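/- Let $n\ge 2$, let $B_n$ be the braid group with Artin generators $\sigma_1,\dots,\sigma_{n-1}$, let $a_{i,j}=(\sigma_{j-1}\cdots\sigma_{i+1})\sigma_i(\sigma_{j-1}\cdots\sigma_{i+1})^{-1}$ ($1\le i<j\le n$) be the band generators, and let $B_n^{+*}$ be the dual braid monoid, the submonoid of $B_n$ they generate. For $I\subset\{1,\dots,n\}$ let $B_I^{+*}$ be the submonoid generated by the $a_{i,j}$ with $i,j\in I$, and put $B_{(i)}^{+*}=B^{+*}_{\{1,\dots,n\}\setminus\{i\}}$. Let $\phi$ be the automorphism $a_{i,j}\mapsto a_{i+1,j+1}$ (indices modulo $n$), and let $i^*\in\{1,\dots,n\}$ be congruent to $n-i$ modulo $n$. Then $\phi^i$ identifies $B_{(i^*)}^{+*}$ with $B_{n-1}^{+*}$, and $\phi^{-m+1}$ identifies $B_{\{m,\dots,M\}}^{+*}$ with $B_{M-m+1}^{+*}$. **Orderings.** A normal finite Thurston type ordering $<$ of $B_n$ is given by a permutation $\mathbf k=(k(1),\dots,k(n-1))$ of $\{1,\dots,n-1\}$: the $i$-th arc of the curve diagram that defines $<$ separates the punctures $1,\dots,k(i)$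 from $k(i)+1,\dots,n$. All notions below depend on $<$ only through $\mathbf k$. The trivial permutation gives the Dehornoy ordering. The restriction of $\mathbf k$ to $\{m,\dots,M\}$ is the subsequence of the entries $k(i)$ with $m\le k(i)<M$, each lowered by $m-1$; it represents the restriction of $<$ to the braids on the punctures $m,\dots,M$. For $1\le j\le n-2$ let $$m_j=\max\big(\{1\}\cup\{k(i)+1: i\le j,\ k(i)<k(j+1)\}\big),\qquad M_j=\min\big(\{n\}\cup\{k(i): i\le j,\ k(i)>k(j+1)\}\big),$$ $I_j=\{m_j,\dots,M_j\}$, let $\mathbf k_j$ be the restriction of $\mathbf k$ to $I_j$, and let $\mathbf k_0$ be its restriction to $\{1,\dots,n-1\}$. **$\mathcal C$-normal form.** For $n=2$, the code of the word $a_{1,2}^p$ is the integer $p$. For $n\ge3$, a code of a word $W$ in the band generators, with respect to $\mathbf k$, arises from a factorization into subwords $W=A_m\cdots A_1A_0X_1\cdots X_{n-2}$, where $A_i$ is a word of $B_{(i^*)}^{+*}$ and $X_j$ a word of $B_{I_j}^{+*}$. It consists of a code of $\phi^i(A_i)$ with respect to the Dehornoy ordering of $B_{n-1}$ for each $i\ge1$,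 a code of $A_0$ with respect to $\mathbf k_0$, and a code of $X_j$ (as a word of $B_{M_j-m_j+1}^{+*}$) with respect to $\mathbf k_j$ for each $j$; here $A_i$ is empty for $i>m$. Codes are compared by $<_{right}$: integers as usual, and for $n\ge 3$ lexicographically, recursively, the codes of $X_{n-2},\dots,X_1,A_0,A_1,A_2,\dots$ being compared in this order. The $\mathcal C$-normal form of $\beta\in B_n^{+*}$ is the word representing $\beta$ that has the $<_{right}$-maximal code among all codes of all words representing $\beta$. **Normal forms by maximal right divisors.** For a submonoid $N\subset B_n^{+*}$, $\beta\wedge N$ is the element $\beta'\in N$ such that $\beta\beta'^{-1}\in B_n^{+*}$ and, for every $\gamma\in N$ with $\beta\gamma^{-1}\in B_n^{+*}$, $\beta'\gamma^{-1}\in N$. The *rotating normal form* $N(\beta)$ is $a_{1,2}^p$ for $\beta=a_{1,2}^p\in B_2^{+*}$. For $n\ge3$ one writes $\beta=\beta_m\cdots\beta_0\beta_{-1}$ with $\beta_{-1}=\beta\wedge B_{(1)}^{+*}$ and $\beta_i=(\beta\,\beta_{-1}^{-1}\beta_0^{-1}\cdots\beta_{i-1}^{-1})\wedge B_{(i^*)}^{+*}$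 for $i\ge0$, and $N(\beta)=N(\beta_m)\cdots N(\beta_0)N(\beta_{-1})$, where $N(\beta_i)$ is computed in $B_{n-1}^{+*}$ through the identification $\phi^i$. The *$\mathbf k$-tail twisted rotating normal form* $\widetilde N(\beta;\mathbf k)$ is $a_{1,2}^p$ for $\beta=a_{1,2}^p\in B_2^{+*}$. For $n\ge3$ put $$\beta_{Tail}=\beta\wedge\big(B_{\{1,\dots,k(1)\}}^{+*}\times B_{\{k(1)+1,\dots,n\}}^{+*}\big),\quad \beta_{T_0}=(\beta\beta_{Tail}^{-1})\wedge B_{(n)}^{+*},\quad \beta_{Main}=\beta\beta_{Tail}^{-1}\beta_{T_0}^{-1},$$ $\beta_{T_j}=(\beta_{Tail}\,\beta_{T_{n-2}}^{-1}\cdots\beta_{T_{j+1}}^{-1})\wedge B_{I_j}^{+*}$ for $j=n-2,\dots,1$, and $\beta_{Main}=\beta_l\cdots\beta_2\beta_1$ with $\beta_i=(\beta_{Main}\,\beta_1^{-1}\cdots\beta_{i-1}^{-1})\wedge B_{(i^*)}^{+*}$ for $i\ge1$. Then $$\widetilde N(\beta;\mathbf k)=N(\beta_l)\cdots N(\beta_1)\,\widetilde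 N(\beta_{T_0};\mathbf k_0)\,\widetilde N(\beta_{T_1};\mathbf k_1)\cdots\widetilde N(\beta_{T_{n-2}};\mathbf k_{n-2}),$$ each factor being computed on fewer strands through the identifications above. **Proposition.** Let $<$ be the normal finite Thurston type ordering of $B_n$ represented by the permutation $\mathbf k$. Then for every $\beta\in B_n^{+*}$ the $\mathcal C$-normal form of $\beta$ with respect to $<$ and the $\mathbf k$-tail twisted rotating normal form of $\beta$ both exist, are unique, and are the same word. -/

import Mathlib

namespace DualBraid

/-! ### Braid groups, band generators, dual braid monoids -/

/-- The Artin relations of the braid group on `n` strands, with generators indexed by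
`1, …, n - 1`. -/
def artinRels (n : ℕ) : Set (FreeGroup {i : ℕ // 1 ≤ i ∧ i < n}) :=
  {r | ∃ i j : {i : ℕ // 1 ≤ i ∧ i < n}, (i : ℕ) + 2 ≤ (j : ℕ) ∧
      r = FreeGroup.of i * FreeGroup.of j * (FreeGroup.of j * FreeGroup.of i)⁻¹} ∪
  {r | ∃ i j : {i : ℕ // 1 ≤ i ∧ i < n}, (j : ℕ) = (i : ℕ) + 1 ∧
      r = FreeGroup.of i * FreeGroup.of j * FreeGroup.of i *
        (FreeGroup.of j * FreeGroup.of i * FreeGroup.of j)⁻¹}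

/-- The braid group `B_n`. -/
abbrev BraidGroup (n : ℕ) : Type := PresentedGroup (artinRels n)

/-- The Artin generator `σ_i`, `1 ≤ i ≤ n - 1` (the value `1` outside this range is not used). -/
def sigma (n i : ℕ) : BraidGroup n :=
  if h : 1 ≤ i ∧ i < n then PresentedGroup.of ⟨i, h⟩ else 1

/-- The band generator
`a_{i,j} = (σ_{j-1} σ_{j-2} ⋯ σ_{i+1}) σ_i (σ_{j-1} σ_{j-2} ⋯ σ_{i+1})⁻¹`, for `1 ≤ i < j ≤ n`. -/
def band (n i j : ℕ) : BraidGroup n :=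
  ((List.range' (i + 1) (j - 1 - i)).reverse.map (sigma n)).prod * sigma n i *
    (((List.range' (i + 1) (j - 1 - i)).reverse.map (sigma n)).prod)⁻¹

/-- The list `1, 2, …, n` of all punctures. -/
def punctures (n : ℕ) : List ℕ := List.range' 1 n

/-- The submonoid `B_I^{+*}` of `B_n` generated by the `a_{i,j}` with `i < j` in `I`. -/
def parabolic (n : ℕ) (I : List ℕ) : Submonoid (BraidGroup n) :=
  Submonoid.closure {x | ∃ i j, i ∈ I ∧ j ∈ I ∧ i < j ∧ x = band n i j}

/-- The dual braid monoid `B_n^{+*}`. -/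
def dualMonoid (n : ℕ) : Submonoid (BraidGroup n) := parabolic n (punctures n)

/-- Words in the band generators; the letter `(i, j)` with `i < j` stands for `a_{i,j}`. -/
abbrev Word : Type := List (ℕ × ℕ)

/-- The braid represented by a word. -/
def Word.eval (n : ℕ) (W : Word) : BraidGroup n := (W.map fun p => band n p.1 p.2).prod

/-- The word `a_{p,q}^e`, where `p ≠ q` are punctures in any order. -/
def powWord (p q e : ℕ) : Word := List.replicate e (min p q, max p q)

/-! ### Configurations of punctures

A list `L = (p_1, …, p_r)` of punctures in anticlockwise order stands for the disc with these `r`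
punctures: `B_L^{+*}` is identified with `B_r^{+*}`, the puncture `p_x` playing the role of the
puncture `x`. Identifying a smaller submonoid with a dual braid monoid by a power of the rotation
`φ` (`a_{x,y} ↦ a_{x+1,y+1}`, indices mod `r`) amounts to listing its punctures from the right
starting point. -/

/-- The punctures of `B_{(i^*)}^{+*}`, `i^* = r - i` mod `r`, listed so that the position of each
puncture in the new list is the index given to it by `φ^i`: the puncture `p_{[x-i]}`,
`x = 1, …, r - 1`, comes in position `x`, and `p_{[r-i]}` is left out. -/
def omitStar (L : List ℕ) (i : ℕ) : List ℕ :=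
  (L.rotate (L.length - i % L.length)).dropLast

/-- The punctures `p_m, p_{m+1}, …, p_M`, listed according to the identification `φ^{-m+1}`. -/
def interval (L : List ℕ) (m M : ℕ) : List ℕ := (L.drop (m - 1)).take (M - m + 1)

/-! ### Normal orderings

A normal finite Thurston type ordering of `B_r` is given by a permutation of `1, …, r - 1`, written
as the sequence `k = (k(1), …, k(r-1))`: its `i`-th arc separates the punctures `1, …, k(i)` from
the punctures `k(i)+1, …, r`. -/

/-- The trivial permutation `(1, 2, …, r - 1)`, which gives the Dehornoy ordering of `B_r`. -/
def dehornoy (r : ℕ) : List ℕ := List.range' 1 (r - 1)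

/-- The permutation of the restriction of the ordering `k` to the braids on the punctures
`m, …, M`: keep, in their order, the arcs that separate two of these punctures, and renumber the
punctures `m, …, M` as `1, …, M - m + 1`. -/
def restrict (k : List ℕ) (m M : ℕ) : List ℕ :=
  (k.filter fun x => decide (m ≤ x ∧ x < M)).map fun x => x - (m - 1)

/-- `k(i)` for `i ≥ 1`. -/
def entry (k : List ℕ) (i : ℕ) : ℕ := k.getD (i - 1) 0

/-- `m_j = max {1, k(i) + 1 | i = 1, …, j, k(i) < k(j+1)}`. -/
def lo (k : List ℕ) (j : ℕ) : ℕ :=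
  (((k.take j).filter fun x => decide (x < entry k (j + 1))).map (· + 1)).foldr max 1

/-- `M_j = min {r, k(i) | i = 1, …, j, k(i) > k(j+1)}`. -/
def hi (r : ℕ) (k : List ℕ) (j : ℕ) : ℕ :=
  ((k.take j).filter fun x => decide (entry k (j + 1) < x)).foldr min r

/-- The punctures `I_j = {m_j, …, M_j}`. -/
def tailPunctures (L k : List ℕ) (j : ℕ) : List ℕ :=
  interval L (lo k j) (hi L.length k j)

/-- The permutation of the restriction of the ordering `k` to the braids on `I_j`. -/
def tailPerm (L k : List ℕ) (j : ℕ) : List ℕ := restrict k (lo k j) (hi L.length k j)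

/-! ### Codes -/

/-- Codes: an integer on two strands; on `r ≥ 3` strands, the left-infinite sequence
`(…, C(A_1), C(A_0))` together with the sequence `(C(X_1), …, C(X_{r-2}))`. In `node A X` these are
`A i`, `i ≥ 0`, and `X j`, `1 ≤ j ≤ r - 2` (the other values of `X` are set to `int 0`). -/
inductive Code : Type
  | int (p : ℕ) : Code
  | node (A X : ℕ → Code) : Code

/-- The lexicographical ordering from the right, `<_right`. -/
inductive Code.LtRight : Code → Code → Prop
  | int {p q : ℕ} (h : p < q) : Code.LtRight (.int p) (.int q)
  | tail {A X A' X' : ℕ → Code} (l : ℕ) (heq : ∀ j, l < j → X j = X' j)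
      (hlt : Code.LtRight (X l) (X' l)) : Code.LtRight (.node A X) (.node A' X')
  | main {A X A' : ℕ → Code} (l : ℕ) (heq : ∀ i, i < l → A i = A' i)
      (hlt : Code.LtRight (A l) (A' l)) : Code.LtRight (.node A X) (.node A' X)

/-- `HasCode L k W C`: `C` is the code, with respect to the normal ordering `k`, of some
decomposition of the word `W` on the punctures `L` into subwords
`W = A_m ⋯ A_1 A_0 X_1 ⋯ X_{r-2}`, where `A_i` is a word of `B_{(i^*)}^{+*}` and `X_j` a word of
`B_{I_j}^{+*}`, which are themselves decomposed. -/
inductive HasCode : List ℕ → List ℕ → Word → Code → Prop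
  | two (p q e : ℕ) : HasCode [p, q] [1] (powWord p q e) (.int e)
  | step (L k : List ℕ) (W : Word) (m : ℕ) (A X : ℕ → Word) (cA cX : ℕ → Code)
      (hL : 3 ≤ L.length)
      (hW : W = ((List.range (m + 1)).reverse.map A).flatten ++
        ((List.range' 1 (L.length - 2)).map X).flatten)
      (hm : ∀ i, m < i → A i = [])
      (hA0 : HasCode L.dropLast (restrict k 1 (L.length - 1)) (A 0) (cA 0))
      (hA : ∀ i, 1 ≤ i → HasCode (omitStar L i) (dehornoy (L.length - 1)) (A i) (cA i))
      (hX : ∀ j, 1 ≤ j → j ≤ L.length - 2 →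
        HasCode (tailPunctures L k j) (tailPerm L k j) (X j) (cX j))
      (hX' : ∀ j, ¬ (1 ≤ j ∧ j ≤ L.length - 2) → cX j = .int 0) :
      HasCode L k W (.node cA cX)

/-- `W` is the `C`-normal form of `β ∈ B_n^{+*}` with respect to the normal finite Thurston type
ordering given by `k`: it represents `β`, and it has a code that is maximal with respect to
`<_right` among all codes of all words that represent `β`. -/
def IsCNormalForm (n : ℕ) (k : List ℕ) (β : BraidGroup n) (W : Word) : Prop :=
  Word.eval n W = β ∧ ∃ C, HasCode (punctures n) k W C ∧
    ∀ W' C', Word.eval n W' = β → HasCode (punctures n) k W' C' → C' = C ∨ Code.LtRight C' C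

/-! ### Rotating and tail twisted rotating normal forms -/

/-- `β'` is the maximal right divisor in the submonoid `N` of the element `β` of the monoid `M`. -/
def IsMaxRightDivisor {G : Type*} [Group G] (M N : Submonoid G) (β β' : G) : Prop :=
  β' ∈ N ∧ β * β'⁻¹ ∈ M ∧ ∀ γ ∈ N, β * γ⁻¹ ∈ M → β' * γ⁻¹ ∈ N

/-- `β = β_m β_{m-1} ⋯ β_s`, where `β_i = (β β_s⁻¹ β_{s+1}⁻¹ ⋯ β_{i-1}⁻¹) ∧ B_{(i^*)}^{+*}`. -/
def IsRotatingDecomposition (n : ℕ) (L : List ℕ) (s m : ℕ) (β : BraidGroup n)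
    (b : ℕ → BraidGroup n) : Prop :=
  (∀ i, s ≤ i → i ≤ m → IsMaxRightDivisor (parabolic n L) (parabolic n (omitStar L i))
    (β * ((List.range' s (i - s)).map fun l => (b l)⁻¹).prod) (b i)) ∧
  β = ((List.range' s (m + 1 - s)).reverse.map b).prod

/-- `IsRotatingNF n L β W`: `W` is the rotating normal form of `β ∈ B_L^{+*}`. Here `t` is
`β_{-1} = β ∧ B_{(1)}^{+*}` and `b i` is `β_i`, `i ≥ 0`. -/
inductive IsRotatingNF (n : ℕ) : List ℕ → BraidGroup n → Word → Prop
  | two (p q e : ℕ) : IsRotatingNF n [p, q] (Word.eval n (powWord p q e)) (powWord p q e)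
  | step (L : List ℕ) (β t : BraidGroup n) (m : ℕ) (b : ℕ → BraidGroup n)
      (W U : Word) (V : ℕ → Word)
      (hL : 3 ≤ L.length)
      (ht : IsMaxRightDivisor (parabolic n L) (parabolic n L.tail) β t)
      (hb : IsRotatingDecomposition n L 0 m (β * t⁻¹) b)
      (hU : IsRotatingNF n L.tail t U)
      (hV : ∀ i, i ≤ m → IsRotatingNF n (omitStar L i) (b i) (V i))
      (hW : W = ((List.range (m + 1)).reverse.map V).flatten ++ U) :
      IsRotatingNF n L β W

/-- `IsTailTwistedNF n L k β W`: `W` is the `k`-tail twisted rotating normal form of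
`β ∈ B_L^{+*}`. Here `tail` is `β_Tail`, `t 0` is `β_{T_0}`, `t j` is `β_{T_j}` for
`1 ≤ j ≤ r - 2`, and `β_Main = β tail⁻¹ (t 0)⁻¹ = β_m ⋯ β_2 β_1` is the rotating decomposition of
`β_Main` without its two terms `β_{-1}`, `β_0`; `V i` is the rotating normal form of `β_i`. -/
inductive IsTailTwistedNF (n : ℕ) : List ℕ → List ℕ → BraidGroup n → Word → Prop
  | two (p q e : ℕ) : IsTailTwistedNF n [p, q] [1] (Word.eval n (powWord p q e)) (powWord p q e)
  | step (L k : List ℕ) (β tail : BraidGroup n) (t : ℕ → BraidGroup n) (m : ℕ)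
      (b : ℕ → BraidGroup n) (W : Word) (V U : ℕ → Word)
      (hL : 3 ≤ L.length)
      (htail : IsMaxRightDivisor (parabolic n L)
        (parabolic n (L.take (entry k 1)) ⊔ parabolic n (L.drop (entry k 1))) β tail)
      (ht0 : IsMaxRightDivisor (parabolic n L) (parabolic n L.dropLast) (β * tail⁻¹) (t 0))
      (ht : ∀ j, 1 ≤ j → j ≤ L.length - 2 →
        IsMaxRightDivisor (parabolic n L) (parabolic n (tailPunctures L k j))
          (tail * ((List.range' (j + 1) (L.length - 2 - j)).reverse.map fun l => (t l)⁻¹).prod)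
          (t j))
      (hb : IsRotatingDecomposition n L 1 m (β * tail⁻¹ * (t 0)⁻¹) b)
      (hV : ∀ i, 1 ≤ i → i ≤ m → IsRotatingNF n (omitStar L i) (b i) (V i))
      (hU0 : IsTailTwistedNF n L.dropLast (restrict k 1 (L.length - 1)) (t 0) (U 0))
      (hU : ∀ j, 1 ≤ j → j ≤ L.length - 2 →
        IsTailTwistedNF n (tailPunctures L k j) (tailPerm L k j) (t j) (U j))
      (hW : W = ((List.range' 1 m).reverse.map V).flatten ++
        ((List.range (L.length - 1)).map U).flatten) :
      IsTailTwistedNF n L k β W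

end DualBraid

/-! Both normal forms come out of one greedy algorithm. Number the subwords of a decomposition from
the right, X_{r-2}, …, X_1, A_0, A_1, …, and let J_s be the set of punctures available to the s-th
one (`stage`). Starting from β, split off at stage s the maximal right divisor g_s, in the monoid of
J_s, of the quotient that is left (`IsGreedy`). The length of the quotient cannot drop forever, and
every pair of punctures lies in arbitrarily late J_s, so the quotient becomes 1
(`IsGreedy.eventually_one`).

Greedy words have maximal codes (`IsGreedy.isMaximalCode`). Prefixing a letter to a word raises its
codes, so a code of a right divisor of an element never exceeds the maximal code of that element
(`IsMaximalCode.le_of_mul_inv_mem`). At the first entry from the right where a competing code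
differs from the greedy one, the competing subword right divides the remaining quotient, hence
divides g_s, hence has the smaller code. A code determines its word, which gives uniqueness.

Greedy words are tail twisted rotating normal forms (`IsGreedy.isTailTwistedNF`). Let J consist of
the first k(1) punctures and J' of the others. Every I_j lies in J or in J', and each of J, J' is
itself some I_j as soon as it has two punctures. So the quotient left after the tail stages has no
right divisor in the product of the monoids of J and J', and the tail factors multiply to β_Tail.
The other factors agree by definition, except that for i ≥ 1 the word A_i is taken for the Dehornoy
ordering on one side and is a rotating normal form on the other; `IsTailTwistedNF.isRotatingNF`
reconciles the two.

All this needs maximal right divisors, hence the Garside structure of the dual braid monoid, which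
is built here from the Birman–Ko–Lee presentation. A noncrossing partition has a simple element, and
letting the letters of a word act on partitions gives a head partition (`headPart`) that depends
only on the element represented. The central lemma `exists_mul_simpleDiv` says that if x a_e = y
a_{e'}, then x and y have a common left factor q, followed by what remains of the simple element of
the head when e, respectively e', is divided out. This yields right cancellation and local least
common multiples (`exists_lcm_atom`). A reflection gives left cancellation and powers of the Garside
element give common multiples, so the monoid embeds into a group of fractions. The images of the
a_{i,i+1} there satisfy the Artin relations, so this embedding factors through B_n and the presented
monoid is the dual braid monoid (`exists_hom_braidGroup`). Induction on the length then gives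
`exists_isMaxRightDivisor`. -/

namespace DualBraid

/-! ### The presentation of the dual braid monoid -/

/-- The chords of `{1, …, n}`, which index the band generators. -/
abbrev Chord (n : ℕ) : Type := {p : ℕ × ℕ // 1 ≤ p.1 ∧ p.1 < p.2 ∧ p.2 ≤ n}

/-- The chord with end points `i < j`. -/
abbrev Chord.mk {n i j : ℕ} (h1 : 1 ≤ i) (h2 : i < j) (h3 : j ≤ n) : Chord n :=
  ⟨(i, j), h1, h2, h3⟩

/-- The Birman–Ko–Lee relations. -/
inductive BKLRel (n : ℕ) : FreeMonoid (Chord n) → FreeMonoid (Chord n) → Prop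
  | tri_left {r s t : ℕ} (hr : 1 ≤ r) (hrs : r < s) (hst : s < t) (ht : t ≤ n) :
      BKLRel n (.of (.mk (hr.trans hrs.le) hst ht) * .of (.mk hr hrs (hst.le.trans ht)))
        (.of (.mk hr (hrs.trans hst) ht) * .of (.mk (hr.trans hrs.le) hst ht))
  | tri_right {r s t : ℕ} (hr : 1 ≤ r) (hrs : r < s) (hst : s < t) (ht : t ≤ n) :
      BKLRel n (.of (.mk (hr.trans hrs.le) hst ht) * .of (.mk hr hrs (hst.le.trans ht)))
        (.of (.mk hr hrs (hst.le.trans ht)) * .of (.mk hr (hrs.trans hst) ht))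
  | disjoint {i j k l : ℕ} (hi : 1 ≤ i) (hij : i < j) (hjk : j < k) (hkl : k < l) (hl : l ≤ n) :
      BKLRel n
        (.of (.mk hi hij ((hjk.trans hkl).le.trans hl)) *
          .of (.mk (hi.trans (hij.trans hjk).le) hkl hl))
        (.of (.mk (hi.trans (hij.trans hjk).le) hkl hl) *
          .of (.mk hi hij ((hjk.trans hkl).le.trans hl)))
  | nested {i j k l : ℕ} (hi : 1 ≤ i) (hik : i < k) (hkl : k < l) (hlj : l < j) (hj : j ≤ n) :
      BKLRel n
        (.of (.mk hi (hik.trans (hkl.trans hlj)) hj) *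
          .of (.mk (hi.trans hik.le) hkl (hlj.le.trans hj)))
        (.of (.mk (hi.trans hik.le) hkl (hlj.le.trans hj)) *
          .of (.mk hi (hik.trans (hkl.trans hlj)) hj))

/-- The monoid presented by the Birman–Ko–Lee relations. -/
abbrev BKLMonoid (n : ℕ) : Type := PresentedMonoid (BKLRel n)

/-- The generator of the Birman–Ko–Lee monoid given by a chord (`1` if there is no such chord). -/
def atom (n i j : ℕ) : BKLMonoid n :=
  if h : 1 ≤ i ∧ i < j ∧ j ≤ n then PresentedMonoid.of _ ⟨(i, j), h⟩ else 1

theorem atom_eq {n : ℕ} (e : Chord n) : atom n e.1.1 e.1.2 = PresentedMonoid.of _ e := by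
  rw [atom, dif_pos e.2]

theorem atom_tri_left {n r s t : ℕ} (hr : 1 ≤ r) (hrs : r < s) (hst : s < t) (ht : t ≤ n) :
    atom n s t * atom n r s = atom n r t * atom n s t := by
  have h := PresentedMonoid.mk_eq_mk_of_rel (BKLRel.tri_left hr hrs hst ht)
  rw [map_mul, map_mul] at h
  rw [atom, atom, atom, dif_pos ⟨by omega, by omega, by omega⟩,
    dif_pos ⟨by omega, by omega, by omega⟩, dif_pos ⟨by omega, by omega, by omega⟩]
  exact h

theorem atom_tri_right {n r s t : ℕ} (hr : 1 ≤ r) (hrs : r < s) (hst : s < t) (ht : t ≤ n) :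
    atom n s t * atom n r s = atom n r s * atom n r t := by
  have h := PresentedMonoid.mk_eq_mk_of_rel (BKLRel.tri_right hr hrs hst ht)
  rw [map_mul, map_mul] at h
  rw [atom, atom, atom, dif_pos ⟨by omega, by omega, by omega⟩,
    dif_pos ⟨by omega, by omega, by omega⟩, dif_pos ⟨by omega, by omega, by omega⟩]
  exact h

/-- The chords `{i, j}` and `{k, l}`, `i < j`, `k < l`, are disjoint and do not cross. -/
def Apart (i j k l : ℕ) : Prop :=
  j < k ∨ l < i ∨ (i < k ∧ l < j) ∨ (k < i ∧ j < l)

theorem atom_comm {n i j k l : ℕ} (h : Apart i j k l) :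
    atom n i j * atom n k l = atom n k l * atom n i j := by
  by_cases h1 : 1 ≤ i ∧ i < j ∧ j ≤ n
  swap
  · rw [atom, dif_neg h1, one_mul, mul_one]
  by_cases h2 : 1 ≤ k ∧ k < l ∧ l ≤ n
  swap
  · rw [atom, atom, dif_neg h2, one_mul, mul_one]
  rw [atom, atom, dif_pos h1, dif_pos h2]
  obtain ⟨hi, hij, hj⟩ := h1
  obtain ⟨hk, hkl, hl⟩ := h2
  rcases h with h | h | h | h
  · exact PresentedMonoid.mk_eq_mk_of_rel (BKLRel.disjoint hi hij h hkl hl)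
  · exact (PresentedMonoid.mk_eq_mk_of_rel (BKLRel.disjoint hk hkl h hij hj)).symm
  · exact PresentedMonoid.mk_eq_mk_of_rel (BKLRel.nested hi h.1 hkl h.2 hj)
  · exact (PresentedMonoid.mk_eq_mk_of_rel (BKLRel.nested hk h.1 hij h.2 hl)).symm

/-- A map on chords that satisfies the Birman–Ko–Lee relations extends to the monoid. -/
theorem exists_bklMonoid_hom {M : Type*} [Monoid M] (n : ℕ) (f : ℕ → ℕ → M)
    (h1 : ∀ r s t, 1 ≤ r → r < s → s < t → t ≤ n → f s t * f r s = f r t * f s t)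
    (h2 : ∀ r s t, 1 ≤ r → r < s → s < t → t ≤ n → f s t * f r s = f r s * f r t)
    (h3 : ∀ i j k l, 1 ≤ i → i < j → 1 ≤ k → k < l → j ≤ n → l ≤ n → Apart i j k l →
      f i j * f k l = f k l * f i j) :
    ∃ F : BKLMonoid n →* M, ∀ i j, 1 ≤ i → i < j → j ≤ n → F (atom n i j) = f i j := by
  refine ⟨PresentedMonoid.lift (fun e : Chord n => f e.1.1 e.1.2) ?_, ?_⟩
  · rintro _ _ (⟨hr, hrs, hst, ht⟩ | ⟨hr, hrs, hst, ht⟩ | ⟨hi, hij, hjk, hkl, hl⟩ |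
      ⟨hi, hij, hjk, hkl, hl⟩)
    · simpa using h1 _ _ _ hr hrs hst ht
    · simpa using h2 _ _ _ hr hrs hst ht
    · simpa using h3 _ _ _ _ hi hij (by omega) hkl (by omega) hl (.inl hjk)
    · simpa using h3 _ _ _ _ hi (by omega) (by omega) hjk (by omega) (by omega)
        (.inr (.inr (.inl ⟨by omega, by omega⟩)))
  · intro i j hi hij hj
    rw [atom, dif_pos ⟨hi, hij, hj⟩]
    rfl

/-! ### Noncrossing partitions as relations -/

/-- The classes of the relation `R` are the blocks of a noncrossing partition of `{1, …, n}`, all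
other natural numbers being alone in their class. -/
structure Noncrossing (n : ℕ) (R : ℕ → ℕ → Prop) : Prop where
  refl : ∀ x, R x x
  symm : ∀ {x y}, R x y → R y x
  trans : ∀ {x y z}, R x y → R y z → R x z
  one_le : ∀ {x y}, R x y → x ≠ y → 1 ≤ x
  le : ∀ {x y}, R x y → x ≠ y → x ≤ n
  cross : ∀ {x y z w}, x < y → y < z → z < w → R x z → R y w → R x y

/-- Cut all blocks of a partition along `{i, …, j - 1}`. -/
def cut (R : ℕ → ℕ → Prop) (i j : ℕ) : ℕ → ℕ → Prop :=
  fun x y => R x y ∧ ((i ≤ x ∧ x < j) ↔ (i ≤ y ∧ y < j))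

/-- Cut the block of `c` along `{i, …, j - 1}`. -/
def cutBlock (R : ℕ → ℕ → Prop) (c i j : ℕ) : ℕ → ℕ → Prop :=
  fun x y => R x y ∧ (R x c → ((i ≤ x ∧ x < j) ↔ (i ≤ y ∧ y < j)))

/-- Cut all blocks along `{i, …, j - 1}` and join those of `i` and `j`. -/
def act (R : ℕ → ℕ → Prop) (i j : ℕ) : ℕ → ℕ → Prop :=
  fun x y => cut R i j x y ∨
    ((cut R i j x i ∨ cut R i j x j) ∧ (cut R i j y i ∨ cut R i j y j))

theorem Noncrossing.cut {n : ℕ} {R : ℕ → ℕ → Prop} (h : Noncrossing n R) (i j : ℕ) :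
    Noncrossing n (cut R i j) where
  refl x := ⟨h.refl x, Iff.rfl⟩
  symm hx := ⟨h.symm hx.1, hx.2.symm⟩
  trans hx hy := ⟨h.trans hx.1 hy.1, hx.2.trans hy.2⟩
  one_le hx hn := h.one_le hx.1 hn
  le hx hn := h.le hx.1 hn
  cross h1 h2 h3 hx hy := ⟨h.cross h1 h2 h3 hx.1 hy.1, by have := hx.2; have := hy.2; omega⟩

theorem Noncrossing.cutBlock {n : ℕ} {R : ℕ → ℕ → Prop} (h : Noncrossing n R) (c i j : ℕ) :
    Noncrossing n (cutBlock R c i j) where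
  refl x := ⟨h.refl x, fun _ => Iff.rfl⟩
  symm hx := ⟨h.symm hx.1, fun hc => (hx.2 (h.trans hx.1 hc)).symm⟩
  trans hx hy := ⟨h.trans hx.1 hy.1, fun hc => (hx.2 hc).trans (hy.2 (h.trans (h.symm hx.1) hc))⟩
  one_le hx hn := h.one_le hx.1 hn
  le hx hn := h.le hx.1 hn
  cross {x y z w} h1 h2 h3 hx hy := by
    have hxy := h.cross h1 h2 h3 hx.1 hy.1
    refine ⟨hxy, fun hc => ?_⟩
    have := hx.2 hc
    have := hy.2 (h.trans (h.symm hxy) hc)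
    omega

/-- The relation is the kernel of its quotient map. In the form f x = f y, membership in blocks
becomes a matter of congruence closure, so the pointwise identities below reduce to finite case
checks. -/
theorem Noncrossing.exists_map {n : ℕ} {R : ℕ → ℕ → Prop} (h : Noncrossing n R) :
    ∃ (α : Type) (f : ℕ → α), R = fun x y => f x = f y := by
  let s : Setoid ℕ := ⟨R, h.refl, h.symm, h.trans⟩
  refine ⟨Quotient s, Quotient.mk s, ?_⟩
  ext x y
  exact (Quotient.eq (r := s)).symm

theorem crossing_act {n : ℕ} {R : ℕ → ℕ → Prop} (h : Noncrossing n R) {i j : ℕ}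
    (hij : i < j) : ∀ {x y z w}, x < y → y < z → z < w → act R i j x z → act R i j y w →
      act R i j x y := by
  intro x y z w h1 h2 h3 hx hy
  -- The instances of noncrossingness that the case split needs: the four points themselves, and
  -- quadruples in which `i` or `j` stands in for one of them.
  have c1 := @h.cross x y z w h1 h2 h3
  have c2 := @h.cross i x y z
  have c3 := @h.cross x j z w
  have c4 := @h.cross x y z j
  have c5 := @h.cross j y z w
  have c6 := @h.cross i y z w
  have c7 := @h.cross x y j w
  obtain ⟨α, f, rfl⟩ := h.exists_map
  clear h
  simp only [act, DualBraid.cut] at *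
  by_cases hx1 : i ≤ x ∧ x < j <;> by_cases hy1 : i ≤ y ∧ y < j <;>
  by_cases hz1 : i ≤ z ∧ z < j <;> by_cases hw1 : i ≤ w ∧ w < j <;>
  simp only [hx1, hy1, hz1, hw1, hij, le_refl, lt_irrefl, and_true, and_false, or_false, false_or,
    iff_true, iff_false, not_true] at hx hy ⊢ <;>
  grind

theorem Noncrossing.act {n : ℕ} {R : ℕ → ℕ → Prop} (h : Noncrossing n R) {i j : ℕ} (hi : 1 ≤ i)
    (hij : i < j) (hj : j ≤ n) : Noncrossing n (act R i j) := by
  have hc := h.cut i j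
  refine ⟨fun x => .inl (hc.refl x), ?_, ?_, ?_, ?_, ?_⟩
  · rintro x y (hx | hx)
    · exact .inl (hc.symm hx)
    · exact .inr hx.symm
  · rintro x y z (hx | hx) (hy | hy)
    · exact .inl (hc.trans hx hy)
    · exact .inr ⟨hy.1.imp (hc.trans hx) (hc.trans hx), hy.2⟩
    · exact .inr ⟨hx.1, hx.2.imp (hc.trans (hc.symm hy)) (hc.trans (hc.symm hy))⟩
    · exact .inr ⟨hx.1, hy.2⟩
  · rintro x y (hx | ⟨hx | hx, -⟩) hn
    · exact hc.one_le hx hn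
    · by_cases hxi : x = i
      · omega
      · exact hc.one_le hx hxi
    · by_cases hxi : x = j
      · omega
      · exact hc.one_le hx hxi
  · rintro x y (hx | ⟨hx | hx, -⟩) hn
    · exact hc.le hx hn
    · by_cases hxi : x = i
      · omega
      · exact hc.le hx hxi
    · by_cases hxi : x = j
      · omega
      · exact hc.le hx hxi
  · exact crossing_act h hij

/-- The join of the blocks of `i` and `j` is undone by cutting the joined block along the same
interval. On simple elements this is right division by the chord just added. -/
theorem cutBlock_act {n : ℕ} {R : ℕ → ℕ → Prop} (h : Noncrossing n R) {i j : ℕ} (hij : i < j) :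
    cutBlock (act R i j) i i j = cut R i j := by
  obtain ⟨α, f, rfl⟩ := h.exists_map
  ext x y
  simp only [act, cut, cutBlock]
  grind

/-- With the next two lemmas: the action of chords on noncrossing partitions respects the
Birman–Ko–Lee relations, so the partition obtained from a word depends only on the element. -/
theorem act_tri_left {n : ℕ} {R : ℕ → ℕ → Prop} (h : Noncrossing n R) {r s t : ℕ} (hrs : r < s)
    (hst : s < t) : act (act R s t) r s = act (act R r t) s t := by
  obtain ⟨α, f, rfl⟩ := h.exists_map
  ext x y
  simp only [act, cut]
  grind

theorem act_tri_right {n : ℕ} {R : ℕ → ℕ → Prop} (h : Noncrossing n R) {r s t : ℕ} (hrs : r < s)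
    (hst : s < t) : act (act R s t) r s = act (act R r s) r t := by
  obtain ⟨α, f, rfl⟩ := h.exists_map
  ext x y
  simp only [act, cut]
  grind

theorem act_comm {n : ℕ} {R : ℕ → ℕ → Prop} (h : Noncrossing n R) {i j k l : ℕ} (hij : i < j)
    (hkl : k < l) (ha : Apart i j k l) : act (act R i j) k l = act (act R k l) i j := by
  obtain ⟨α, f, rfl⟩ := h.exists_map
  ext x y
  simp only [act, cut]
  unfold Apart at ha
  by_cases hx1 : i ≤ x ∧ x < j <;> by_cases hy1 : i ≤ y ∧ y < j <;>
  by_cases hx2 : k ≤ x ∧ x < l <;> by_cases hy2 : k ≤ y ∧ y < l <;> 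
  simp only [hx1, hy1, hx2, hy2, hij, hkl, le_refl, lt_irrefl, and_true, and_false, or_false,
    false_or, iff_true, true_iff, iff_false, false_iff, not_true] <;>
  grind


/-- Here and in the next two lemmas the right-hand side is the same: whichever of the three products
a_{s,t} a_{r,s}, a_{r,t} a_{s,t}, a_{r,s} a_{r,t} is used, taking away both letters leaves `R` cut
along both intervals. This is how the two sides of a triangle relation get a common left factor. -/
theorem cutBlock_cut_act_st {n : ℕ} {R : ℕ → ℕ → Prop} (h : Noncrossing n R) {r s t : ℕ}
    (hrs : r < s) (hst : s < t) :
    cutBlock (cut (act R s t) r s) s s t = cut (cut R r s) s t := by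
  obtain ⟨α, f, rfl⟩ := h.exists_map
  ext x y
  simp only [cutBlock, cut, act]
  grind

theorem cutBlock_cut_act_rt {n : ℕ} {R : ℕ → ℕ → Prop} (h : Noncrossing n R) {r s t : ℕ}
    (hrs : r < s) (hst : s < t) :
    cutBlock (cut (act R r t) s t) r r t = cut (cut R r s) s t := by
  obtain ⟨α, f, rfl⟩ := h.exists_map
  ext x y
  simp only [cutBlock, cut, act]
  grind

theorem cutBlock_cut_act_rs {n : ℕ} {R : ℕ → ℕ → Prop} (h : Noncrossing n R) {r s t : ℕ}
    (hrs : r < s) (hst : s < t) :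
    cutBlock (cut (act R r s) r t) r r s = cut (cut R r s) s t := by
  obtain ⟨α, f, rfl⟩ := h.exists_map
  ext x y
  simp only [cutBlock, cut, act]
  grind

theorem cutBlock_cut_act_apart {n : ℕ} {R : ℕ → ℕ → Prop} (h : Noncrossing n R) {i j k l : ℕ}
    (hij : i < j) (hkl : k < l) (ha : Apart i j k l) :
    cutBlock (cut (act R i j) k l) i i j = cut (cut R i j) k l := by
  obtain ⟨α, f, rfl⟩ := h.exists_map
  ext x y
  simp only [cutBlock, cut, act]
  unfold Apart at ha
  grind

theorem cut_comm (R : ℕ → ℕ → Prop) (i j k l : ℕ) :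
    cut (cut R i j) k l = cut (cut R k l) i j := by
  ext x y
  simp only [cut]
  tauto

/-- The partition counterpart of the triangle relations under right division: dividing by a_{r,s}
and then a_{s,t} has the same effect as dividing by a_{s,t} and then a_{r,t}. -/
theorem cutBlock_rs_st {n : ℕ} {R : ℕ → ℕ → Prop} (h : Noncrossing n R) {r s t : ℕ}
    (hrs : r < s) (hst : s < t) (h1 : R r s) (h2 : R s t) :
    cutBlock (cutBlock R r r s) s s t = cutBlock (cutBlock R s s t) r r t := by
  obtain ⟨α, f, rfl⟩ := h.exists_map
  ext x y
  simp only [cutBlock]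
  grind

theorem cutBlock_rs_rt {n : ℕ} {R : ℕ → ℕ → Prop} (h : Noncrossing n R) {r s t : ℕ}
    (hrs : r < s) (hst : s < t) (h1 : R r s) (h2 : R s t) :
    cutBlock (cutBlock R r r s) s s t = cutBlock (cutBlock R r r t) r r s := by
  obtain ⟨α, f, rfl⟩ := h.exists_map
  ext x y
  simp only [cutBlock]
  grind

theorem cutBlock_comm {n : ℕ} {R : ℕ → ℕ → Prop} (h : Noncrossing n R) {i j k l : ℕ} (hij : i < j)
    (hkl : k < l) (ha : Apart i j k l) (h1 : R i j) (h2 : R k l) :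
    cutBlock (cutBlock R i i j) k k l = cutBlock (cutBlock R k k l) i i j := by
  obtain ⟨α, f, rfl⟩ := h.exists_map
  ext x y
  simp only [cutBlock]
  unfold Apart at ha
  grind

/-- The chords {i, j} and {k, l} cross. Dividing by a_{j,l} a_{i,k} a_{i,j} or by a_{i,l} a_{k,j}
a_{k,l}, from the right, leaves the same partition; these two products serve as the common multiple
of the crossing chords. -/
theorem cutBlock_cross {n : ℕ} {R : ℕ → ℕ → Prop} (h : Noncrossing n R) {i j k l : ℕ} (hik : i < k)
    (hkj : k < j) (hjl : j < l) (h1 : R i k) (h2 : R k j) (h3 : R j l) :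
    cutBlock (cutBlock (cutBlock R i i j) i i k) j j l =
      cutBlock (cutBlock (cutBlock R k k l) k k j) i i l := by
  obtain ⟨α, f, rfl⟩ := h.exists_map
  ext x y
  simp only [cutBlock]
  grind

/-! ### Simple elements -/

/-- `q` is the predecessor of `p` in its block. -/
def IsPred (R : ℕ → ℕ → Prop) (q p : ℕ) : Prop :=
  q < p ∧ R q p ∧ ∀ x, q < x → x < p → ¬ R x p

theorem exists_isPred {R : ℕ → ℕ → Prop} {x p : ℕ} (h : x < p) (hR : R x p) :
    ∃ q, x ≤ q ∧ IsPred R q p := by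
  classical
  have h0 : R (Nat.findGreatest (fun q => R q p) (p - 1)) p :=
    Nat.findGreatest_spec (P := fun q => R q p) (by omega : x ≤ p - 1) hR
  have h1 := Nat.findGreatest_le (P := fun q => R q p) (p - 1)
  refine ⟨_, Nat.le_findGreatest (by omega) hR, by omega, h0, fun y hy hp hRy => ?_⟩
  exact Nat.findGreatest_is_greatest hy (by omega) hRy

theorem IsPred.unique {R : ℕ → ℕ → Prop} {q q' p : ℕ} (h : IsPred R q p) (h' : IsPred R q' p) :
    q = q' := by
  rcases lt_trichotomy q q' with hlt | heq | hlt
  · exact absurd h'.2.1 (h.2.2 _ hlt h'.1)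
  · exact heq
  · exact absurd h.2.1 (h'.2.2 _ hlt h.1)

open Classical in
/-- The generator that joins `p` to its predecessor (`1` if `p` is the first of its block). -/
noncomputable def letter (n : ℕ) (R : ℕ → ℕ → Prop) (p : ℕ) : BKLMonoid n :=
  if h : ∃ q, IsPred R q p then atom n h.choose p else 1

theorem letter_eq {n : ℕ} {R : ℕ → ℕ → Prop} {q p : ℕ} (h : IsPred R q p) :
    letter n R p = atom n q p := by
  have h' : ∃ q, IsPred R q p := ⟨q, h⟩
  rw [letter, dif_pos h', h'.choose_spec.unique h]

theorem letter_eq_one {n : ℕ} {R : ℕ → ℕ → Prop} {p : ℕ} (h : ∀ q, q < p → ¬ R q p) :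
    letter n R p = 1 := by
  rw [letter, dif_neg]
  rintro ⟨q, h1, h2, -⟩
  exact h q h1 h2

theorem letter_cases (n : ℕ) (R : ℕ → ℕ → Prop) (p : ℕ) :
    ((∀ q, q < p → ¬ R q p) ∧ letter n R p = 1) ∨ ∃ q, IsPred R q p ∧ letter n R p = atom n q p := by
  by_cases h : ∃ q, q < p ∧ R q p
  · obtain ⟨x, hx, hR⟩ := h
    obtain ⟨q, -, hq⟩ := exists_isPred hx hR
    exact .inr ⟨q, hq, letter_eq hq⟩
  · push Not at h
    exact .inl ⟨h, letter_eq_one h⟩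

theorem isPred_congr {R R' : ℕ → ℕ → Prop} {p : ℕ} (h : ∀ q, q < p → (R q p ↔ R' q p)) (q : ℕ) :
    IsPred R q p ↔ IsPred R' q p := by
  constructor
  · rintro ⟨h1, h2, h3⟩
    exact ⟨h1, (h q h1).1 h2, fun x hx hp hR => h3 x hx hp ((h x hp).2 hR)⟩
  · rintro ⟨h1, h2, h3⟩
    exact ⟨h1, (h q h1).2 h2, fun x hx hp hR => h3 x hx hp ((h x hp).1 hR)⟩

theorem letter_congr_isPred {n : ℕ} {R R' : ℕ → ℕ → Prop} {p : ℕ}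
    (h : ∀ q, IsPred R q p ↔ IsPred R' q p) : letter n R p = letter n R' p := by
  rcases letter_cases n R p with ⟨h1, h2⟩ | ⟨q, hq, h2⟩
  · rw [h2]
    rcases letter_cases n R' p with ⟨-, h3⟩ | ⟨q, hq, -⟩
    · exact h3.symm
    · exact absurd ((h q).2 hq).2.1 (h1 q hq.1)
  · rw [h2, letter_eq ((h q).1 hq)]

/-- The product of the letters of the points below `N`, in decreasing order. -/
noncomputable def letterProd (n : ℕ) (R : ℕ → ℕ → Prop) : ℕ → BKLMonoid n
  | 0 => 1
  | N + 1 => letter n R N * letterProd n R N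

/-- The simple element of a noncrossing partition. -/
noncomputable def simple (n : ℕ) (R : ℕ → ℕ → Prop) : BKLMonoid n := letterProd n R (n + 1)

theorem letterProd_congr {n : ℕ} {R R' : ℕ → ℕ → Prop} {N : ℕ}
    (h : ∀ p, p < N → ∀ q, IsPred R q p ↔ IsPred R' q p) :
    letterProd n R N = letterProd n R' N := by
  induction N with
  | zero => rfl
  | succ N ih =>
    rw [letterProd, letterProd, ih fun p hp => h p (by omega),
      letter_congr_isPred (h N (by omega))]

/-- Commutation of a generator with the letters of points `p` in a range. -/
theorem atom_comm_letter {n : ℕ} {R : ℕ → ℕ → Prop} {i j p : ℕ}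
    (h : ∀ q, IsPred R q p → Apart i j q p) :
    atom n i j * letter n R p = letter n R p * atom n i j := by
  rcases letter_cases n R p with ⟨-, h1⟩ | ⟨q, hq, h1⟩
  · rw [h1, one_mul, mul_one]
  · rw [h1, atom_comm (h q hq)]

theorem atom_comm_letterProd {n : ℕ} (R : ℕ → ℕ → Prop) {i j N : ℕ}
    (hN : N ≤ i) :
    atom n i j * letterProd n R N = letterProd n R N * atom n i j := by
  induction N with
  | zero => rw [letterProd, one_mul, mul_one]
  | succ N ih =>
    rw [letterProd, ← mul_assoc, atom_comm_letter, mul_assoc, ih (by omega), mul_assoc]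
    intro q hq
    have := hq.1
    exact .inr (.inl (by omega))

/-! ### Division of simple elements by chords. -/

section

variable {n : ℕ} {R : ℕ → ℕ → Prop}

/-- Splitting a simple element from the right, points below `N ≤ j`. -/
theorem letterProd_cutBlock_aux (h : Noncrossing n R) {i j : ℕ} (hi : 1 ≤ i) (hij : i < j)
    (hj : j ≤ n) (hR : R i j) {N : ℕ} (hiN : i < N) (hN : N ≤ j) :
    ∃ k, i ≤ k ∧ k < N ∧ R k j ∧ (∀ x, k < x → x < N → ¬ R x j) ∧
      atom n k j * letterProd n R N = letter n (cutBlock R i i j) j *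
        letterProd n (cutBlock R i i j) N * atom n i j := by
  -- Below `j`, only `i` can change its predecessor: the cut separates it from the earlier points of
  -- its block.
  have hpred : ∀ p, p < j → p ≠ i → ∀ q, IsPred R q p ↔ IsPred (cutBlock R i i j) q p := by
    intro p hp hpi q
    by_cases hpR : R p i ∧ i < p
    · have hip : IsPred R q p → i ≤ q := fun hq => by
        by_contra hlt
        exact hq.2.2 i (by omega) hpR.2 (h.symm hpR.1)
      have hip' : IsPred (cutBlock R i i j) q p → i ≤ q := fun hq => by
        by_contra hlt
        exact hq.2.2 i (by omega) hpR.2 ⟨h.symm hpR.1, fun _ => by omega⟩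
      constructor
      · intro hq
        have := hip hq
        have := hq.1
        exact ⟨hq.1, ⟨hq.2.1, fun _ => by omega⟩, fun x h1 h2 h3 => hq.2.2 x h1 h2 h3.1⟩
      · intro hq
        have := hip' hq
        exact ⟨hq.1, hq.2.1.1, fun x h1 h2 h3 => hq.2.2 x h1 h2 ⟨h3, fun _ => by omega⟩⟩
    · apply isPred_congr
      intro x hx
      refine ⟨fun hxp => ⟨hxp, fun hxi => ?_⟩, fun hxp => hxp.1⟩
      have : R p i := h.trans (h.symm hxp) hxi
      have : ¬ i < p := fun hip => hpR ⟨this, hip⟩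
      omega
  have hlt : ∀ q, IsPred (cutBlock R i i j) q j → q < i := by
    intro q hq
    have := hq.2.1.2 (h.trans hq.2.1.1 (h.symm hR))
    have := hq.1
    omega
  induction N, hiN using Nat.le_induction with
  | base =>
    refine ⟨i, le_rfl, by omega, hR, fun x => by omega, ?_⟩
    rw [letterProd, letterProd, letterProd_congr (fun p hp => hpred p (by omega) (by omega))]
    have h1 : letter n (cutBlock R i i j) i = 1 := by
      apply letter_eq_one
      intro q hq hqR
      have := hqR.2 hqR.1
      omega
    rw [h1, one_mul, mul_assoc, ← atom_comm_letterProd _ le_rfl, ← mul_assoc, ← mul_assoc]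
    congr 1
    rcases letter_cases n (cutBlock R i i j) j with ⟨h2, h3⟩ | ⟨q, hq, h3⟩
    · rw [h3, letter_eq_one, mul_one, one_mul]
      intro q hq hqi
      exact h2 q (by omega) ⟨h.trans hqi hR, fun _ => by omega⟩
    · have hqj : R q j := hq.2.1.1
      have hqi : q < i := hlt q hq
      have : IsPred R q i := by
        refine ⟨hqi, h.trans hqj (h.symm hR), fun x h4 h5 h6 => ?_⟩
        exact hq.2.2 x h4 (by omega) ⟨h.trans h6 hR, fun _ => by omega⟩
      rw [h3, letter_eq this]
      -- As a_{i,j} passes to the right, the letter {q, i} becomes {q, j}, the new letter of `j`.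
      exact (atom_tri_left (h.one_le this.2.1 hqi.ne) hqi hij hj)
  | succ N hN' ih =>
    obtain ⟨k, hik, hkN, hkj, hmax, heq⟩ := ih (by omega)
    have h1k : 1 ≤ k := by omega
    rw [letterProd, letterProd, ← letter_congr_isPred (hpred N (by omega) (by omega))]
    by_cases hNj : R N j
    · refine ⟨N, by omega, by omega, hNj, fun x => by omega, ?_⟩
      have hk : IsPred R k N := ⟨by omega, h.trans hkj (h.symm hNj), fun x h1 h2 h3 =>
        hmax x h1 h2 (h.trans h3 hNj)⟩
      -- Since a_{N,j} a_{k,N} = a_{k,N} a_{k,j}, the chord ending at `j` moves its other end one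
      -- step down the block.
      rw [letter_eq hk, ← mul_assoc, atom_tri_right h1k hkN (by omega) hj, mul_assoc, heq,
        ← mul_assoc, ← mul_assoc, ← mul_assoc, atom_comm_letter]
      intro q hq
      have := hlt q hq
      unfold Apart
      omega
    · refine ⟨k, hik, by omega, hkj, fun x h1 h2 h3 => ?_, ?_⟩
      · rcases (by omega : x < N ∨ x = N) with h4 | rfl
        · exact hmax x h1 h4 h3
        · exact hNj h3
      rcases letter_cases n R N with ⟨-, h1⟩ | ⟨q, hq, h1⟩
      · rw [h1, one_mul, one_mul, heq]
      have hq' := hq.1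
      -- By noncrossingness the chord {q, N} of another block lies under {k, j}, so the two commute.
      have hkq : k < q := by
        rcases lt_trichotomy k q with h2 | h2 | h2
        · exact h2
        · exact absurd (h.trans (h.symm hq.2.1) (h2 ▸ hkj)) hNj
        · have := h.cross h2 hkN (by omega) hq.2.1 hkj
          exact absurd (h.trans (h.trans (h.symm hq.2.1) this) hkj) hNj
      rw [h1, ← mul_assoc, atom_comm (.inr (.inr (.inl ⟨hkq, by omega⟩))), mul_assoc, heq,
        ← mul_assoc, ← mul_assoc, ← mul_assoc, atom_comm_letter]
      intro x hx
      have := hlt x hx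
      unfold Apart
      omega

/-- Beyond `j` no letter changes: `j` stays in the part of its block outside the interval, so every
later point of the block has its predecessor at or after `j`, before and after the cut. -/
theorem letterProd_cutBlock_right (h : Noncrossing n R) {i j : ℕ} (hi : 1 ≤ i) (hij : i < j)
    (hj : j ≤ n) (hR : R i j) {N : ℕ} (hN : j < N) :
    letterProd n R N = letterProd n (cutBlock R i i j) N * atom n i j := by
  induction N, hN using Nat.le_induction with
  | base =>
    obtain ⟨k, hik, hkN, hkj, hmax, heq⟩ := letterProd_cutBlock_aux h hi hij hj hR hij le_rfl
    rw [letterProd, letterProd, letter_eq ⟨hkN, hkj, hmax⟩, heq]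
  | succ N hN ih =>
    rw [letterProd, letterProd, ih, mul_assoc]
    congr 1
    apply letter_congr_isPred
    intro q
    by_cases hNi : R N i
    · have hjN : R j N := h.trans (h.symm hR) (h.symm hNi)
      constructor
      · intro hq
        have : j ≤ q := by
          by_contra hlt
          exact hq.2.2 j (by omega) (by omega) hjN
        exact ⟨hq.1, ⟨hq.2.1, fun _ => by omega⟩, fun x h1 h2 h3 => hq.2.2 x h1 h2 h3.1⟩
      · intro hq
        have : j ≤ q := by
          by_contra hlt
          exact hq.2.2 j (by omega) (by omega) ⟨hjN, fun _ => by omega⟩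
        exact ⟨hq.1, hq.2.1.1, fun x h1 h2 h3 => hq.2.2 x h1 h2 ⟨h3, fun _ => by omega⟩⟩
    · apply isPred_congr
      exact fun x _ => ⟨fun hx => ⟨hx, fun hxi => absurd (h.trans (h.symm hx) hxi) hNi⟩,
        fun hx => hx.1⟩

/-- A simple element is divisible on the right by the chords of its blocks. -/
theorem simple_eq_mul_atom (h : Noncrossing n R) {i j : ℕ} (hi : 1 ≤ i) (hij : i < j)
    (hj : j ≤ n) (hR : R i j) : simple n R = simple n (cutBlock R i i j) * atom n i j :=
  letterProd_cutBlock_right h hi hij hj hR (by omega)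

/-- Splitting a simple element from the left, points below `N ≤ j + 1`. -/
theorem letterProd_cutBlock_left_aux (h : Noncrossing n R) {i j : ℕ} (hi : 1 ≤ i) (hij : i < j)
    (hj : j ≤ n) (hR : R i j) {N : ℕ} (hiN : i < N) (hN : N ≤ j + 1) :
    ∃ k, i ≤ k ∧ k < N ∧ R k i ∧ (∀ x, k < x → x < N → ¬ R x i) ∧
      letterProd n R N = (if k = i then 1 else atom n i k) *
        letterProd n (cutBlock R i (i + 1) (j + 1)) N := by
  induction N, hiN using Nat.le_induction with
  | base =>
    refine ⟨i, le_rfl, by omega, h.refl i, fun x => by omega, ?_⟩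
    rw [if_pos rfl, one_mul]
    apply letterProd_congr
    intro p hp
    apply isPred_congr
    exact fun q hq => ⟨fun h1 => ⟨h1, fun _ => by omega⟩, fun h1 => h1.1⟩
  | succ N hN' ih =>
    obtain ⟨k, hik, hkN, hki, hmax, heq⟩ := ih (by omega)
    rw [letterProd, letterProd, heq]
    by_cases hNi : R N i
    · refine ⟨N, by omega, by omega, hNi, fun x => by omega, ?_⟩
      have hk : IsPred R k N := ⟨by omega, h.trans hki (h.symm hNi), fun x h1 h2 h3 =>
        hmax x h1 h2 (h.trans h3 hNi)⟩
      rw [letter_eq hk, if_neg (show ¬ N = i by omega)]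
      by_cases hke : k = i
      · subst hke
        rw [if_pos rfl, one_mul, letter_eq_one, one_mul]
        intro q hq hqR
        have h1 := hqR.2 (h.trans hqR.1 hNi)
        exact hmax q (by omega) hq (h.trans hqR.1 hNi)
      · have hk' : IsPred (cutBlock R i (i + 1) (j + 1)) k N :=
          ⟨hk.1, ⟨hk.2.1, fun _ => by omega⟩, fun x h1 h2 h3 => hk.2.2 x h1 h2 h3.1⟩
        rw [if_neg hke, letter_eq hk', ← mul_assoc, ← mul_assoc,
          atom_tri_left hi (by omega) hkN (by omega)]
    · refine ⟨k, hik, by omega, hki, fun x h1 h2 h3 => ?_, ?_⟩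
      · rcases (by omega : x < N ∨ x = N) with h4 | rfl
        · exact hmax x h1 h4 h3
        · exact hNi h3
      have hl : letter n (cutBlock R i (i + 1) (j + 1)) N = letter n R N :=
        letter_congr_isPred <| isPred_congr fun x _ => ⟨fun hx => hx.1,
          fun hx => ⟨hx, fun hxi => absurd (h.trans (h.symm hx) hxi) hNi⟩⟩
      rw [hl]
      by_cases hke : k = i
      · rw [if_pos hke, one_mul, one_mul]
      rw [if_neg hke, ← mul_assoc, ← mul_assoc, atom_comm_letter]
      intro q hq
      have hq' := hq.1
      have hqi : ¬ R q i := fun h1 => hNi (h.trans (h.symm hq.2.1) h1)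
      unfold Apart
      by_contra hcon
      have h1 : q ≠ i := fun h1 => hqi (h1 ▸ h.refl i)
      have h2 : q ≠ k := fun h1 => hqi (h1 ▸ hki)
      rcases (by omega : i < q ∧ q < k) with ⟨h3, h4⟩
      exact hqi (h.symm (h.cross h3 h4 hkN (h.symm hki) hq.2.1))

/-- A simple element is divisible on the left by the chords of its blocks. -/
theorem simple_eq_atom_mul (h : Noncrossing n R) {i j : ℕ} (hi : 1 ≤ i) (hij : i < j)
    (hj : j ≤ n) (hR : R i j) :
    simple n R = atom n i j * simple n (cutBlock R i (i + 1) (j + 1)) := by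
  have key : ∀ N, j < N →
      letterProd n R N = atom n i j * letterProd n (cutBlock R i (i + 1) (j + 1)) N := by
    intro N hN
    induction N, hN using Nat.le_induction with
    | base =>
      obtain ⟨k, hik, hkN, hki, hmax, heq⟩ :=
        letterProd_cutBlock_left_aux h hi hij hj hR (N := j + 1) (by omega) le_rfl
      have hkj : k = j := by
        by_contra hne
        exact hmax j (by omega) (by omega) (h.symm hR)
      rw [heq, if_neg (by omega), hkj]
    | succ N hN ih =>
      rw [letterProd, letterProd, ih]
      by_cases hNi : R N i
      · have hjN : R j N := h.trans (h.symm hR) (h.symm hNi)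
        obtain ⟨q, hjq, hq⟩ := exists_isPred hN hjN
        have hNn : N ≤ n := h.le hNi (by omega)
        rcases hjq.eq_or_lt with rfl | hlt
        -- The first point of the block after `j` loses `j` as predecessor and takes `i` instead;
        -- the triangle relation moves a_{i,j} across.
        · have hp : IsPred (cutBlock R i (i + 1) (j + 1)) i N := by
            refine ⟨by omega, ⟨h.symm hNi, fun _ => by omega⟩, fun x h1 h2 h3 => ?_⟩
            have h4 := h3.2 (h.trans h3.1 hNi)
            exact hq.2.2 x (by omega) h2 h3.1
          rw [letter_eq hq, letter_eq hp, ← mul_assoc, ← mul_assoc,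
            atom_tri_right hi hij (by omega) hNn]
        · have hp : IsPred (cutBlock R i (i + 1) (j + 1)) q N :=
            ⟨hq.1, ⟨hq.2.1, fun _ => by omega⟩, fun x h1 h2 h3 => hq.2.2 x h1 h2 h3.1⟩
          rw [letter_eq hq, letter_eq hp, ← mul_assoc, ← mul_assoc, atom_comm (.inr (.inl hlt))]
      · have hl : letter n (cutBlock R i (i + 1) (j + 1)) N = letter n R N :=
          letter_congr_isPred <| isPred_congr fun x _ => ⟨fun hx => hx.1,
            fun hx => ⟨hx, fun hxi => absurd (h.trans (h.symm hx) hxi) hNi⟩⟩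
        rw [hl, ← mul_assoc, ← mul_assoc, atom_comm_letter]
        intro q hq
        have hq' := hq.1
        have hqi : ¬ R q i := fun h1 => hNi (h.trans (h.symm hq.2.1) h1)
        have h1 : q ≠ i := fun h1 => hqi (h1 ▸ h.refl i)
        have h2 : q ≠ j := fun h1 => hqi (h1 ▸ h.symm hR)
        unfold Apart
        by_contra hcon
        rcases (by omega : i < q ∧ q < j) with ⟨h3, h4⟩
        exact hqi (h.symm (h.cross h3 h4 hN hR hq.2.1))
  exact key _ (by omega)

open Classical in
/-- Cutting all blocks along an interval amounts to a division from the left. -/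
theorem exists_simple_eq_mul_cut (h : Noncrossing n R) (i j : ℕ) :
    ∃ r, simple n R = r * simple n (cut R i j) := by
  -- The number of related pairs drops each time a block that meets both the interval and its
  -- complement is split.
  induction hc : ((Finset.range (n + 1) ×ˢ Finset.range (n + 1)).filter
    fun p : ℕ × ℕ => R p.1 p.2).card using Nat.strong_induction_on generalizing R with
  | _ c ih =>
    by_cases hR : ∃ x y, R x y ∧ (i ≤ x ∧ x < j) ∧ ¬ (i ≤ y ∧ y < j)
    swap
    · refine ⟨1, ?_⟩
      have : cut R i j = R := by
        ext x y
        refine ⟨fun h1 => h1.1, fun h1 => ⟨h1, ?_⟩⟩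
        push Not at hR
        have := hR x y h1
        have := hR y x (h.symm h1)
        omega
      rw [this, one_mul]
    obtain ⟨x, y, hxy, hx, hy⟩ := hR
    -- a chord of the block of `x` that separates its parts inside and outside of the interval
    obtain ⟨a, b, hax, hab, hbx, hsep⟩ : ∃ a b, R a x ∧ a < b ∧ R b x ∧
        ((∀ z, R z x → ((a + 1 ≤ z ∧ z < b + 1) ↔ (i ≤ z ∧ z < j))) ∨
          ∀ z, R z x → ((a + 1 ≤ z ∧ z < b + 1) ↔ ¬ (i ≤ z ∧ z < j))) := by
      -- `l` is the last point of the block inside the interval. If the block has points before `i`,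
      -- and `q` is the last of them, then (q, l] picks out the inside part. Otherwise, with `q` the
      -- last point of the block, (l, q] picks out the outside part.
      obtain ⟨l, hl, hlR, hlm⟩ : ∃ l, (i ≤ l ∧ l < j) ∧ R l x ∧
          ∀ z, l < z → z < j → ¬ R z x := by
        obtain ⟨q, hxq, hq, hqR, hqm⟩ := exists_isPred (R := fun q _ => R q x) hx.2 (h.refl x)
        exact ⟨q, ⟨by omega, hq⟩, hqR, hqm⟩
      by_cases hz : ∃ z, z < i ∧ R z x
      · obtain ⟨z, hzi, hzR⟩ := hz
        obtain ⟨q, hxq, hq, hqR, hqm⟩ := exists_isPred (R := fun q _ => R q x) hzi hzR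
        refine ⟨q, l, hqR, by omega, hlR, .inl fun z hz => ?_⟩
        have h1 : q < z → ¬ z < i := fun h1 h2 => hqm z h1 h2 hz
        have h2 : l < z → ¬ z < j := fun h1 h2 => hlm z h1 h2 hz
        omega
      · push Not at hz
        have hyi : ¬ y < i := fun h1 => hz y h1 (h.symm hxy)
        have hyn := h.le (h.symm hxy) (by rintro rfl; exact hy hx)
        obtain ⟨q, hxq, hq, hqR, hqm⟩ :=
          exists_isPred (R := fun q _ => R q x) (Nat.lt_succ_of_le hyn) (h.symm hxy)
        refine ⟨l, q, hlR, by omega, hqR, .inr fun z hzR => ?_⟩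
        have h1 : ¬ z < i := fun h1 => hz z h1 hzR
        have h2 : l < z → ¬ z < j := fun h1 h2 => hlm z h1 h2 hzR
        have h3 : q < z → ¬ z < n + 1 := fun h1 h2 => hqm z h1 h2 hzR
        have h4 : z < n + 1 := by
          by_cases hzx : z = x
          · have := h.le hxy (by rintro rfl; exact hy hx)
            omega
          · have := h.le hzR hzx
            omega
        omega
    have hRab : R a b := h.trans hax (h.symm hbx)
    have ha1 := h.one_le hRab hab.ne
    have hbn := h.le (h.symm hRab) hab.ne'
    -- The chord divided out splits its block just as the interval does, so the cut still to be
    -- reached is unchanged.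
    have hcut : cut (cutBlock R a (a + 1) (b + 1)) i j = cut R i j := by
      ext u v
      refine ⟨fun h1 => ⟨h1.1.1, h1.2⟩, fun h1 => ⟨⟨h1.1, fun h2 => ?_⟩, h1.2⟩⟩
      have h3 := h.trans h2 hax
      have h4 := h.trans (h.symm h1.1) h3
      have h5 := h1.2
      rcases hsep with hs | hs
      · rw [hs u h3, hs v h4, h5]
      · rw [hs u h3, hs v h4, h5]
    obtain ⟨r, hr⟩ := ih _ (by
      rw [← hc]
      apply Finset.card_lt_card
      refine (Finset.ssubset_iff_of_subset ?_).2 ⟨(x, y), ?_, ?_⟩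
      · intro p hp
        rw [Finset.mem_filter] at hp ⊢
        exact ⟨hp.1, hp.2.1⟩
      · have hne : x ≠ y := by rintro rfl; exact hy hx
        have := h.le hxy hne
        have := h.le (h.symm hxy) hne.symm
        simp only [Finset.mem_filter, Finset.mem_product, Finset.mem_range]
        exact ⟨⟨by omega, by omega⟩, hxy⟩
      · simp only [Finset.mem_filter, not_and]
        intro _ h1
        have h2 := h1.2 (h.symm hax)
        have h3 := hsep.imp (fun hs => And.intro (hs x (h.refl x)) (hs y (h.symm hxy)))
          fun hs => And.intro (hs x (h.refl x)) (hs y (h.symm hxy))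
        rcases h3 with ⟨h4, h5⟩ | ⟨h4, h5⟩
        · exact hy (h5.1 (h2.1 (h4.2 hx)))
        · exact h4.1 (h2.2 (h5.2 hy)) hx) (h.cutBlock _ _ _) rfl
    rw [hcut] at hr
    exact ⟨atom n a b * r, by rw [simple_eq_atom_mul h ha1 hab hbn hRab, hr, mul_assoc]⟩

end

/-! ### Cancellation and least common multiples -/

section

variable {n : ℕ}

/-- The element of the Birman–Ko–Lee monoid represented by a list of chords. -/
def chordProd (w : List (Chord n)) : BKLMonoid n := (w.map fun e => atom n e.1.1 e.1.2).prod

@[simp] theorem chordProd_append (w w' : List (Chord n)) :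
    chordProd (w ++ w') = chordProd w * chordProd w' := by simp [chordProd]

@[simp] theorem chordProd_singleton (e : Chord n) : chordProd [e] = atom n e.1.1 e.1.2 := by
  simp [chordProd]

theorem mk_eq_chordProd (w : FreeMonoid (Chord n)) :
    PresentedMonoid.mk (BKLRel n) w = chordProd w.toList := by
  induction w using FreeMonoid.inductionOn' with
  | one => rfl
  | of_mul e w ih =>
    rw [map_mul, ih, FreeMonoid.toList_mul, chordProd_append, FreeMonoid.toList_of,
      chordProd_singleton, atom_eq]
    rfl

theorem exists_chordProd (x : BKLMonoid n) : ∃ w, x = chordProd w := by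
  obtain ⟨w, rfl⟩ := PresentedMonoid.surjective_mk x
  exact ⟨_, mk_eq_chordProd w⟩

/-- One application of a Birman–Ko–Lee relation. -/
inductive BKLStep (n : ℕ) : List (Chord n) → List (Chord n) → Prop
  | mk (u : List (Chord n)) {l r : FreeMonoid (Chord n)} (v : List (Chord n)) (h : BKLRel n l r) :
      BKLStep n (u ++ l.toList ++ v) (u ++ r.toList ++ v)

theorem BKLStep.append {w w' : List (Chord n)} (h : BKLStep n w w') (u v : List (Chord n)) :
    BKLStep n (u ++ w ++ v) (u ++ w' ++ v) := by
  obtain ⟨u', v', h⟩ := h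
  have := BKLStep.mk (u ++ u') (v' ++ v) h
  simpa only [List.append_assoc] using this

theorem eqvGen_append {w w' : List (Chord n)} (h : Relation.EqvGen (BKLStep n) w w')
    (u v : List (Chord n)) : Relation.EqvGen (BKLStep n) (u ++ w ++ v) (u ++ w' ++ v) := by
  induction h with
  | rel _ _ h => exact .rel _ _ (h.append u v)
  | refl _ => exact .refl _
  | symm _ _ _ ih => exact .symm _ _ ih
  | trans _ _ _ _ _ ih1 ih2 => exact .trans _ _ _ ih1 ih2

/-- Equality in the presented monoid is unfolded into a chain of single rewritings, so that
invariants and factorizations can be proved one rewriting at a time. -/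
theorem eqvGen_of_chordProd_eq {w w' : List (Chord n)} (h : chordProd w = chordProd w') :
    Relation.EqvGen (BKLStep n) w w' := by
  have h1 : PresentedMonoid.mk (BKLRel n) (FreeMonoid.ofList w) =
      PresentedMonoid.mk (BKLRel n) (FreeMonoid.ofList w') := by
    rw [mk_eq_chordProd, mk_eq_chordProd]
    exact h
  have h2 : ∀ x y : FreeMonoid (Chord n), ConGen.Rel (BKLRel n) x y →
      Relation.EqvGen (BKLStep n) x.toList y.toList := by
    intro x y hxy
    induction hxy with
    | of x y hr =>
      have := BKLStep.mk [] [] hr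
      rw [List.nil_append, List.append_nil, List.nil_append, List.append_nil] at this
      exact .rel _ _ this
    | refl _ => exact .refl _
    | symm _ ih => exact .symm _ _ ih
    | trans _ _ ih1 ih2 => exact .trans _ _ _ ih1 ih2
    | @mul w x y z _ _ ih1 ih2 =>
      have e1 := eqvGen_append ih1 [] y.toList
      have e2 := eqvGen_append ih2 x.toList []
      simp only [List.nil_append, List.append_nil] at e1 e2
      exact .trans _ _ _ e1 e2
  exact h2 _ _ (PresentedMonoid.mk_eq_mk_iff.1 h1)

theorem BKLStep.chordProd_eq {w w' : List (Chord n)} (h : BKLStep n w w') :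
    chordProd w = chordProd w' := by
  obtain ⟨u, v, h⟩ := h
  rw [chordProd_append, chordProd_append, chordProd_append, chordProd_append, ← mk_eq_chordProd,
    ← mk_eq_chordProd, PresentedMonoid.mk_eq_mk_of_rel h]

theorem BKLStep.length_eq {w w' : List (Chord n)} (h : BKLStep n w w') :
    w.length = w'.length := by
  obtain ⟨u, v, h⟩ := h
  cases h <;> simp

/-- The partition that describes the maximal simple right divisor of a word. -/
def headPart (w : List (Chord n)) : ℕ → ℕ → Prop :=
  w.foldl (fun R e => act R e.1.1 e.1.2) Eq

theorem headPart_append_singleton (w : List (Chord n)) (e : Chord n) :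
    headPart (w ++ [e]) = act (headPart w) e.1.1 e.1.2 := by
  rw [headPart, List.foldl_append]
  rfl

theorem noncrossing_eq : Noncrossing n Eq where
  refl _ := rfl
  symm h := h.symm
  trans h h' := h.trans h'
  one_le h h' := absurd h h'
  le h h' := absurd h h'
  cross h1 h2 _ h _ := by omega

theorem noncrossing_headPart (w : List (Chord n)) : Noncrossing n (headPart w) := by
  induction w using List.reverseRecOn with
  | nil => exact noncrossing_eq
  | append_singleton w e ih =>
    rw [headPart_append_singleton]
    exact ih.act e.2.1 e.2.2.1 e.2.2.2

theorem BKLStep.headPart_eq {w w' : List (Chord n)} (h : BKLStep n w w') :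
    headPart w = headPart w' := by
  obtain ⟨u, v, h⟩ := h
  rw [headPart, headPart, List.foldl_append, List.foldl_append, List.foldl_append,
    List.foldl_append]
  congr 1
  have hu := noncrossing_headPart u
  rcases h with ⟨hr, hrs, hst, ht⟩ | ⟨hr, hrs, hst, ht⟩ | ⟨hi, hij, hjk, hkl, hl⟩ |
      ⟨hi, hik, hkl, hlj, hj⟩
  · exact act_tri_left hu hrs hst
  · exact act_tri_right hu hrs hst
  · exact act_comm hu hij hkl (.inl hjk)
  · exact act_comm hu (hik.trans (hkl.trans hlj)) hkl (.inr (.inr (.inl ⟨hik, hlj⟩)))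

theorem eqvGen_invariants {w w' : List (Chord n)} (h : Relation.EqvGen (BKLStep n) w w') :
    chordProd w = chordProd w' ∧ w.length = w'.length ∧ headPart w = headPart w' := by
  induction h with
  | rel _ _ h => exact ⟨h.chordProd_eq, h.length_eq, h.headPart_eq⟩
  | refl _ => exact ⟨rfl, rfl, rfl⟩
  | symm _ _ _ ih => exact ⟨ih.1.symm, ih.2.1.symm, ih.2.2.symm⟩
  | trans _ _ _ _ _ ih1 ih2 =>
    exact ⟨ih1.1.trans ih2.1, ih1.2.1.trans ih2.2.1, ih1.2.2.trans ih2.2.2⟩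

theorem act_self {R : ℕ → ℕ → Prop} (h : Noncrossing n R) (i j : ℕ) :
    act R i j i j :=
  .inr ⟨.inl ((h.cut i j).refl i), .inr ((h.cut i j).refl j)⟩

theorem simple_eq_one : simple n Eq = 1 := by
  have : ∀ N, letterProd n Eq N = 1 := by
    intro N
    induction N with
    | zero => rfl
    | succ N ih => rw [letterProd, ih, letter_eq_one fun q hq => hq.ne, one_mul]
  exact this _

theorem simple_act {R : ℕ → ℕ → Prop} (h : Noncrossing n R) (e : Chord n) :
    simple n (act R e.1.1 e.1.2) = simple n (cut R e.1.1 e.1.2) * atom n e.1.1 e.1.2 := by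
  rw [simple_eq_mul_atom (h.act e.2.1 e.2.2.1 e.2.2.2) e.2.1 e.2.2.1 e.2.2.2
    (act_self h _ _), cutBlock_act h e.2.2.1]

/-- When a letter is appended, the part of the old simple element that cannot be kept is left behind
by `exists_simple_eq_mul_cut`; the part that is kept absorbs the letter by `simple_act`. -/
theorem exists_chordProd_eq_mul_simple (w : List (Chord n)) :
    ∃ q, chordProd w = q * simple n (headPart w) := by
  induction w using List.reverseRecOn with
  | nil => exact ⟨1, by rw [one_mul]; exact simple_eq_one.symm⟩
  | append_singleton w e ih =>
    obtain ⟨q, hq⟩ := ih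
    obtain ⟨r, hr⟩ := exists_simple_eq_mul_cut (noncrossing_headPart w) e.1.1 e.1.2
    refine ⟨q * r, ?_⟩
    rw [headPart_append_singleton, simple_act (noncrossing_headPart w), chordProd_append, hq, hr,
      chordProd_singleton]
    simp only [mul_assoc]

/-- The simple element of the partition obtained by cutting the chord `e` out of its block. -/
noncomputable def simpleDiv (R : ℕ → ℕ → Prop) (e : Chord n) : BKLMonoid n :=
  simple n (cutBlock R e.1.1 e.1.1 e.1.2)

theorem exists_chordProd_eq_mul_simpleDiv (w : List (Chord n)) (e : Chord n) :
    ∃ q, chordProd w = q * simpleDiv (headPart (w ++ [e])) e := by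
  obtain ⟨q, hq⟩ := exists_chordProd_eq_mul_simple w
  obtain ⟨r, hr⟩ := exists_simple_eq_mul_cut (noncrossing_headPart w) e.1.1 e.1.2
  refine ⟨q * r, ?_⟩
  rw [headPart_append_singleton, simpleDiv, cutBlock_act (noncrossing_headPart w) e.2.2.1, hq, hr,
    mul_assoc]

theorem simple_cut_act {R : ℕ → ℕ → Prop} (h : Noncrossing n R) (c d : Chord n)
    {a b a' b' : ℕ} (hcut : cutBlock (cut (act R c.1.1 c.1.2) d.1.1 d.1.2) c.1.1 c.1.1 c.1.2 =
      cut (cut R a b) a' b')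
    (hc : (d.1.1 ≤ c.1.1 ∧ c.1.1 < d.1.2) ↔ (d.1.1 ≤ c.1.2 ∧ c.1.2 < d.1.2)) :
    simpleDiv (act (act R c.1.1 c.1.2) d.1.1 d.1.2) d =
      simple n (cut (cut R a b) a' b') * atom n c.1.1 c.1.2 := by
  have h1 := h.act c.2.1 c.2.2.1 c.2.2.2
  rw [simpleDiv, cutBlock_act h1 d.2.2.1,
    simple_eq_mul_atom (h1.cut _ _) c.2.1 c.2.2.1 c.2.2.2 ⟨act_self h _ _, hc⟩, hcut]

/-- For a relation c d = c' d' applied after `u`: dividing the head of u c d by d leaves the twice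
cut head of `u` followed by c, and dividing it by d' leaves the same partition's simple element
followed by c'. What precedes it in `u` is the shared factor `q`. -/
theorem chordProd_pair (u : List (Chord n)) (c d c' d' : Chord n)
    {a b a' b' : ℕ}
    (hact : act (act (headPart u) c.1.1 c.1.2) d.1.1 d.1.2 =
      act (act (headPart u) c'.1.1 c'.1.2) d'.1.1 d'.1.2)
    (hcut : cutBlock (cut (act (headPart u) c.1.1 c.1.2) d.1.1 d.1.2) c.1.1 c.1.1 c.1.2 =
      cut (cut (headPart u) a b) a' b')
    (hcut' : cutBlock (cut (act (headPart u) c'.1.1 c'.1.2) d'.1.1 d'.1.2) c'.1.1 c'.1.1 c'.1.2 =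
      cut (cut (headPart u) a b) a' b')
    (hc : (d.1.1 ≤ c.1.1 ∧ c.1.1 < d.1.2) ↔ (d.1.1 ≤ c.1.2 ∧ c.1.2 < d.1.2))
    (hc' : (d'.1.1 ≤ c'.1.1 ∧ c'.1.1 < d'.1.2) ↔ (d'.1.1 ≤ c'.1.2 ∧ c'.1.2 < d'.1.2)) :
    ∃ q, chordProd (u ++ [c]) = q * simpleDiv (headPart (u ++ [c] ++ [d])) d ∧
      chordProd (u ++ [c']) = q * simpleDiv (headPart (u ++ [c] ++ [d])) d' := by
  have h := noncrossing_headPart u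
  obtain ⟨q, hq⟩ := exists_chordProd_eq_mul_simple u
  obtain ⟨r, hr⟩ := exists_simple_eq_mul_cut h a b
  obtain ⟨r', hr'⟩ := exists_simple_eq_mul_cut (h.cut a b) a' b'
  refine ⟨q * r * r', ?_, ?_⟩
  · rw [headPart_append_singleton, headPart_append_singleton, simple_cut_act h c d hcut hc,
      chordProd_append, hq, hr, hr', chordProd_singleton]
    simp only [mul_assoc]
  · rw [headPart_append_singleton, headPart_append_singleton, hact, simple_cut_act h c' d' hcut' hc',
      chordProd_append, hq, hr, hr', chordProd_singleton]
    simp only [mul_assoc]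

/-- A relation applied away from the last letter does not change that letter, and the two prefixes
represent the same element. Otherwise the relation rewrites the last two letters and
`chordProd_pair` applies. -/
theorem BKLStep.exists_mul_simpleDiv {w w' : List (Chord n)} (h : BKLStep n w w') {V V' e e'}
    (hw : w = V ++ [e]) (hw' : w' = V' ++ [e']) :
    ∃ q, chordProd V = q * simpleDiv (headPart w) e ∧
      chordProd V' = q * simpleDiv (headPart w) e' := by
  obtain ⟨u, v, h⟩ := h
  induction v using List.reverseRecOn with
  | append_singleton v f _ =>
    rw [← List.append_assoc] at hw hw'
    obtain ⟨rfl, h1⟩ := List.append_inj' hw rfl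
    obtain ⟨rfl, h2⟩ := List.append_inj' hw' rfl
    obtain rfl : f = e := by simpa using h1
    obtain rfl : f = e' := by simpa using h2
    have h3 := (BKLStep.mk u v h).chordProd_eq
    simp only [← h3, and_self]
    rw [← List.append_assoc]
    exact exists_chordProd_eq_mul_simpleDiv _ _
  | nil =>
    have key : ∀ c d c' d' : Chord n, u ++ [c, d] = V ++ [e] → u ++ [c', d'] = V' ++ [e'] →
        V = u ++ [c] ∧ e = d ∧ V' = u ++ [c'] ∧ e' = d' := by
      intro c d c' d' h1 h2
      have h3 : (u ++ [c]) ++ [d] = V ++ [e] := by simpa using h1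
      have h4 : (u ++ [c']) ++ [d'] = V' ++ [e'] := by simpa using h2
      obtain ⟨rfl, h5⟩ := List.append_inj' h3 rfl
      obtain ⟨rfl, h6⟩ := List.append_inj' h4 rfl
      exact ⟨rfl, by simpa using h5.symm, rfl, by simpa using h6.symm⟩
    rw [List.append_nil] at hw hw' ⊢
    have hu := noncrossing_headPart u
    rcases h with ⟨hr, hrs, hst, ht⟩ | ⟨hr, hrs, hst, ht⟩ | ⟨hi, hij, hjk, hkl, hl⟩ |
      ⟨hi, hik, hkl, hlj, hj⟩
    all_goals
      obtain ⟨rfl, rfl, rfl, rfl⟩ := key _ _ _ _ hw hw'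
      rw [hw]
    · exact chordProd_pair u _ _ _ _ (act_tri_left hu hrs hst) (cutBlock_cut_act_st hu hrs hst)
        (cutBlock_cut_act_rt hu hrs hst) (by dsimp only; omega) (by dsimp only; omega)
    · exact chordProd_pair u _ _ _ _ (act_tri_right hu hrs hst) (cutBlock_cut_act_st hu hrs hst)
        (cutBlock_cut_act_rs hu hrs hst) (by dsimp only; omega) (by dsimp only; omega)
    · exact chordProd_pair u _ _ _ _ (act_comm hu hij hkl (.inl hjk))
        (cutBlock_cut_act_apart hu hij hkl (.inl hjk))
        ((cutBlock_cut_act_apart hu hkl hij (.inr (.inl hjk))).trans (cut_comm _ _ _ _ _))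
        (by dsimp only; omega) (by dsimp only; omega)
    · exact chordProd_pair u _ _ _ _ (act_comm hu (hik.trans (hkl.trans hlj)) hkl (.inr (.inr (.inl ⟨hik, hlj⟩))))
        (cutBlock_cut_act_apart hu (hik.trans (hkl.trans hlj)) hkl (.inr (.inr (.inl ⟨hik, hlj⟩))))
        ((cutBlock_cut_act_apart hu hkl (hik.trans (hkl.trans hlj)) (.inr (.inr (.inr ⟨hik, hlj⟩)))).trans
          (cut_comm _ _ _ _ _))
        (by dsimp only; omega) (by dsimp only; omega)

/-- Equal words factor through the same left divisor, the right part being given by the maximal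
simple right divisor. -/
theorem exists_mul_simpleDiv (N : ℕ) : ∀ V V' : List (Chord n), ∀ e e', V.length = N →
    chordProd (V ++ [e]) = chordProd (V' ++ [e']) →
    ∃ q, chordProd V = q * simpleDiv (headPart (V ++ [e])) e ∧
      chordProd V' = q * simpleDiv (headPart (V ++ [e])) e' := by
  induction N using Nat.strong_induction_on with
  | _ N ih =>
  -- Right cancellation in smaller length is the case of equal last letters in the induction
  -- hypothesis.
  have cancel1 : ∀ X Y : List (Chord n), ∀ e, X.length < N →
      chordProd (X ++ [e]) = chordProd (Y ++ [e]) → chordProd X = chordProd Y := by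
    intro X Y e hX h
    obtain ⟨q, h1, h2⟩ := ih _ hX X Y e e rfl h
    rw [h1, h2]
  have cancel : ∀ U X Y : List (Chord n), (X ++ U).length ≤ N →
      chordProd (X ++ U) = chordProd (Y ++ U) → chordProd X = chordProd Y := by
    intro U
    induction U using List.reverseRecOn with
    | nil =>
      intro X Y _ h
      simpa using h
    | append_singleton U e ihU =>
      intro X Y hl h
      rw [← List.append_assoc, ← List.append_assoc] at h
      simp only [List.length_append, List.length_singleton] at hl
      exact ihU X Y (by rw [List.length_append]; omega)
        (cancel1 _ _ e (by rw [List.length_append]; omega) h)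
  have key : ∀ w w' : List (Chord n), Relation.EqvGen (BKLStep n) w w' → w.length = N + 1 →
      ∀ V e V' e', w = V ++ [e] → w' = V' ++ [e'] →
        ∃ q, chordProd V = q * simpleDiv (headPart w) e ∧
          chordProd V' = q * simpleDiv (headPart w) e' := by
    intro w w' h
    induction h with
    | rel w w' h => exact fun _ V e V' e' h1 h2 => h.exists_mul_simpleDiv h1 h2
    | refl w =>
      intro _ V e V' e' h1 h2
      obtain ⟨rfl, h3⟩ := List.append_inj' (h1.symm.trans h2) rfl
      obtain rfl : e = e' := by simpa using h3
      simp only [and_self, h1]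
      exact exists_chordProd_eq_mul_simpleDiv _ _
    | symm w w' h ihw =>
      intro hl V e V' e' h1 h2
      have h3 := eqvGen_invariants h
      obtain ⟨q, h4, h5⟩ := ihw (h3.2.1.trans hl) V' e' V e h2 h1
      exact ⟨q, h3.2.2 ▸ h5, h3.2.2 ▸ h4⟩
    | trans w x w' h h' ihw ihx =>
      intro hl V e V' e' h1 h2
      have h3 := eqvGen_invariants h
      have hx : x.length = N + 1 := h3.2.1.symm.trans hl
      rcases List.eq_nil_or_concat' x with rfl | ⟨X, f, rfl⟩
      · simp at hx
      rw [List.length_append, List.length_singleton] at hx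
      obtain ⟨q, h4, h5⟩ := ihw hl V e X f h1 rfl
      obtain ⟨q', h6, h7⟩ := ihx (by rw [List.length_append, List.length_singleton, hx])
        X f V' e' rfl h2
      rw [← h3.2.2] at h6 h7
      obtain ⟨Q, rfl⟩ := exists_chordProd q
      obtain ⟨Q', rfl⟩ := exists_chordProd q'
      obtain ⟨U, hU⟩ := exists_chordProd (simpleDiv (headPart w) f)
      rw [hU, ← chordProd_append] at h5 h6
      have h8 := (eqvGen_invariants (eqvGen_of_chordProd_eq h5)).2.1
      -- The two halves of the chain factor the middle prefix `X` with the same right factor `U`. As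
      -- `X` has length `N`, cancelling `U` only uses the induction hypothesis and identifies the
      -- two left factors.
      have h9 := cancel U Q Q' (by omega) (h5.symm.trans h6)
      exact ⟨chordProd Q, h4, h9 ▸ h7⟩
  intro V V' e e' hl h
  exact key _ _ (eqvGen_of_chordProd_eq h) (by rw [List.length_append, List.length_singleton, hl])
    V e V' e' rfl rfl

end

/-! ### Least common left multiples of chords. -/

section

variable {n : ℕ}

/-- The submonoid of the Birman–Ko–Lee monoid generated by the chords with end points in `S`. -/
def chordSubmonoid (n : ℕ) (S : Set ℕ) : Submonoid (BKLMonoid n) :=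
  Submonoid.closure {x | ∃ i j, i ∈ S ∧ j ∈ S ∧ i < j ∧ x = atom n i j}

theorem atom_mem {S : Set ℕ} {i j : ℕ} (hi : i ∈ S) (hj : j ∈ S) (hij : i < j) :
    atom n i j ∈ chordSubmonoid n S :=
  Submonoid.subset_closure ⟨i, j, hi, hj, hij, rfl⟩

/-- Two right divisors of a simple element that are chords have a least common left multiple. -/
theorem exists_lcm_simple {R : ℕ → ℕ → Prop} (h : Noncrossing n R) {S : Set ℕ} {i j k l : ℕ}
    (hij : i < j) (hkl : k < l) (hR : R i j) (hR' : R k l)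
    (hi : i ∈ S) (hj : j ∈ S) (hk : k ∈ S) (hl : l ∈ S) :
    ∃ z, ∃ u ∈ chordSubmonoid n S, ∃ v ∈ chordSubmonoid n S,
      simple n (cutBlock R i i j) = z * u ∧ simple n (cutBlock R k k l) = z * v := by
  have split : ∀ {R : ℕ → ℕ → Prop}, Noncrossing n R → ∀ {i j}, i < j → R i j →
      simple n R = simple n (cutBlock R i i j) * atom n i j := fun h i j hij hR =>
    simple_eq_mul_atom h (h.one_le hR hij.ne) hij (h.le (h.symm hR) hij.ne') hR
  -- By symmetry the chords may be taken in lexicographic order. They are then apart, share an end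
  -- point, or cross. In each case `u` and `v` use only the given end points, which is what makes
  -- the lemma apply inside every parabolic submonoid.
  have key : ∀ {i j k l}, i < j → k < l → R i j → R k l → i ∈ S → j ∈ S → k ∈ S → l ∈ S →
      (i < k ∨ (i = k ∧ j ≤ l)) → ∃ z, ∃ u ∈ chordSubmonoid n S, ∃ v ∈ chordSubmonoid n S,
        simple n (cutBlock R i i j) = z * u ∧ simple n (cutBlock R k k l) = z * v := by
    intro i j k l hij hkl hR hR' hi hj hk hl hord
    have N1 := h.cutBlock i i j
    have N2 := h.cutBlock k k l
    by_cases hap : Apart i j k l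
    · refine ⟨_, _, atom_mem hk hl hkl, _, atom_mem hi hj hij, split N1 hkl ⟨hR', fun _ => ?_⟩, ?_⟩
      · unfold Apart at hap
        omega
      · rw [cutBlock_comm h hij hkl hap hR hR']
        refine split N2 hij ⟨hR, fun _ => ?_⟩
        unfold Apart at hap
        omega
    unfold Apart at hap
    rcases hord with hik | ⟨rfl, hjl⟩
    swap
    · rcases hjl.eq_or_lt with rfl | hjl
      · exact ⟨_, 1, one_mem _, 1, one_mem _, (mul_one _).symm, (mul_one _).symm⟩
      have hjl' : R j l := h.trans (h.symm hR) hR'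
      refine ⟨_, _, atom_mem hj hl hjl, _, atom_mem hi hj hij, split N1 hjl ⟨hjl', fun _ => ?_⟩, ?_⟩
      · omega
      · rw [cutBlock_rs_rt h hij hjl hR hjl']
        exact split N2 hij ⟨hR, fun _ => by omega⟩
    rcases (by omega : j = k ∨ j = l ∨ (k < j ∧ j < l)) with rfl | rfl | ⟨hkj, hjl⟩
    · refine ⟨_, _, atom_mem hk hl hkl, _, atom_mem hi hl (hij.trans hkl),
        split N1 hkl ⟨hR', fun _ => ?_⟩, ?_⟩
      · omega
      · rw [cutBlock_rs_st h hij hkl hR hR']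
        exact split N2 (hij.trans hkl) ⟨h.trans hR hR', fun _ => by omega⟩
    · have hik' : R i k := h.trans hR (h.symm hR')
      refine ⟨_, _, atom_mem hi hk hik, _, atom_mem hi hj hij,
        split N1 hik ⟨hik', fun _ => by omega⟩, ?_⟩
      rw [← cutBlock_rs_rt h hik hkl hik' hR', cutBlock_rs_st h hik hkl hik' hR']
      exact split N2 hij ⟨hR, fun _ => by omega⟩
    · have hik' : R i k := h.cross hik hkj hjl hR hR'
      have hkj' : R k j := h.trans (h.symm hik') hR
      have hjl' : R j l := h.trans (h.symm hkj') hR'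
      have hil' : R i l := h.trans hik' hR'
      -- `z` belongs to the partition left after the whole common multiple, spanned by i < k < j <
      -- l, has been divided out.
      refine ⟨simple n (cutBlock (cutBlock (cutBlock R i i j) i i k) j j l), _,
        mul_mem (atom_mem hj hl hjl) (atom_mem hi hk hik), _,
        mul_mem (atom_mem hi hl (hik.trans hkl)) (atom_mem hk hj hkj), ?_, ?_⟩
      · rw [split N1 hik ⟨hik', fun _ => by omega⟩, split (N1.cutBlock i i k) hjl
          ⟨⟨hjl', fun _ => by omega⟩, fun _ => by omega⟩, mul_assoc]
      · rw [split N2 hkj ⟨hkj', fun _ => by omega⟩, split (N2.cutBlock k k j) (hik.trans hkl)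
          ⟨⟨hil', fun _ => by omega⟩, fun _ => by omega⟩, mul_assoc,
          cutBlock_cross h hik hkj hjl hik' hkj' hjl']
  by_cases hord : i < k ∨ (i = k ∧ j ≤ l)
  · exact key hij hkl hR hR' hi hj hk hl hord
  · obtain ⟨z, u, hu, v, hv, h1, h2⟩ := key hkl hij hR' hR hk hl hi hj (by omega)
    exact ⟨z, v, hv, u, hu, h2, h1⟩

/-- The head partition depends only on the common product, and the last letter of every word joins
its end points there. So one partition `R` contains both chords in its blocks. -/
theorem exists_mul_simpleDiv' {x y : BKLMonoid n} {e e' : Chord n}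
    (h : x * atom n e.1.1 e.1.2 = y * atom n e'.1.1 e'.1.2) :
    ∃ R, Noncrossing n R ∧ R e.1.1 e.1.2 ∧ R e'.1.1 e'.1.2 ∧
      ∃ q, x = q * simpleDiv R e ∧ y = q * simpleDiv R e' := by
  obtain ⟨V, rfl⟩ := exists_chordProd x
  obtain ⟨V', rfl⟩ := exists_chordProd y
  rw [← chordProd_singleton, ← chordProd_singleton, ← chordProd_append, ← chordProd_append] at h
  have h1 := (eqvGen_invariants (eqvGen_of_chordProd_eq h)).2.2
  refine ⟨headPart (V ++ [e]), noncrossing_headPart _, ?_, ?_, exists_mul_simpleDiv _ _ _ _ _ rfl h⟩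
  · rw [headPart_append_singleton]
    exact act_self (noncrossing_headPart V) _ _
  · rw [h1, headPart_append_singleton]
    exact act_self (noncrossing_headPart V') _ _

/-- Least common left multiples of chords. -/
theorem exists_lcm_atom {x y : BKLMonoid n} {S : Set ℕ} {i j k l : ℕ} (hi1 : 1 ≤ i) (hij : i < j)
    (hjn : j ≤ n) (hk1 : 1 ≤ k) (hkl : k < l) (hln : l ≤ n)
    (hi : i ∈ S) (hj : j ∈ S) (hk : k ∈ S) (hl : l ∈ S) (h : x * atom n i j = y * atom n k l) :
    ∃ z, ∃ u ∈ chordSubmonoid n S, ∃ v ∈ chordSubmonoid n S, x = z * u ∧ y = z * v := by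
  obtain ⟨R, hR, h1, h2, q, h3, h4⟩ :=
    exists_mul_simpleDiv' (e := .mk hi1 hij hjn) (e' := .mk hk1 hkl hln) h
  obtain ⟨z, u, hu, v, hv, h5, h6⟩ := exists_lcm_simple hR hij hkl h1 h2 hi hj hk hl
  rw [simpleDiv, h5, ← mul_assoc] at h3
  rw [simpleDiv, h6, ← mul_assoc] at h4
  exact ⟨q * z, u, hu, v, hv, h3, h4⟩

/-- Chords that do not cross and are disjoint have their product as a least common multiple. -/
theorem exists_lcm_atom_of_apart {x y : BKLMonoid n} {i j k l : ℕ} (hi1 : 1 ≤ i) (hij : i < j)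
    (hjn : j ≤ n) (hk1 : 1 ≤ k) (hkl : k < l) (hln : l ≤ n) (hap : Apart i j k l)
    (h : x * atom n i j = y * atom n k l) :
    ∃ z, x = z * atom n k l ∧ y = z * atom n i j := by
  obtain ⟨R, hR, h1, h2, q, h3, h4⟩ :=
    exists_mul_simpleDiv' (e := .mk hi1 hij hjn) (e' := .mk hk1 hkl hln) h
  have h5 := simple_eq_mul_atom (hR.cutBlock i i j) hk1 hkl hln
    ⟨h2, fun _ => by unfold Apart at hap; omega⟩
  have h6 := simple_eq_mul_atom (hR.cutBlock k k l) hi1 hij hjn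
    ⟨h1, fun _ => by unfold Apart at hap; omega⟩
  rw [← cutBlock_comm hR hij hkl hap h1 h2] at h6
  rw [simpleDiv, h5, ← mul_assoc] at h3
  rw [simpleDiv, h6, ← mul_assoc] at h4
  exact ⟨_, h3, h4⟩

/-! ### Cancellation, the Garside element and the group of fractions. -/

theorem BKLMonoid.induction {p : BKLMonoid n → Prop} (h1 : p 1)
    (hmul : ∀ x i j, 1 ≤ i → i < j → j ≤ n → p x → p (x * atom n i j)) (x : BKLMonoid n) : p x := by
  obtain ⟨w, rfl⟩ := exists_chordProd x
  induction w using List.reverseRecOn with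
  | nil => exact h1
  | append_singleton w e ih =>
    rw [chordProd_append, chordProd_singleton]
    exact hmul _ _ _ e.2.1 e.2.2.1 e.2.2.2 ih

/-- For equal last chords, the two factorizations of `exists_mul_simpleDiv'` are literally the same.
-/
theorem BKLMonoid.mul_right_cancel' {x y z : BKLMonoid n} (h : x * z = y * z) : x = y := by
  induction z using BKLMonoid.induction with
  | h1 => simpa using h
  | hmul z i j hi hij hj ih =>
    rw [← mul_assoc, ← mul_assoc] at h
    obtain ⟨R, -, -, -, q, h3, h4⟩ :=
      exists_mul_simpleDiv' (e := .mk hi hij hj) (e' := .mk hi hij hj) h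
    exact ih (h3.trans h4.symm)

theorem Apart.symm {i j k l : ℕ} (h : Apart i j k l) : Apart k l i j := by
  unfold Apart at *
  omega

/-- The reflection i ↦ n + 1 - i combined with reversal of products exchanges the two triangle
relations, and it is an involution. It turns right cancellation into left cancellation. -/
theorem exists_mirror (n : ℕ) : ∃ F : BKLMonoid n →* (BKLMonoid n)ᵐᵒᵖ,
    Function.Injective F := by
  obtain ⟨F, hF⟩ := exists_bklMonoid_hom (M := (BKLMonoid n)ᵐᵒᵖ) n
    (fun i j => .op (atom n (n + 1 - j) (n + 1 - i))) (by
      intro r s t hr hrs hst ht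
      rw [← MulOpposite.op_mul, ← MulOpposite.op_mul, atom_tri_right (by omega) (by omega) (by omega)
        (by omega)]) (by
      intro r s t hr hrs hst ht
      rw [← MulOpposite.op_mul, ← MulOpposite.op_mul, atom_tri_left (by omega) (by omega) (by omega)
        (by omega)]) (by
      intro i j k l hi hij hk hkl hj hl hap
      rw [← MulOpposite.op_mul, ← MulOpposite.op_mul, atom_comm]
      unfold Apart at *
      omega)
  refine ⟨F, Function.LeftInverse.injective (g := fun y => (F y.unop).unop) fun x => ?_⟩
  induction x using BKLMonoid.induction with
  | h1 => simp
  | hmul x i j hi hij hj ih =>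
    dsimp only at ih ⊢
    rw [map_mul, MulOpposite.unop_mul, map_mul, MulOpposite.unop_mul, ih, hF _ _ hi hij hj,
      MulOpposite.unop_op, hF _ _ (by omega) (by omega) (by omega), MulOpposite.unop_op]
    congr 2 <;> omega

theorem BKLMonoid.mul_left_cancel' {x y z : BKLMonoid n} (h : z * x = z * y) : x = y := by
  obtain ⟨F, hF⟩ := exists_mirror n
  have h1 := congrArg (fun u => (F u).unop) h
  simp only [map_mul, MulOpposite.unop_mul] at h1
  exact hF (MulOpposite.unop_injective (BKLMonoid.mul_right_cancel' h1))

/-- The partition with the single block `{1, …, n}`. -/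
def fullPart (n : ℕ) : ℕ → ℕ → Prop := fun x y => x = y ∨ ((1 ≤ x ∧ x ≤ n) ∧ 1 ≤ y ∧ y ≤ n)

theorem noncrossing_fullPart (n : ℕ) : Noncrossing n (fullPart n) := by
  constructor <;> unfold fullPart <;> omega

/-- The Garside element. -/
noncomputable def garside (n : ℕ) : BKLMonoid n := simple n (fullPart n)

theorem exists_mul_atom_eq_garside {i j : ℕ} (hi : 1 ≤ i) (hij : i < j) (hj : j ≤ n) :
    ∃ x, x * atom n i j = garside n :=
  ⟨_, (simple_eq_mul_atom (noncrossing_fullPart n) hi hij hj (.inr (by omega))).symm⟩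

/-- Conjugation by the Garside element rotates the punctures. Dividing a_{i,j} out from the right
leaves the same two blocks as dividing a_{i-1,j-1} out from the left, or a_{j-1,n} if i = 1. -/
theorem exists_garside_mul_atom {i j : ℕ} (hi : 1 ≤ i) (hij : i < j) (hj : j ≤ n) :
    ∃ x, garside n * atom n i j = x * garside n := by
  have h := noncrossing_fullPart n
  have h1 : garside n = _ := simple_eq_mul_atom h hi hij hj (.inr (by omega))
  rcases hi.eq_or_lt with rfl | hi1
  · have h2 : garside n = _ := simple_eq_atom_mul h (i := j - 1) (j := n) (by omega) (by omega) le_rfl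
      (.inr (by omega))
    refine ⟨atom n (j - 1) n, ?_⟩
    have h3 : cutBlock (fullPart n) (j - 1) (j - 1 + 1) (n + 1) = cutBlock (fullPart n) 1 1 j := by
      ext x y
      unfold cutBlock fullPart
      omega
    rw [h3] at h2
    nth_rewrite 1 [h2]
    rw [mul_assoc, ← h1]
  · have h2 : garside n = _ := simple_eq_atom_mul h (i := i - 1) (j := j - 1) (by omega) (by omega)
      (by omega) (.inr (by omega))
    refine ⟨atom n (i - 1) (j - 1), ?_⟩
    have h3 : cutBlock (fullPart n) (i - 1) (i - 1 + 1) (j - 1 + 1) =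
        cutBlock (fullPart n) i i j := by
      ext x y
      unfold cutBlock fullPart
      omega
    rw [h3] at h2
    nth_rewrite 1 [h2]
    rw [mul_assoc, ← h1]

theorem exists_garside_mul (x : BKLMonoid n) : ∃ y, garside n * x = y * garside n := by
  induction x using BKLMonoid.induction with
  | h1 => exact ⟨1, by simp⟩
  | hmul x i j hi hij hj ih =>
    obtain ⟨y, hy⟩ := ih
    obtain ⟨z, hz⟩ := exists_garside_mul_atom hi hij hj
    exact ⟨y * z, by rw [← mul_assoc, hy, mul_assoc, hz, mul_assoc]⟩

theorem exists_garside_pow_mul (k : ℕ) (x : BKLMonoid n) :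
    ∃ y, garside n ^ k * x = y * garside n ^ k := by
  induction k with
  | zero => exact ⟨x, by simp⟩
  | succ k ih =>
    obtain ⟨y, hy⟩ := ih
    obtain ⟨z, hz⟩ := exists_garside_mul y
    exact ⟨z, by rw [pow_succ', mul_assoc, hy, ← mul_assoc, hz, mul_assoc]⟩

/-- Every generator right divides the Garside element, and a power of the Garside element moves
across the cofactor, so the exponent grows by one with each letter. -/
theorem exists_mul_eq_garside_pow (x : BKLMonoid n) : ∃ k y, y * x = garside n ^ k := by
  induction x using BKLMonoid.induction with
  | h1 => exact ⟨0, 1, by simp⟩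
  | hmul x i j hi hij hj ih =>
    obtain ⟨k, y, hy⟩ := ih
    obtain ⟨z, hz⟩ := exists_mul_atom_eq_garside hi hij hj
    obtain ⟨z', hz'⟩ := exists_garside_pow_mul k z
    refine ⟨k + 1, z' * y, ?_⟩
    calc z' * y * (x * atom n i j) = z' * (y * x) * atom n i j := by simp only [mul_assoc]
      _ = garside n ^ (k + 1) := by rw [hy, ← hz', mul_assoc, hz, pow_succ]

theorem exists_common_left_mul (x y : BKLMonoid n) : ∃ u v, u * x = v * y := by
  obtain ⟨k, z, hz⟩ := exists_mul_eq_garside_pow y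
  obtain ⟨x', hx'⟩ := exists_garside_pow_mul k x
  exact ⟨garside n ^ k, x' * z, by rw [hx', mul_assoc, hz]⟩

/-- Ore's theorem: with cancellation on both sides and common left multiples, the localization at
the whole monoid makes every element a unit and identifies no two of them. -/
theorem exists_injective_hom_group (n : ℕ) :
    ∃ (K : Type) (_ : Group K) (F : BKLMonoid n →* K), Function.Injective F := by
  choose u v huv using exists_common_left_mul (n := n)
  let _ : OreLocalization.OreSet (⊤ : Submonoid (BKLMonoid n)) :=
    { ore_right_cancel := fun r₁ r₂ s h => ⟨1, by rw [BKLMonoid.mul_right_cancel' h]⟩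
      oreNum := fun r s => v r s
      oreDenom := fun r s => ⟨u r s, trivial⟩
      ore_eq := fun r s => huv r s }
  let F : BKLMonoid n →* (OreLocalization (⊤ : Submonoid (BKLMonoid n)) (BKLMonoid n))ˣ :=
    { toFun := fun x => OreLocalization.numeratorUnit ⟨x, trivial⟩
      map_one' := Units.ext (map_one OreLocalization.numeratorHom)
      map_mul' := fun x y => Units.ext (map_mul OreLocalization.numeratorHom x y) }
  refine ⟨_, inferInstance, F, fun x y h => ?_⟩
  have h1 : x /ₒ (1 : (⊤ : Submonoid (BKLMonoid n))) = y /ₒ 1 := congrArg Units.val h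
  rw [OreLocalization.oreDiv_eq_iff] at h1
  obtain ⟨a, b, h2, h3⟩ := h1
  simp only [Submonoid.smul_def, smul_eq_mul, OneMemClass.coe_one, mul_one] at h2 h3
  rw [h3] at h2
  exact (BKLMonoid.mul_left_cancel' h2).symm

end

/-! ### The Birman–Ko–Lee relations in the braid group -/

section

variable {n : ℕ}

theorem sigma_eq {i : ℕ} (h : 1 ≤ i ∧ i < n) : sigma n i = PresentedGroup.of ⟨i, h⟩ := by
  rw [sigma, dif_pos h]

theorem sigma_comm {i j : ℕ} (h : i + 2 ≤ j) : Commute (sigma n i) (sigma n j) := by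
  by_cases hi : 1 ≤ i ∧ i < n
  swap
  · rw [sigma, dif_neg hi]
    exact Commute.one_left _
  by_cases hj : 1 ≤ j ∧ j < n
  swap
  · rw [sigma.eq_1 n j, dif_neg hj]
    exact Commute.one_right _
  rw [sigma_eq hi, sigma_eq hj]
  have := PresentedGroup.mk_eq_mk_of_mul_inv_mem (rels := artinRels n)
    (x := FreeGroup.of ⟨i, hi⟩ * FreeGroup.of ⟨j, hj⟩)
    (y := FreeGroup.of ⟨j, hj⟩ * FreeGroup.of ⟨i, hi⟩) (.inl ⟨⟨i, hi⟩, ⟨j, hj⟩, h, rfl⟩)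
  exact this

theorem sigma_braid {i : ℕ} (hi : 1 ≤ i) (hn : i + 1 < n) :
    sigma n i * sigma n (i + 1) * sigma n i = sigma n (i + 1) * sigma n i * sigma n (i + 1) := by
  rw [sigma_eq ⟨hi, by omega⟩, sigma_eq ⟨by omega, hn⟩]
  have := PresentedGroup.mk_eq_mk_of_mul_inv_mem (rels := artinRels n)
    (x := FreeGroup.of ⟨i, hi, by omega⟩ * FreeGroup.of ⟨i + 1, by omega, hn⟩ *
      FreeGroup.of ⟨i, hi, by omega⟩)
    (y := FreeGroup.of ⟨i + 1, by omega, hn⟩ * FreeGroup.of ⟨i, hi, by omega⟩ *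
      FreeGroup.of ⟨i + 1, by omega, hn⟩) (.inr ⟨⟨i, hi, by omega⟩, ⟨i + 1, by omega, hn⟩, rfl, rfl⟩)
  exact this

theorem band_succ_self (n i : ℕ) : band n i (i + 1) = sigma n i := by
  simp [band]

theorem band_succ {i j : ℕ} (hij : i < j) :
    band n i (j + 1) = sigma n j * band n i j * (sigma n j)⁻¹ := by
  obtain ⟨d, rfl⟩ : ∃ d, j = i + 1 + d := ⟨j - (i + 1), by omega⟩
  have h1 : i + 1 + d + 1 - 1 - i = d + 1 := by omega
  have h2 : i + 1 + d - 1 - i = d := by omega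
  rw [band, band, h1, h2, List.range'_1_concat, List.reverse_append, List.reverse_singleton,
    List.singleton_append, List.map_cons, List.prod_cons]
  group

/-- An element that commutes with the generators `σ_i, …, σ_{j-1}` commutes with `a_{i,j}`. -/
theorem commute_band {x : BraidGroup n} {i j : ℕ} (hij : i < j)
    (h : ∀ m, i ≤ m → m < j → Commute x (sigma n m)) : Commute x (band n i j) := by
  induction j, hij using Nat.le_induction with
  | base => 
    rw [Nat.succ_eq_add_one, band_succ_self]
    exact h i le_rfl (by omega)
  | succ j hij ih =>
    rw [band_succ hij]
    have h1 := h j (by omega) (by omega)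
    exact (h1.mul_right (ih fun m h2 h3 => h m h2 (by omega))).mul_right h1.inv_right

theorem sigma_comm_band_of_lt {k i j : ℕ} (hij : i < j) (hk : k + 1 < i ∨ j < k) :
    Commute (sigma n k) (band n i j) := by
  apply commute_band hij
  intro m h1 h2
  rcases hk with hk | hk
  · exact sigma_comm (by omega)
  · exact (sigma_comm (by omega)).symm

/-- For j = k + 2, the band generator is the conjugate of a_{i,k} by σ_{k+1} σ_k, and by the braid
relation the same conjugation takes σ_{k+1}, which commutes with a_{i,k}, to σ_k. Larger j only add
conjugations by generators that commute with σ_k. -/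
theorem sigma_comm_band_of_between {k i j : ℕ} (hi : 1 ≤ i) (hik : i < k) (hkj : k + 1 < j)
    (hn : j ≤ n) : Commute (sigma n k) (band n i j) := by
  induction j, hkj using Nat.le_induction with
  | base =>
    have h1 : Commute (sigma n (k + 1)) (band n i k) := sigma_comm_band_of_lt hik (by omega)
    have h2 := sigma_braid (i := k) (by omega) (by omega : k + 1 < n)
    rw [Nat.succ_eq_add_one, band_succ (by omega), band_succ hik]
    generalize band n i k = b at *
    generalize sigma n (k + 1) = y at *
    generalize sigma n k = x at *
    have h1' : y * b = b * y := h1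
    rw [commute_iff_eq]
    have e1 : x * (y * (x * b * x⁻¹) * y⁻¹) = (x * y * x) * b * x⁻¹ * y⁻¹ := by group
    have e2 : y * (x * b * x⁻¹) * y⁻¹ * x = y * x * b * y * (y⁻¹ * x⁻¹ * y⁻¹ * x) := by group
    have e3 : y⁻¹ * x⁻¹ * y⁻¹ * x = x⁻¹ * y⁻¹ := by
      have : y⁻¹ * x⁻¹ * y⁻¹ = x⁻¹ * y⁻¹ * x⁻¹ := by
        have := congrArg (·⁻¹) h2
        simpa [mul_assoc] using this.symm
      rw [this, inv_mul_cancel_right]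
    rw [e1, h2, e2, e3, mul_assoc (y * x) y, h1']
    group
  | succ j hj ih =>
    rw [band_succ (by omega)]
    have h1 : Commute (sigma n k) (sigma n j) := sigma_comm (by omega)
    exact (h1.mul_right (ih (by omega))).mul_right h1.inv_right

theorem band_comm_of_apart {i j k l : ℕ} (hi : 1 ≤ i) (hij : i < j) (hk : 1 ≤ k) (hkl : k < l)
    (hj : j ≤ n) (hl : l ≤ n) (h : Apart i j k l) :
    band n i j * band n k l = band n k l * band n i j := by
  rcases h with h | h | h | h
  · exact commute_band hkl fun m h1 h2 => (sigma_comm_band_of_lt hij (by omega)).symm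
  · exact (commute_band hij fun m h1 h2 => (sigma_comm_band_of_lt hkl (by omega)).symm).symm
  · exact commute_band hkl fun m h1 h2 =>
      (sigma_comm_band_of_between hi (by omega) (by omega) hj).symm
  · exact (commute_band hij fun m h1 h2 =>
      (sigma_comm_band_of_between hk (by omega) (by omega) hl).symm).symm

/-- In the induction step, the relation already known turns σ_s a_{r,s} σ_s⁻¹ into a_{r,s}⁻¹ σ_s
a_{r,s}. As a_{r,s} commutes with σ_{s+1}, the claim is a conjugate of the braid relation of σ_s and
σ_{s+1}. -/
theorem band_braid_sigma {r s : ℕ} (hr : 1 ≤ r) (hrs : r < s) (hs : s < n) :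
    band n r s * sigma n s * band n r s = sigma n s * band n r s * sigma n s := by
  induction s, hrs using Nat.le_induction with
  | base =>
    rw [Nat.succ_eq_add_one, band_succ_self]
    exact sigma_braid hr hs
  | succ s hrs ih =>
    have h1 : Commute (sigma n (s + 1)) (band n r s) := sigma_comm_band_of_lt hrs (by omega)
    have h2 := sigma_braid (i := s) (by omega) hs
    have h3 := ih (by omega)
    rw [band_succ hrs]
    generalize band n r s = b at *
    generalize sigma n (s + 1) = y at *
    generalize sigma n s = x at *
    have h4 : x * b * x⁻¹ = b⁻¹ * x * b := by
      rw [mul_inv_eq_iff_eq_mul, mul_assoc, mul_assoc, eq_inv_mul_iff_mul_eq, ← mul_assoc,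
        ← mul_assoc, h3]
    have h5 : b * y = y * b := h1.symm
    have h6 : b⁻¹ * y = y * b⁻¹ := h1.symm.inv_left
    rw [h4]
    calc b⁻¹ * x * b * y * (b⁻¹ * x * b) = b⁻¹ * x * (b * y) * b⁻¹ * x * b := by group
      _ = b⁻¹ * (x * y * x) * b := by rw [h5]; group
      _ = (b⁻¹ * y) * x * (y * b) := by rw [h2]; group
      _ = y * (b⁻¹ * x * b) * y := by rw [h6, ← h5]; group

/-- For t = s + 1 this is `band_braid_sigma`. Passing from t to t + 1 conjugates the relation by
σ_t, which fixes a_{r,s}. -/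
theorem band_tri {r s t : ℕ} (hr : 1 ≤ r) (hrs : r < s) (hst : s < t) (ht : t ≤ n) :
    band n s t * band n r s = band n r t * band n s t ∧
      band n s t * band n r s = band n r s * band n r t := by
  induction t, hst using Nat.le_induction with
  | base =>
    rw [Nat.succ_eq_add_one, band_succ_self, band_succ hrs, inv_mul_cancel_right, ← mul_assoc,
      ← mul_assoc, band_braid_sigma hr hrs (by omega), mul_inv_cancel_right]
    exact ⟨rfl, rfl⟩
  | succ t hst ih =>
    obtain ⟨h1, h2⟩ := ih (by omega)
    have h3 : Commute (sigma n t) (band n r s) := sigma_comm_band_of_lt hrs (by omega)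
    rw [band_succ hst, band_succ (hrs.trans hst)]
    have h4 : band n r s = sigma n t * band n r s * (sigma n t)⁻¹ := by
      rw [h3.eq, mul_inv_cancel_right]
    constructor
    · rw [h4]
      simp only [mul_assoc, inv_mul_cancel_left]
      rw [← mul_assoc (band n s t), h1, mul_assoc]
    · rw [h4]
      simp only [mul_assoc, inv_mul_cancel_left]
      rw [← mul_assoc (band n s t), h2, mul_assoc]

/-- For injectivity, the embedding `E` of the monoid into a group satisfies the Artin relations on
the atoms a_{i,i+1}. It therefore induces `P` on B_n with P ∘ F = E, and `F` is injective because
`E` is. -/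
theorem exists_hom_braidGroup (n : ℕ) : ∃ F : BKLMonoid n →* BraidGroup n,
    Function.Injective F ∧ ∀ i j, 1 ≤ i → i < j → j ≤ n → F (atom n i j) = band n i j := by
  obtain ⟨F, hF⟩ := exists_bklMonoid_hom n (fun i j => band n i j)
    (fun r s t hr hrs hst ht => (band_tri hr hrs hst ht).1)
    (fun r s t hr hrs hst ht => (band_tri hr hrs hst ht).2)
    (fun i j k l hi hij hk hkl hj hl h => band_comm_of_apart hi hij hk hkl hj hl h)
  obtain ⟨K, _, E, hE⟩ := exists_injective_hom_group n
  have hrel : ∀ r ∈ artinRels n,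
      FreeGroup.lift (fun i : {i : ℕ // 1 ≤ i ∧ i < n} => E (atom n i (i + 1))) r = 1 := by
    rintro _ (⟨i, j, hij, rfl⟩ | ⟨i, j, hij, rfl⟩)
    · rw [map_mul, map_inv, mul_inv_eq_one, map_mul, map_mul, FreeGroup.lift_apply_of,
        FreeGroup.lift_apply_of, ← map_mul, ← map_mul, atom_comm (.inl (by omega))]
    · have h1 := i.2
      have h2 := j.2
      rw [map_mul, map_inv, mul_inv_eq_one]
      simp only [map_mul, FreeGroup.lift_apply_of]
      rw [← map_mul, ← map_mul, ← map_mul, ← map_mul, hij]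
      congr 1
      have h3 := atom_tri_left (n := n) h1.1 (Nat.lt_succ_self i) (Nat.lt_succ_self (i + 1)) (by omega)
      have h4 := atom_tri_right (n := n) h1.1 (Nat.lt_succ_self i) (Nat.lt_succ_self (i + 1)) (by omega)
      rw [mul_assoc]
      simp only [Nat.succ_eq_add_one] at h3 h4
      rw [h4, mul_assoc, ← h3, h4]
  let P : BraidGroup n →* K := PresentedGroup.toGroup hrel
  have hP : ∀ i, 1 ≤ i → i < n → P (sigma n i) = E (atom n i (i + 1)) := by
    intro i h1 h2
    rw [sigma_eq ⟨h1, h2⟩]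
    exact PresentedGroup.toGroup.of hrel
  have hPb : ∀ i j, 1 ≤ i → i < j → j ≤ n → P (band n i j) = E (atom n i j) := by
    intro i j hi hij hj
    induction j, hij using Nat.le_induction with
    | base => rw [Nat.succ_eq_add_one, band_succ_self, hP i hi (by omega)]
    | succ j hij ih =>
      rw [band_succ hij, map_mul, map_mul, map_inv, hP j (by omega) (by omega), ih (by omega),
        mul_inv_eq_iff_eq_mul, ← map_mul, ← map_mul, atom_tri_left hi hij (by omega) hj]
  refine ⟨F, ?_, hF⟩
  have hcomp : ∀ x, P (F x) = E x := by
    intro x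
    induction x using BKLMonoid.induction with
    | h1 => simp
    | hmul x i j hi hij hj ih => rw [map_mul, map_mul, ih, hF i j hi hij hj, hPb i j hi hij hj,
        map_mul]
  intro x y h
  apply hE
  rw [← hcomp, ← hcomp, h]

theorem exists_length_hom (n : ℕ) : ∃ ℓ : BraidGroup n →* Multiplicative ℤ,
    ∀ i j, 1 ≤ i → i < j → j ≤ n → ℓ (band n i j) = Multiplicative.ofAdd 1 := by
  have hrel : ∀ r ∈ artinRels n, FreeGroup.lift (fun _ : {i : ℕ // 1 ≤ i ∧ i < n} =>
      Multiplicative.ofAdd (1 : ℤ)) r = 1 := by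
    rintro _ (⟨i, j, hij, rfl⟩ | ⟨i, j, hij, rfl⟩) <;> simp
  refine ⟨PresentedGroup.toGroup hrel, fun i j hi hij hj => ?_⟩
  induction j, hij using Nat.le_induction with
  | base =>
    rw [Nat.succ_eq_add_one, band_succ_self, sigma_eq ⟨hi, by omega⟩]
    exact PresentedGroup.toGroup.of hrel
  | succ j hij ih =>
    rw [band_succ hij, map_mul, map_mul, ih (by omega), map_inv, mul_comm, inv_mul_cancel_left]

end

/-! ### Divisibility in the dual braid monoid -/

section

variable {n : ℕ}

/-- All elements of the list are among the punctures `1, …, n`. -/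
def InRange (n : ℕ) (I : List ℕ) : Prop := ∀ x ∈ I, 1 ≤ x ∧ x ≤ n

theorem inRange_punctures (n : ℕ) : InRange n (punctures n) := by
  intro x hx
  rw [punctures, List.mem_range'_1] at hx
  omega

theorem InRange.subset {I J : List ℕ} (hJ : InRange n J) (h : I ⊆ J) : InRange n I :=
  fun x hx => hJ x (h hx)

theorem band_mem {I : List ℕ} {i j : ℕ} (hi : i ∈ I) (hj : j ∈ I) (hij : i < j) :
    band n i j ∈ parabolic n I :=
  Submonoid.subset_closure ⟨i, j, hi, hj, hij, rfl⟩

theorem parabolic_mono {I J : List ℕ} (h : I ⊆ J) : parabolic n I ≤ parabolic n J := by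
  apply Submonoid.closure_mono
  rintro x ⟨i, j, hi, hj, hij, rfl⟩
  exact ⟨i, j, h hi, h hj, hij, rfl⟩

theorem parabolic_le_dualMonoid {I : List ℕ} (h : InRange n I) :
    parabolic n I ≤ dualMonoid n := by
  apply parabolic_mono
  intro x hx
  have := h x hx
  rw [punctures, List.mem_range'_1]
  omega

theorem exists_hom_parabolic (n : ℕ) : ∃ F : BKLMonoid n →* BraidGroup n,
    Function.Injective F ∧ (∀ i j, 1 ≤ i → i < j → j ≤ n → F (atom n i j) = band n i j) ∧
      ∀ I, InRange n I → parabolic n I = (chordSubmonoid n {x | x ∈ I}).map F := by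
  obtain ⟨F, hF, hFa⟩ := exists_hom_braidGroup n
  refine ⟨F, hF, hFa, fun I hI => ?_⟩
  rw [chordSubmonoid, MonoidHom.map_mclosure, parabolic]
  congr 1
  ext x
  constructor
  · rintro ⟨i, j, hi, hj, hij, rfl⟩
    exact ⟨_, ⟨i, j, hi, hj, hij, rfl⟩, hFa i j (hI i hi).1 hij (hI j hj).2⟩
  · rintro ⟨_, ⟨i, j, hi, hj, hij, rfl⟩, rfl⟩
    exact ⟨i, j, hi, hj, hij, hFa i j (hI i hi).1 hij (hI j hj).2⟩

-- Send a chord to 1 if both end points lie in `S` and to 0 otherwise. The two sides of a triangle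
-- relation both see all three vertices, so this is a homomorphism to (ℕ, ·). The submonoid is
-- exactly the set where it takes the value 1, and a product of natural numbers is 1 only if both
-- factors are.
open Classical in
theorem mul_mem_chordSubmonoid {S : Set ℕ} {x y : BKLMonoid n} (h : x * y ∈ chordSubmonoid n S) :
    x ∈ chordSubmonoid n S ∧ y ∈ chordSubmonoid n S := by
  obtain ⟨F, hF⟩ := exists_bklMonoid_hom n (fun i j => if i ∈ S ∧ j ∈ S then (1 : ℕ) else 0)
    (by
      intro r s t _ _ _ _
      by_cases hr : r ∈ S <;> by_cases hs : s ∈ S <;> by_cases ht : t ∈ S <;> simp [hr, hs, ht])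
    (by
      intro r s t _ _ _ _
      by_cases hr : r ∈ S <;> by_cases hs : s ∈ S <;> by_cases ht : t ∈ S <;> simp [hr, hs, ht])
    (fun _ _ _ _ _ _ _ _ _ _ _ => mul_comm _ _)
  have h1 : ∀ x, F x = 1 → x ∈ chordSubmonoid n S := by
    intro x
    induction x using BKLMonoid.induction with
    | h1 => exact fun _ => one_mem _
    | hmul x i j hi hij hj ih =>
      intro hx
      rw [map_mul, mul_eq_one, hF i j hi hij hj] at hx
      have h2 : i ∈ S ∧ j ∈ S := by
        by_contra h2
        rw [if_neg h2] at hx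
        exact absurd hx.2 (by norm_num)
      exact mul_mem (ih hx.1) (atom_mem h2.1 h2.2 hij)
  have h2 : ∀ x, x ∈ chordSubmonoid n S → F x = 1 := by
    intro x hx
    induction hx using Submonoid.closure_induction with
    | mem x hx =>
      obtain ⟨i, j, hi, hj, hij, rfl⟩ := hx
      by_cases h3 : 1 ≤ i ∧ i < j ∧ j ≤ n
      · rw [hF i j h3.1 h3.2.1 h3.2.2, if_pos ⟨hi, hj⟩]
      · rw [atom, dif_neg h3, map_one]
    | one => exact map_one F
    | mul x y _ _ hx hy => rw [map_mul, hx, hy]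
  have h3 := h2 _ h
  rw [map_mul, mul_eq_one] at h3
  exact ⟨h1 _ h3.1, h1 _ h3.2⟩

/-- The monoids `B_I^{+*}` are closed under divisors. -/
theorem mem_parabolic_of_mul_mem {I : List ℕ} (hI : InRange n I) {x y : BraidGroup n}
    (hx : x ∈ dualMonoid n) (hy : y ∈ dualMonoid n) (h : x * y ∈ parabolic n I) :
    x ∈ parabolic n I ∧ y ∈ parabolic n I := by
  obtain ⟨F, hF, -, hFp⟩ := exists_hom_parabolic n
  rw [dualMonoid, hFp _ (inRange_punctures n)] at hx hy
  obtain ⟨x, -, rfl⟩ := hx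
  obtain ⟨y, -, rfl⟩ := hy
  rw [hFp I hI] at h ⊢
  obtain ⟨z, hz, hxy⟩ := h
  rw [← map_mul] at hxy
  rw [hF hxy] at hz
  have := mul_mem_chordSubmonoid hz
  exact ⟨⟨x, this.1, rfl⟩, ⟨y, this.2, rfl⟩⟩

theorem mem_chordSubmonoid_punctures (z : BKLMonoid n) :
    z ∈ chordSubmonoid n {x | x ∈ punctures n} := by
  induction z using BKLMonoid.induction with
  | h1 => exact one_mem _
  | hmul z i j hi hij hj ih =>
    refine mul_mem ih (atom_mem ?_ ?_ hij)
    all_goals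
      rw [Set.mem_ofPred_eq, punctures, List.mem_range'_1]
      omega

theorem exists_lcm_band {I : List ℕ} (hI : InRange n I) {x y : BraidGroup n}
    (hx : x ∈ dualMonoid n) (hy : y ∈ dualMonoid n) {i j k l : ℕ} (hi : i ∈ I) (hj : j ∈ I)
    (hij : i < j) (hk : k ∈ I) (hl : l ∈ I) (hkl : k < l) (h : x * band n i j = y * band n k l) :
    ∃ z ∈ dualMonoid n, ∃ u ∈ parabolic n I, ∃ v ∈ parabolic n I, x = z * u ∧ y = z * v := by
  obtain ⟨F, hF, hFa, hFp⟩ := exists_hom_parabolic n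
  have hD := hFp _ (inRange_punctures n)
  rw [dualMonoid, hD] at hx hy ⊢
  obtain ⟨x, -, rfl⟩ := hx
  obtain ⟨y, -, rfl⟩ := hy
  rw [← hFa i j (hI i hi).1 hij (hI j hj).2, ← hFa k l (hI k hk).1 hkl (hI l hl).2, ← map_mul,
    ← map_mul] at h
  obtain ⟨z, u, hu, v, hv, rfl, rfl⟩ := exists_lcm_atom (S := {x | x ∈ I}) (hI i hi).1 hij
    (hI j hj).2 (hI k hk).1 hkl (hI l hl).2 hi hj hk hl (hF h)
  refine ⟨F z, ⟨z, ?_, rfl⟩, F u, ?_, F v, ?_, map_mul _ _ _, map_mul _ _ _⟩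
  · exact mem_chordSubmonoid_punctures z
  · rw [hFp I hI]
    exact ⟨u, hu, rfl⟩
  · rw [hFp I hI]
    exact ⟨v, hv, rfl⟩

theorem exists_lcm_band_of_apart {x y : BraidGroup n} (hx : x ∈ dualMonoid n)
    (hy : y ∈ dualMonoid n) {i j k l : ℕ} (hi : 1 ≤ i) (hij : i < j) (hj : j ≤ n) (hk : 1 ≤ k)
    (hkl : k < l) (hl : l ≤ n) (hap : Apart i j k l) (h : x * band n i j = y * band n k l) :
    ∃ z ∈ dualMonoid n, x = z * band n k l ∧ y = z * band n i j := by
  obtain ⟨F, hF, hFa, hFp⟩ := exists_hom_parabolic n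
  rw [dualMonoid, hFp _ (inRange_punctures n)] at hx hy ⊢
  obtain ⟨x, -, rfl⟩ := hx
  obtain ⟨y, -, rfl⟩ := hy
  rw [← hFa i j hi hij hj, ← hFa k l hk hkl hl, ← map_mul, ← map_mul] at h
  obtain ⟨z, rfl, rfl⟩ := exists_lcm_atom_of_apart hi hij hj hk hkl hl hap (hF h)
  refine ⟨F z, ⟨z, mem_chordSubmonoid_punctures z, rfl⟩, ?_, ?_⟩
  · rw [map_mul, hFa k l hk hkl hl]
  · rw [map_mul, hFa i j hi hij hj]

/-- The number of letters of a word in the generators, counted with sign. -/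
noncomputable def braidLength (n : ℕ) (x : BraidGroup n) : ℤ :=
  Multiplicative.toAdd ((exists_length_hom n).choose x)

theorem braidLength_mul (x y : BraidGroup n) :
    braidLength n (x * y) = braidLength n x + braidLength n y := by
  rw [braidLength, map_mul]
  rfl

theorem braidLength_one : braidLength n 1 = 0 := by
  rw [braidLength, map_one]
  rfl

theorem braidLength_inv (x : BraidGroup n) : braidLength n x⁻¹ = - braidLength n x := by
  rw [braidLength, map_inv]
  rfl

theorem braidLength_band {i j : ℕ} (hi : 1 ≤ i) (hij : i < j) (hj : j ≤ n) :
    braidLength n (band n i j) = 1 := by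
  rw [braidLength, (exists_length_hom n).choose_spec i j hi hij hj]
  rfl

theorem eq_one_or_exists_of_mem_closure {G : Type*} [Monoid G] {A : Set G} {x : G}
    (hx : x ∈ Submonoid.closure A) : x = 1 ∨ ∃ y ∈ Submonoid.closure A, ∃ a ∈ A, x = y * a := by
  induction hx using Submonoid.closure_induction_right with
  | one => exact .inl rfl
  | mul_right x hx y hy _ => exact .inr ⟨x, hx, y, hy, rfl⟩

theorem eq_one_or_exists_of_mem_parabolic {I : List ℕ} {x : BraidGroup n}
    (hx : x ∈ parabolic n I) :
    x = 1 ∨ ∃ y ∈ parabolic n I, ∃ i ∈ I, ∃ j ∈ I, i < j ∧ x = y * band n i j := by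
  rcases eq_one_or_exists_of_mem_closure hx with h | ⟨y, hy, _, ⟨i, j, hi, hj, hij, rfl⟩, h⟩
  · exact .inl h
  · exact .inr ⟨y, hy, i, hi, j, hj, hij, h⟩

theorem braidLength_nonneg {x : BraidGroup n} (hx : x ∈ dualMonoid n) : 0 ≤ braidLength n x := by
  have hx' : x ∈ parabolic n (punctures n) := hx
  rw [parabolic] at hx'
  clear hx
  induction hx' using Submonoid.closure_induction with
  | mem x hx =>
    obtain ⟨i, j, hi, hj, hij, rfl⟩ := hx
    rw [braidLength_band (inRange_punctures n i hi).1 hij (inRange_punctures n j hj).2]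
    norm_num
  | one => rw [braidLength_one]
  | mul x y hx hy h1 h2 =>
    rw [braidLength_mul]
    exact add_nonneg h1 h2

theorem eq_one_of_braidLength {x : BraidGroup n} (hx : x ∈ dualMonoid n)
    (h : braidLength n x ≤ 0) : x = 1 := by
  rcases eq_one_or_exists_of_mem_parabolic hx with h1 | ⟨y, hy, i, hi, j, hj, hij, rfl⟩
  · exact h1
  · rw [braidLength_mul, braidLength_band (inRange_punctures n i hi).1 hij
      (inRange_punctures n j hj).2] at h
    have := braidLength_nonneg hy
    omega

theorem eq_one_of_inv_mem {x : BraidGroup n} (hx : x ∈ dualMonoid n) (hx' : x⁻¹ ∈ dualMonoid n) :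
    x = 1 := by
  have := braidLength_nonneg hx'
  rw [braidLength_inv] at this
  exact eq_one_of_braidLength hx (by omega)

/-! ### Maximal right divisors -/

theorem IsMaxRightDivisor.unique {M N : Submonoid (BraidGroup n)} (hN : N ≤ dualMonoid n)
    {β x y : BraidGroup n} (hx : IsMaxRightDivisor M N β x) (hy : IsMaxRightDivisor M N β y) :
    x = y := by
  have h1 := hx.2.2 y hy.1 hy.2.1
  have h2 := hy.2.2 x hx.1 hx.2.1
  rw [← inv_inv (y * x⁻¹), mul_inv_rev, inv_inv] at h2
  have := eq_one_of_inv_mem (x := x * y⁻¹) (hN h1) (by simpa using hN (hy.2.2 x hx.1 hx.2.1))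
  rwa [mul_inv_eq_one] at this

/-- Maximal right divisors exist in a submonoid whose generators have common multiples. -/
theorem exists_isMaxRightDivisor {M : Submonoid (BraidGroup n)} {A : Set (BraidGroup n)}
    (hM : M ≤ dualMonoid n) (hA : Submonoid.closure A ≤ M) (hlen : ∀ a ∈ A, braidLength n a = 1)
    (hlcm : ∀ a ∈ A, ∀ b ∈ A, ∀ x ∈ M, ∀ y ∈ M, x * a = y * b →
      ∃ z ∈ M, ∃ u ∈ Submonoid.closure A, ∃ v ∈ Submonoid.closure A, x = z * u ∧ y = z * v)
    {β : BraidGroup n} (hβ : β ∈ M) :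
    ∃ x, IsMaxRightDivisor M (Submonoid.closure A) β x := by
  obtain ⟨k, hk⟩ : ∃ k : ℕ, braidLength n β = k :=
    Int.eq_ofNat_of_zero_le (braidLength_nonneg (hM hβ))
  induction k using Nat.strong_induction_on generalizing β with
  | _ k ih =>
  by_cases hdiv : ∃ a ∈ A, β * a⁻¹ ∈ M
  swap
  · refine ⟨1, one_mem _, by simpa using hβ, fun γ hγ hβγ => ?_⟩
    rcases eq_one_or_exists_of_mem_closure hγ with rfl | ⟨y, hy, a, ha, rfl⟩
    · simp
    · refine absurd ⟨a, ha, ?_⟩ hdiv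
      have := mul_mem hβγ (hA hy)
      rwa [mul_inv_rev, ← mul_assoc, inv_mul_cancel_right] at this
  -- maximal right divisors of proper left factors
  have ih' : ∀ x ∈ M, ∀ y ∈ M, braidLength n y ≠ 0 → β = x * y →
      ∃ g, IsMaxRightDivisor M (Submonoid.closure A) x g := by
    intro x hx y hy hy0 hxy
    have h1 := braidLength_nonneg (hM hx)
    have h2 := braidLength_nonneg (hM hy)
    rw [hxy, braidLength_mul] at hk
    obtain ⟨l, hl⟩ := Int.eq_ofNat_of_zero_le h1
    exact ih l (by omega) hx hl
  obtain ⟨a, ha, hβa⟩ := hdiv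
  have hAM : ∀ a ∈ A, a ∈ M := fun a ha => hA (Submonoid.subset_closure ha)
  obtain ⟨g, hg⟩ := ih' _ hβa a (hAM a ha) (by rw [hlen a ha]; norm_num)
    (by rw [inv_mul_cancel_right])
  refine ⟨g * a, mul_mem hg.1 (Submonoid.subset_closure ha), ?_, fun γ hγ hβγ => ?_⟩
  · have := hg.2.1
    rwa [mul_assoc, ← mul_inv_rev] at this
  rcases eq_one_or_exists_of_mem_closure hγ with rfl | ⟨γ', hγ', b, hb, rfl⟩
  · rw [inv_one, mul_one]
    exact mul_mem hg.1 (Submonoid.subset_closure ha)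
  have hβb : β * b⁻¹ ∈ M := by
    have := mul_mem hβγ (hA hγ')
    rwa [mul_inv_rev, ← mul_assoc, inv_mul_cancel_right] at this
  obtain ⟨g', hg'⟩ := ih' _ hβb b (hAM b hb) (by rw [hlen b hb]; norm_num)
    (by rw [inv_mul_cancel_right])
  -- A divisor ending in another generator `b` is compared through the common multiple u a = v b.
  -- With `g₀` the maximal divisor of `z`, both g a and g' b will equal g₀ u a, so the choice of the
  -- last generator is immaterial.
  obtain ⟨z, hz, u, hu, v, hv, hzu, hzv⟩ := hlcm a ha b hb _ hβa _ hβb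
    (by rw [inv_mul_cancel_right, inv_mul_cancel_right])
  obtain ⟨g₀, hg₀⟩ := ih' z hz (u * a) (mul_mem (hA hu) (hAM a ha)) (by
      have := braidLength_nonneg (hM (hA hu))
      rw [braidLength_mul, hlen a ha]
      omega) (by rw [← mul_assoc, ← hzu, inv_mul_cancel_right])
  -- the maximal right divisor of `z u` is that of `z` times `u`
  have key : ∀ x g u, x = z * u → u ∈ Submonoid.closure A →
      IsMaxRightDivisor M (Submonoid.closure A) x g → g = g₀ * u := by
    intro x g u hx hu hg
    have h1 : g * (g₀ * u)⁻¹ ∈ Submonoid.closure A := by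
      apply hg.2.2 _ (mul_mem hg₀.1 hu)
      rw [hx, mul_inv_rev, ← mul_assoc, mul_inv_cancel_right]
      exact hg₀.2.1
    have h2 : z * (g * (g₀ * u)⁻¹ * g₀)⁻¹ ∈ M := by
      have := hg.2.1
      rw [hx] at this
      convert this using 1
      group
    have h3 := hg₀.2.2 _ (mul_mem h1 hg₀.1) h2
    rw [mul_inv_rev, ← mul_assoc, mul_inv_cancel, one_mul] at h3
    have h4 := eq_one_of_inv_mem (hM (hA h1)) (hM (hA h3))
    rwa [mul_inv_eq_one] at h4
  have h1 := key _ _ _ hzu hu hg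
  have h2 := key _ _ _ hzv hv hg'
  have h3 : g * a = g' * b := by
    have h4 : u * a = v * b := by
      have : z * u * a = z * v * b := by
        rw [← hzu, ← hzv, inv_mul_cancel_right, inv_mul_cancel_right]
      rwa [mul_assoc, mul_assoc, mul_right_inj] at this
    rw [h1, h2, mul_assoc, mul_assoc, h4]
  rw [h3, mul_inv_rev, ← mul_assoc, mul_inv_cancel_right]
  apply hg'.2.2 γ' hγ'
  rwa [mul_assoc, ← mul_inv_rev]

theorem exists_isMaxRightDivisor_parabolic {L I : List ℕ} (hL : InRange n L) (hI : I ⊆ L)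
    {β : BraidGroup n} (hβ : β ∈ parabolic n L) :
    ∃ x, IsMaxRightDivisor (parabolic n L) (parabolic n I) β x := by
  have hLM := parabolic_le_dualMonoid hL
  refine exists_isMaxRightDivisor hLM (parabolic_mono hI) ?_ ?_ hβ
  · rintro _ ⟨i, j, hi, hj, hij, rfl⟩
    exact braidLength_band (hL i (hI hi)).1 hij (hL j (hI hj)).2
  · rintro _ ⟨i, j, hi, hj, hij, rfl⟩ _ ⟨k, l, hk, hl, hkl, rfl⟩ x hx y hy h
    obtain ⟨z, hz, u, hu, v, hv, rfl, rfl⟩ := exists_lcm_band (hL.subset hI) (hLM hx) (hLM hy)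
      hi hj hij hk hl hkl h
    exact ⟨z, (mem_parabolic_of_mul_mem hL hz (hLM (parabolic_mono hI hu)) hx).1, u, hu, v, hv,
      rfl, rfl⟩

/-- No chord of `I` crosses or meets a chord of `J`. -/
def Separated (I J : List ℕ) : Prop :=
  ∀ i ∈ I, ∀ j ∈ I, ∀ k ∈ J, ∀ l ∈ J, i < j → k < l → Apart i j k l

theorem Separated.symm {I J : List ℕ} (h : Separated I J) : Separated J I :=
  fun i hi j hj k hk l hl hij hkl => (h k hk l hl i hi j hj hkl hij).symm

theorem Separated.commute {I J : List ℕ} (h : Separated I J) (hI : InRange n I) (hJ : InRange n J)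
    {x y : BraidGroup n} (hx : x ∈ parabolic n I) (hy : y ∈ parabolic n J) : x * y = y * x := by
  have h1 : ∀ i ∈ I, ∀ j ∈ I, i < j → ∀ y ∈ parabolic n J, Commute (band n i j) y := by
    intro i hi j hj hij y hy
    rw [parabolic] at hy
    induction hy using Submonoid.closure_induction with
    | mem y hy =>
      obtain ⟨k, l, hk, hl, hkl, rfl⟩ := hy
      exact band_comm_of_apart (hI i hi).1 hij (hJ k hk).1 hkl (hI j hj).2 (hJ l hl).2
        (h i hi j hj k hk l hl hij hkl)
    | one => exact Commute.one_right _
    | mul x y _ _ hx hy => exact hx.mul_right hy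
  rw [parabolic] at hx
  induction hx using Submonoid.closure_induction with
  | mem x hx =>
    obtain ⟨i, j, hi, hj, hij, rfl⟩ := hx
    exact h1 i hi j hj hij y hy
  | one => simp
  | mul x z _ _ hx hz => rw [mul_assoc, hz, ← mul_assoc, hx, mul_assoc]

/-- A chord of `I` and a chord of `J` commute and have their product as least common multiple, so
the union of the two generating sets still meets the common multiple condition of
`exists_isMaxRightDivisor`. -/
theorem exists_isMaxRightDivisor_sup {L I J : List ℕ} (hL : InRange n L) (hI : I ⊆ L) (hJ : J ⊆ L)
    (hIJ : Separated I J) {β : BraidGroup n} (hβ : β ∈ parabolic n L) :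
    ∃ x, IsMaxRightDivisor (parabolic n L) (parabolic n I ⊔ parabolic n J) β x := by
  have hLM := parabolic_le_dualMonoid hL
  have hsup : parabolic n I ⊔ parabolic n J ≤ parabolic n L :=
    sup_le (parabolic_mono hI) (parabolic_mono hJ)
  rw [parabolic.eq_1 n I, parabolic.eq_1 n J, ← Submonoid.closure_union] at hsup ⊢
  have key : ∀ {I K}, I ⊆ L → parabolic n I ≤ K → K ≤ parabolic n L →
      ∀ i ∈ I, ∀ j ∈ I, i < j → ∀ k ∈ I, ∀ l ∈ I, k < l → ∀ x ∈ parabolic n L,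
        ∀ y ∈ parabolic n L, x * band n i j = y * band n k l →
      ∃ z ∈ parabolic n L, ∃ u ∈ K, ∃ v ∈ K, x = z * u ∧ y = z * v := by
    intro I K hI hIK hK i hi j hj hij k hk l hl hkl x hx y hy h
    obtain ⟨z, hz, u, hu, v, hv, rfl, rfl⟩ := exists_lcm_band (hL.subset hI) (hLM hx) (hLM hy)
      hi hj hij hk hl hkl h
    exact ⟨z, (mem_parabolic_of_mul_mem hL hz (hLM (parabolic_mono hI hu)) hx).1, u, hIK hu, v,
      hIK hv, rfl, rfl⟩
  have key' : ∀ {i j k l}, i ∈ L → j ∈ L → k ∈ L → l ∈ L → i < j → k < l → Apart i j k l →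
      ∀ x ∈ parabolic n L, ∀ y ∈ parabolic n L, x * band n i j = y * band n k l →
      ∃ z ∈ parabolic n L, x = z * band n k l ∧ y = z * band n i j := by
    intro i j k l hi hj hk hl hij hkl hap x hx y hy h
    obtain ⟨z, hz, rfl, rfl⟩ := exists_lcm_band_of_apart (hLM hx) (hLM hy) (hL i hi).1 hij
      (hL j hj).2 (hL k hk).1 hkl (hL l hl).2 hap h
    exact ⟨z, (mem_parabolic_of_mul_mem hL hz (hLM (band_mem hk hl hkl)) hx).1, rfl, rfl⟩
  refine exists_isMaxRightDivisor hLM hsup ?_ ?_ hβ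
  · rintro _ (⟨i, j, hi, hj, hij, rfl⟩ | ⟨i, j, hi, hj, hij, rfl⟩)
    · exact braidLength_band (hL i (hI hi)).1 hij (hL j (hI hj)).2
    · exact braidLength_band (hL i (hJ hi)).1 hij (hL j (hJ hj)).2
  · have hIK := Submonoid.closure_mono (M := BraidGroup n)
      (Set.subset_union_left (s := {x | ∃ i j, i ∈ I ∧ j ∈ I ∧ i < j ∧ x = band n i j})
        (t := {x | ∃ i j, i ∈ J ∧ j ∈ J ∧ i < j ∧ x = band n i j}))
    have hJK := Submonoid.closure_mono (M := BraidGroup n)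
      (Set.subset_union_right (s := {x | ∃ i j, i ∈ I ∧ j ∈ I ∧ i < j ∧ x = band n i j})
        (t := {x | ∃ i j, i ∈ J ∧ j ∈ J ∧ i < j ∧ x = band n i j}))
    rintro _ (⟨i, j, hi, hj, hij, rfl⟩ | ⟨i, j, hi, hj, hij, rfl⟩) _
      (⟨k, l, hk, hl, hkl, rfl⟩ | ⟨k, l, hk, hl, hkl, rfl⟩) x hx y hy h
    · exact key hI hIK hsup i hi j hj hij k hk l hl hkl x hx y hy h
    · obtain ⟨z, hz, h1, h2⟩ := key' (hI hi) (hI hj) (hJ hk) (hJ hl) hij hkl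
        (hIJ i hi j hj k hk l hl hij hkl) x hx y hy h
      exact ⟨z, hz, _, hJK (band_mem hk hl hkl), _, hIK (band_mem hi hj hij), h1, h2⟩
    · obtain ⟨z, hz, h1, h2⟩ := key' (hJ hi) (hJ hj) (hI hk) (hI hl) hij hkl
        (hIJ k hk l hl i hi j hj hkl hij).symm x hx y hy h
      exact ⟨z, hz, _, hIK (band_mem hk hl hkl), _, hJK (band_mem hi hj hij), h1, h2⟩
    · exact key hJ hJK hsup i hi j hj hij k hk l hl hkl x hx y hy h

end

/-! ### Circular lists of punctures -/

section

variable {n : ℕ}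

/-- The list of punctures is in anticlockwise order. -/
def IsCircular (n : ℕ) (L : List ℕ) : Prop :=
  InRange n L ∧ ∃ S : List ℕ, S.Pairwise (· < ·) ∧ S ~r L

theorem isCircular_punctures (n : ℕ) : IsCircular n (punctures n) :=
  ⟨inRange_punctures n, _, List.pairwise_lt_range', List.IsRotated.refl _⟩

theorem IsCircular.nodup {L : List ℕ} (h : IsCircular n L) : L.Nodup := by
  obtain ⟨-, S, hS, hSL⟩ := h
  exact hSL.nodup_iff.1 (hS.imp fun h => h.ne)

theorem IsCircular.rotate {L : List ℕ} (h : IsCircular n L) (i : ℕ) : IsCircular n (L.rotate i) := by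
  obtain ⟨hL, S, hS, hSL⟩ := h
  exact ⟨fun x hx => hL x (List.mem_rotate.1 hx), S, hS, hSL.trans ⟨i, rfl⟩⟩

theorem exists_append_of_isRotated {α : Type*} {S L : List α} (h : S ~r L) :
    ∃ a b, S = a ++ b ∧ L = b ++ a := by
  obtain ⟨m, rfl⟩ := h
  exact ⟨_, _, (List.take_append_drop (m % S.length) S).symm, List.rotate_eq_drop_append_take_mod⟩

theorem IsCircular.sublist {L L' : List ℕ} (h : IsCircular n L) (hs : L'.Sublist L) :
    IsCircular n L' := by
  obtain ⟨hL, S, hS, hSL⟩ := h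
  obtain ⟨a, b, rfl, rfl⟩ := exists_append_of_isRotated hSL
  obtain ⟨b', a', rfl, hb, ha⟩ := List.sublist_append_iff.1 hs
  exact ⟨hL.subset hs.subset, a' ++ b', hS.sublist (ha.append hb), List.isRotated_append⟩

/-- The place where the circle is cut open to get the increasing list falls within `I` or within
`J`. The other of the two is then a contiguous stretch of that list, and a chord of the first either
passes over the stretch or stays on one side of it. -/
theorem IsCircular.separated {I J : List ℕ} (h : IsCircular n (I ++ J)) : Separated I J := by
  obtain ⟨-, S, hS, hSL⟩ := h
  obtain ⟨a, b, rfl, hIJ⟩ := exists_append_of_isRotated hSL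
  rcases List.append_eq_append_iff.1 hIJ with ⟨c, rfl, rfl⟩ | ⟨c, rfl, rfl⟩
  · simp only [List.pairwise_append, List.mem_append] at hS
    intro i hi j hj k hk l hl hij hkl
    rw [List.mem_append] at hk hl
    have hIc := hS.2.1.2.2
    have haI := hS.2.2
    rcases hk with hk | hk
    · exact .inl (hIc j hj k hk)
    · rcases hl with hl | hl
      · exact .inr (.inr (.inr ⟨haI k hk i (.inl hi), hIc j hj l hl⟩))
      · exact .inr (.inl (haI l hl i (.inl hi)))
  · simp only [List.pairwise_append, List.mem_append] at hS
    intro i hi j hj k hk l hl hij hkl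
    rw [List.mem_append] at hi hj
    have hcJ := hS.1.2.2
    have hJb := hS.2.2
    rcases hj with hj | hj
    · rcases hi with hi | hi
      · exact .inr (.inl (hJb l (.inr hl) i hi))
      · exact .inr (.inr (.inl ⟨hcJ i hi k hk, hJb l (.inr hl) j hj⟩))
    · exact .inl (hcJ j hj k hk)

theorem omitStar_zero (L : List ℕ) : omitStar L 0 = L.dropLast := by
  rw [omitStar, Nat.zero_mod, Nat.sub_zero, List.rotate_length]

theorem length_omitStar (L : List ℕ) (i : ℕ) : (omitStar L i).length = L.length - 1 := by
  rw [omitStar, List.length_dropLast, List.length_rotate]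

theorem omitStar_subset (L : List ℕ) (i : ℕ) : omitStar L i ⊆ L := fun _ hx =>
  List.mem_rotate.1 ((List.dropLast_sublist _).subset hx)

theorem IsCircular.omitStar {L : List ℕ} (h : IsCircular n L) (i : ℕ) :
    IsCircular n (omitStar L i) :=
  (h.rotate _).sublist (List.dropLast_sublist _)

/-- Two punctures out of at least three belong to `omitStar L i` for arbitrarily large `i`. -/
theorem exists_mem_omitStar {L : List ℕ} (hL : L.Nodup) (h3 : 3 ≤ L.length) {p q : ℕ} (hp : p ∈ L)
    (hq : q ∈ L) (m : ℕ) : ∃ i, m < i ∧ p ∈ omitStar L i ∧ q ∈ omitStar L i := by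
  obtain ⟨z, hz, hz'⟩ : ∃ z ∈ L.toFinset, z ∉ ({p, q} : Finset ℕ) := by
    apply Finset.exists_mem_notMem_of_card_lt_card
    rw [List.toFinset_card_of_nodup hL]
    exact lt_of_le_of_lt Finset.card_le_two (by omega)
  rw [List.mem_toFinset, List.mem_iff_getElem] at hz
  obtain ⟨t, ht, rfl⟩ := hz
  simp only [Finset.mem_insert, Finset.mem_singleton, not_or] at hz'
  -- This index leaves out the third puncture, at position `t` counted from 0; the multiple of the
  -- length only serves to exceed `m`.
  have key : omitStar L ((m + 1) * L.length + (L.length - 1 - t)) =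
      L.drop (t + 1) ++ L.take t := by
    have h1 : L.length - (L.length - 1 - t) = t + 1 := by omega
    rw [omitStar, Nat.mul_add_mod_self_right, Nat.mod_eq_of_lt (by omega), h1,
      List.rotate_eq_drop_append_take (by omega), List.take_succ_eq_append_getElem ht,
      ← List.append_assoc, List.dropLast_concat]
  have hmem : ∀ x ∈ L, x ≠ L[t] → x ∈ L.drop (t + 1) ++ L.take t := by
    intro x hx hne
    rw [← List.take_append_drop t L, List.drop_eq_getElem_cons ht] at hx
    simp only [List.mem_append, List.mem_cons] at hx ⊢
    tauto
  refine ⟨(m + 1) * L.length + (L.length - 1 - t), ?_, ?_, ?_⟩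
  · nlinarith
  · rw [key]
    exact hmem p hp (Ne.symm hz'.1)
  · rw [key]
    exact hmem q hq (Ne.symm hz'.2)

theorem interval_sublist (L : List ℕ) (m M : ℕ) : (interval L m M).Sublist L :=
  (List.take_sublist _ _).trans (List.drop_sublist _ _)

theorem tailPunctures_sublist (L k : List ℕ) (j : ℕ) : (tailPunctures L k j).Sublist L :=
  interval_sublist _ _ _

/-! ### Normal orderings -/

theorem foldr_max_le {l : List ℕ} {a b : ℕ} : l.foldr max b ≤ a ↔ b ≤ a ∧ ∀ x ∈ l, x ≤ a := by
  induction l with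
  | nil => simp
  | cons c l ih =>
    simp only [List.foldr_cons, max_le_iff, ih, List.mem_cons, forall_eq_or_imp]
    tauto

theorem le_foldr_min {l : List ℕ} {a b : ℕ} : a ≤ l.foldr min b ↔ a ≤ b ∧ ∀ x ∈ l, a ≤ x := by
  induction l with
  | nil => simp
  | cons c l ih =>
    simp only [List.foldr_cons, le_min_iff, ih, List.mem_cons, forall_eq_or_imp]
    tauto

theorem lo_le {k : List ℕ} {j a : ℕ} :
    lo k j ≤ a ↔ 1 ≤ a ∧ ∀ x ∈ k.take j, x < entry k (j + 1) → x + 1 ≤ a := by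
  rw [lo, foldr_max_le]
  simp only [List.mem_map, List.mem_filter, decide_eq_true_eq, forall_exists_index, and_imp]
  exact and_congr_right fun _ =>
    ⟨fun h x hx hlt => h _ x hx hlt rfl, fun h _ x hx hlt he => he ▸ h x hx hlt⟩

theorem le_hi {k : List ℕ} {r j a : ℕ} :
    a ≤ hi r k j ↔ a ≤ r ∧ ∀ x ∈ k.take j, entry k (j + 1) < x → a ≤ x := by
  rw [hi, le_foldr_min]
  simp only [List.mem_filter, decide_eq_true_eq, and_imp]

/-- `k` is a permutation of `1, …, r - 1`. -/
abbrev IsPermutation (r : ℕ) (k : List ℕ) : Prop := k.Perm (List.range' 1 (r - 1))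

theorem restrict_range' {r m M : ℕ} (hm : 1 ≤ m) (hmM : m ≤ M) (hM : M ≤ r) :
    restrict (List.range' 1 (r - 1)) m M = List.range' 1 (M - m) := by
  have h1 : List.range' 1 (r - 1) =
      List.range' 1 (m - 1) ++ (List.range' m (M - m) ++ List.range' M (r - M)) := by
    have e1 : List.range' M (r - M) = List.range' (m + (M - m)) (r - M) := by congr 1; omega
    have e2 : List.range' m (M - m + (r - M)) = List.range' (1 + (m - 1)) (M - m + (r - M)) := by
      congr 1; omega
    rw [e1, List.range'_append_1, e2, List.range'_append_1]
    congr 1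
    omega
  have h2 : (List.range' 1 (m - 1)).filter (fun x => decide (m ≤ x ∧ x < M)) = [] := by
    rw [List.filter_eq_nil_iff]
    intro x hx
    rw [List.mem_range'_1] at hx
    rw [decide_eq_true_eq]
    omega
  have h3 : (List.range' M (r - M)).filter (fun x => decide (m ≤ x ∧ x < M)) = [] := by
    rw [List.filter_eq_nil_iff]
    intro x hx
    rw [List.mem_range'_1] at hx
    rw [decide_eq_true_eq]
    omega
  have h4 : (List.range' m (M - m)).filter (fun x => decide (m ≤ x ∧ x < M)) =
      List.range' m (M - m) := by
    rw [List.filter_eq_self]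
    intro x hx
    rw [List.mem_range'_1] at hx
    rw [decide_eq_true_eq]
    omega
  rw [DualBraid.restrict, h1, List.filter_append, List.filter_append, h2, h3, h4, List.nil_append,
    List.append_nil, List.map_sub_range' (by omega)]
  congr 1
  omega

theorem IsPermutation.restrict {r m M : ℕ} {k : List ℕ} (hk : IsPermutation r k) (hm : 1 ≤ m)
    (hmM : m ≤ M) (hM : M ≤ r) : (restrict k m M).Perm (List.range' 1 (M - m)) := by
  rw [← restrict_range' hm hmM hM]
  exact (hk.filter _).map _

theorem entry_mem {k : List ℕ} {i : ℕ} (hi : 1 ≤ i) (hk : i ≤ k.length) : entry k i ∈ k := by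
  rw [entry, List.getD_eq_getElem _ _ (by omega)]
  exact List.getElem_mem _

theorem IsPermutation.length {r : ℕ} {k : List ℕ} (hk : IsPermutation r k) :
    k.length = r - 1 := by
  rw [hk.length_eq, List.length_range']

theorem IsPermutation.nodup {r : ℕ} {k : List ℕ} (hk : IsPermutation r k) : k.Nodup :=
  hk.nodup_iff.2 (List.nodup_range')

theorem IsPermutation.mem {r : ℕ} {k : List ℕ} (hk : IsPermutation r k) {x : ℕ} :
    x ∈ k ↔ 1 ≤ x ∧ x < r := by
  rw [hk.mem_iff, List.mem_range'_1]
  omega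

theorem IsPermutation.entry {r i : ℕ} {k : List ℕ} (hk : IsPermutation r k) (hi : 1 ≤ i)
    (hir : i < r) : 1 ≤ entry k i ∧ entry k i < r := by
  have := entry_mem hi (by rw [hk.length]; omega)
  exact hk.mem.1 this

/-- The value k(j+1) satisfies m_j ≤ k(j+1) < M_j, so I_j has at least two punctures. The value k(1)
is among the first j entries and differs from k(j+1), so it bounds I_j from one side: no I_j
straddles the first arc. -/
theorem IsPermutation.bounds {r j : ℕ} {k : List ℕ} (hk : IsPermutation r k) (hj : 1 ≤ j)
    (hjr : j ≤ r - 2) : 1 ≤ lo k j ∧ lo k j < hi r k j ∧ hi r k j ≤ r ∧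
      (hi r k j ≤ DualBraid.entry k 1 ∨ DualBraid.entry k 1 < lo k j) := by
  have he := hk.entry (i := j + 1) (by omega) (by omega)
  have h1 : 1 ≤ lo k j := (lo_le.1 le_rfl).1
  have h2 : lo k j ≤ DualBraid.entry k (j + 1) := lo_le.2 ⟨he.1, fun x _ hx => hx⟩
  have h3 : DualBraid.entry k (j + 1) + 1 ≤ hi r k j := le_hi.2 ⟨he.2, fun x _ hx => hx⟩
  have h4 : hi r k j ≤ r := (le_hi.1 le_rfl).1
  refine ⟨h1, by omega, h4, ?_⟩
  have hlen := hk.length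
  have e1 : DualBraid.entry k 1 = k[0] := List.getD_eq_getElem _ _ (by omega)
  have e2 : DualBraid.entry k (j + 1) = k[j] := List.getD_eq_getElem _ _ (by omega)
  have hmem : DualBraid.entry k 1 ∈ k.take j := by
    rw [e1, List.mem_take_iff_getElem]
    exact ⟨0, by omega, rfl⟩
  have hne : DualBraid.entry k 1 ≠ DualBraid.entry k (j + 1) := by
    rw [e1, e2]
    intro h
    have := (List.Nodup.getElem_inj_iff hk.nodup).1 h
    omega
  rcases lt_or_gt_of_ne hne with h | h
  · exact .inr ((lo_le.1 le_rfl).2 _ hmem h)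
  · exact .inl ((le_hi.1 le_rfl).2 _ hmem h)

theorem length_interval {L : List ℕ} {m M : ℕ} (hm : 1 ≤ m) (hmM : m ≤ M) (hM : M ≤ L.length) :
    (interval L m M).length = M - m + 1 := by
  rw [interval, List.length_take, List.length_drop]
  omega

theorem tailPunctures_subset {L k : List ℕ} {j : ℕ} (hk : IsPermutation L.length k) (hj : 1 ≤ j)
    (hjr : j ≤ L.length - 2) :
    tailPunctures L k j ⊆ L.take (entry k 1) ∨ tailPunctures L k j ⊆ L.drop (entry k 1) := by
  obtain ⟨h1, h2, h3, h4⟩ := hk.bounds hj hjr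
  rw [tailPunctures, interval]
  rcases h4 with h4 | h4
  · left
    intro x hx
    rw [List.take_drop] at hx
    exact (List.take_sublist_take_left (by omega)).subset ((List.drop_sublist _ _).subset hx)
  · right
    intro x hx
    exact (List.drop_sublist_drop_left _ (by omega)).subset ((List.take_sublist _ _).subset hx)

/-- The first entry that satisfies a predicate not satisfied by `k(1)`. -/
theorem exists_first_entry {r : ℕ} {k : List ℕ} (hk : IsPermutation r k) (P : ℕ → Prop)
    [DecidablePred P] (h1 : ¬ P (entry k 1)) {x : ℕ} (hx : x ∈ k) (hP : P x) :
    ∃ j, 1 ≤ j ∧ j ≤ r - 2 ∧ P (entry k (j + 1)) ∧ entry k 1 ∈ k.take j ∧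
      ∀ y ∈ k.take j, ¬ P y := by
  -- `findIdx` counts from 0 and `entry` from 1: the entry found is k(j+1), and `k.take j` holds the
  -- entries before it.
  have hlt : k.findIdx (fun x => decide (P x)) < k.length :=
    List.findIdx_lt_length_of_exists ⟨x, hx, by simpa using hP⟩
  have hj := List.findIdx_getElem (w := hlt)
  have hbefore : ∀ y ∈ k.take (k.findIdx fun x => decide (P x)), ¬ P y := by
    intro y hy
    rw [List.mem_take_iff_getElem] at hy
    obtain ⟨i, hi, rfl⟩ := hy
    simpa using List.not_of_lt_findIdx (lt_of_lt_of_le hi (min_le_left _ _))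
  generalize k.findIdx (fun x => decide (P x)) = j at *
  rw [decide_eq_true_eq] at hj
  have hk0 : 0 < k.length := by omega
  have e1 : entry k 1 = k[0] := List.getD_eq_getElem _ _ hk0
  have hj1 : 1 ≤ j := by
    by_contra h
    obtain rfl : j = 0 := by omega
    exact h1 (e1 ▸ hj)
  have hlen := hk.length
  refine ⟨j, hj1, by omega, ?_, ?_, hbefore⟩
  · rw [show entry k (j + 1) = k[j] from List.getD_eq_getElem _ _ hlt]
    exact hj
  · rw [e1, List.mem_take_iff_getElem]
    exact ⟨0, by omega, rfl⟩

/-- Let k(j+1) be the first entry below k(1); one exists because 1 is below k(1). No earlier entry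
is smaller than k(1), so m_j = 1 and M_j = k(1). -/
theorem exists_tailPunctures_eq_take {L k : List ℕ} (hk : IsPermutation L.length k)
    (h2 : 2 ≤ entry k 1) (h3 : 3 ≤ L.length) :
    ∃ j, 1 ≤ j ∧ j ≤ L.length - 2 ∧ tailPunctures L k j = L.take (entry k 1) := by
  obtain ⟨j, hj1, hj2, hj, hmem, hb⟩ := exists_first_entry hk (· < entry k 1) (lt_irrefl _)
    (hk.mem.2 ⟨le_rfl, by omega⟩) (by omega : 1 < entry k 1)
  have he := hk.entry (i := 1) le_rfl (by omega)
  have hlo : lo k j = 1 := le_antisymm (lo_le.2 ⟨le_rfl, fun x hx hlt => absurd (by omega) (hb x hx)⟩)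
    (lo_le.1 le_rfl).1
  have hhi : hi L.length k j = entry k 1 := le_antisymm ((le_hi.1 le_rfl).2 _ hmem hj)
    (le_hi.2 ⟨he.2.le, fun x hx _ => not_lt.1 (hb x hx)⟩)
  refine ⟨j, hj1, hj2, ?_⟩
  rw [tailPunctures, hlo, hhi, interval, Nat.sub_self, List.drop_zero,
    Nat.sub_add_cancel he.1]

theorem exists_tailPunctures_eq_drop {L k : List ℕ} (hk : IsPermutation L.length k)
    (h2 : entry k 1 + 2 ≤ L.length) (h3 : 3 ≤ L.length) :
    ∃ j, 1 ≤ j ∧ j ≤ L.length - 2 ∧ tailPunctures L k j = L.drop (entry k 1) := by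
  have he := hk.entry (i := 1) le_rfl (by omega)
  obtain ⟨j, hj1, hj2, hj, hmem, hb⟩ := exists_first_entry hk (entry k 1 < ·) (lt_irrefl _)
    (x := entry k 1 + 1) (hk.mem.2 ⟨by omega, by omega⟩) (by omega)
  have hlo : lo k j = entry k 1 + 1 := le_antisymm
    (lo_le.2 ⟨by omega, fun x hx _ => Nat.succ_le_succ (not_lt.1 (hb x hx))⟩)
    ((lo_le.1 le_rfl).2 _ hmem hj)
  have hhi : hi L.length k j = L.length := le_antisymm (le_hi.1 le_rfl).1
    (le_hi.2 ⟨le_rfl, fun x hx hlt => absurd (hj.trans hlt) (hb x hx)⟩)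
  refine ⟨j, hj1, hj2, ?_⟩
  rw [tailPunctures, hlo, hhi, interval, Nat.add_sub_cancel]
  apply List.take_of_length_le
  rw [List.length_drop]
  omega

theorem entry_dehornoy {r i : ℕ} (hi : 1 ≤ i) (hr : i < r) : entry (dehornoy r) i = i := by
  have h : i - 1 < (dehornoy r).length := by
    rw [dehornoy, List.length_range']
    omega
  rw [entry, List.getD_eq_getElem _ _ h]
  simp only [dehornoy, List.getElem_range']
  omega

theorem tailPunctures_dehornoy {L : List ℕ} {j : ℕ} (hj : 1 ≤ j) (hjr : j ≤ L.length - 2) :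
    tailPunctures L (dehornoy L.length) j = L.drop j ∧
      tailPerm L (dehornoy L.length) j = dehornoy (L.length - j) := by
  have he : entry (dehornoy L.length) (j + 1) = j + 1 := entry_dehornoy (by omega) (by omega)
  have ht : ∀ x, x ∈ (dehornoy L.length).take j ↔ 1 ≤ x ∧ x ≤ j := by
    intro x
    rw [dehornoy, List.mem_take_iff_getElem]
    simp only [List.getElem_range', List.length_range']
    exact ⟨fun ⟨i, hi, hx⟩ => by omega, fun ⟨h1, h2⟩ => ⟨x - 1, by omega, by omega⟩⟩
  have hlo : lo (dehornoy L.length) j = j + 1 := by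
    apply le_antisymm
    · exact lo_le.2 ⟨by omega, fun x hx _ => Nat.succ_le_succ ((ht x).1 hx).2⟩
    · exact (lo_le.1 le_rfl).2 j ((ht j).2 ⟨hj, le_rfl⟩) (by omega)
  have hhi : hi L.length (dehornoy L.length) j = L.length := by
    apply le_antisymm (le_hi.1 le_rfl).1
    refine le_hi.2 ⟨le_rfl, fun x hx hlt => ?_⟩
    have := (ht x).1 hx
    omega
  constructor
  · rw [tailPunctures, hlo, hhi, interval, Nat.add_sub_cancel]
    apply List.take_of_length_le
    rw [List.length_drop]
    omega
  · rw [tailPerm, hlo, hhi, dehornoy, restrict_range' (by omega) (by omega) le_rfl, dehornoy]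
    congr 1

/-- The configurations on which codes and normal forms are defined. -/
structure IsConfiguration (n : ℕ) (L k : List ℕ) : Prop where
  circular : IsCircular n L
  two_le : 2 ≤ L.length
  perm : IsPermutation L.length k

/-- The ordering used for the words on `omitStar L i`. -/
def mainPerm (L k : List ℕ) (i : ℕ) : List ℕ :=
  if i = 0 then restrict k 1 (L.length - 1) else dehornoy (L.length - 1)

theorem IsConfiguration.omitStar {L k : List ℕ} (h : IsConfiguration n L k) (h3 : 3 ≤ L.length)
    (i : ℕ) : IsConfiguration n (omitStar L i) (mainPerm L k i) where
  circular := h.circular.omitStar i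
  two_le := by rw [length_omitStar]; omega
  perm := by
    rw [length_omitStar, mainPerm]
    split_ifs
    · exact h.perm.restrict le_rfl (by omega) (by omega)
    · exact List.Perm.refl _

theorem IsConfiguration.tail {L k : List ℕ} (h : IsConfiguration n L k) {j : ℕ} (hj : 1 ≤ j)
    (hjr : j ≤ L.length - 2) : IsConfiguration n (tailPunctures L k j) (tailPerm L k j) ∧
      (tailPunctures L k j).length < L.length := by
  obtain ⟨h1, h2, h3, h4⟩ := h.perm.bounds hj hjr
  have h5 := h.perm.entry (i := 1) le_rfl (by omega)
  have hlen : (tailPunctures L k j).length = _ := length_interval h1 h2.le h3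
  refine ⟨⟨h.circular.sublist (tailPunctures_sublist _ _ _), by omega, ?_⟩, by omega⟩
  rw [hlen, tailPerm, IsPermutation, Nat.add_sub_cancel]
  exact h.perm.restrict h1 h2.le h3

end

/-! ### Stages of a decomposition -/

section

variable {n : ℕ}

/-- The subwords `X_{r-2}, …, X_1, A_0, A_1, …` of a decomposition are numbered `0, 1, 2, …`; these
are the punctures on which the subword number `s` is written. -/
def stage (L k : List ℕ) (s : ℕ) : List ℕ :=
  if s < L.length - 2 then tailPunctures L k (L.length - 2 - s)
  else omitStar L (s - (L.length - 2))

/-- The ordering used for the subword number `s`. -/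
def stagePerm (L k : List ℕ) (s : ℕ) : List ℕ :=
  if s < L.length - 2 then tailPerm L k (L.length - 2 - s)
  else mainPerm L k (s - (L.length - 2))

theorem stage_add (L k : List ℕ) (i : ℕ) : stage L k (L.length - 2 + i) = omitStar L i := by
  rw [stage, if_neg (by omega), Nat.add_sub_cancel_left]

theorem stagePerm_add (L k : List ℕ) (i : ℕ) :
    stagePerm L k (L.length - 2 + i) = mainPerm L k i := by
  rw [stagePerm, if_neg (by omega), Nat.add_sub_cancel_left]

theorem stage_sub {L : List ℕ} (k : List ℕ) {j : ℕ} (h1 : 1 ≤ j) (hj : j ≤ L.length - 2) :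
    stage L k (L.length - 2 - j) = tailPunctures L k j := by
  rw [stage, if_pos (by omega), Nat.sub_sub_self hj]

theorem stagePerm_sub {L : List ℕ} (k : List ℕ) {j : ℕ} (h1 : 1 ≤ j) (hj : j ≤ L.length - 2) :
    stagePerm L k (L.length - 2 - j) = tailPerm L k j := by
  rw [stagePerm, if_pos (by omega), Nat.sub_sub_self hj]

theorem stage_subset (L k : List ℕ) (s : ℕ) : stage L k s ⊆ L := by
  rw [stage]
  split_ifs
  · exact (tailPunctures_sublist _ _ _).subset
  · exact omitStar_subset _ _

theorem IsConfiguration.stage {L k : List ℕ} (h : IsConfiguration n L k) (h3 : 3 ≤ L.length)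
    (s : ℕ) : IsConfiguration n (stage L k s) (stagePerm L k s) ∧
      (DualBraid.stage L k s).length < L.length := by
  rw [DualBraid.stage, stagePerm]
  split_ifs
  · exact h.tail (by omega) (by omega)
  · exact ⟨h.omitStar h3 _, by rw [length_omitStar]; omega⟩

theorem IsConfiguration.exists_eq_pair {L k : List ℕ} (h : IsConfiguration n L k)
    (h2 : L.length = 2) : ∃ p q, p ≠ q ∧ L = [p, q] ∧ k = [1] := by
  obtain ⟨p, q, rfl⟩ := List.length_eq_two.1 h2
  refine ⟨p, q, ?_, rfl, List.perm_singleton.1 h.perm⟩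
  simpa using h.circular.nodup

/-- Induction over configurations. -/
@[elab_as_elim]
theorem IsConfiguration.induction {P : List ℕ → List ℕ → Prop}
    (two : ∀ p q, p ≠ q → IsConfiguration n [p, q] [1] → P [p, q] [1])
    (step : ∀ L k, IsConfiguration n L k → 3 ≤ L.length →
      (∀ s, P (DualBraid.stage L k s) (stagePerm L k s)) → P L k)
    {L k : List ℕ} (h : IsConfiguration n L k) : P L k := by
  induction hN : L.length using Nat.strong_induction_on generalizing L k with
  | _ N ih =>
    subst hN
    rcases eq_or_lt_of_le h.two_le with h2 | h3
    · obtain ⟨p, q, hpq, rfl, rfl⟩ := h.exists_eq_pair h2.symm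
      exact two p q hpq h
    · exact step L k h h3 fun s => ih _ (h.stage h3 s).2 (h.stage h3 s).1 rfl

theorem IsConfiguration.exists_mem_stage {L k : List ℕ} (h : IsConfiguration n L k)
    (h3 : 3 ≤ L.length) {p q : ℕ} (hp : p ∈ L) (hq : q ∈ L) (m : ℕ) :
    ∃ s, m < s ∧ p ∈ DualBraid.stage L k s ∧ q ∈ DualBraid.stage L k s := by
  obtain ⟨i, hi, h1, h2⟩ := exists_mem_omitStar h.circular.nodup h3 hp hq m
  exact ⟨L.length - 2 + i, by omega, by rwa [stage_add], by rwa [stage_add]⟩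

/-! ### Words -/

/-- The concatenation `w_{S-1} ⋯ w_1 w_0`. -/
def concat {α : Type*} (w : ℕ → List α) (S : ℕ) : List α := ((List.range S).reverse.map w).flatten

@[simp] theorem concat_zero {α : Type*} (w : ℕ → List α) : concat w 0 = [] := rfl

theorem concat_succ {α : Type*} (w : ℕ → List α) (S : ℕ) : concat w (S + 1) = w S ++ concat w S := by
  rw [concat, List.range_succ, List.reverse_append, List.map_append, List.flatten_append]
  simp [concat]

theorem concat_congr {α : Type*} {w w' : ℕ → List α} {S : ℕ} (h : ∀ s < S, w s = w' s) :
    concat w S = concat w' S := by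
  induction S with
  | zero => rfl
  | succ S ih =>
    rw [concat_succ, concat_succ, h S (by omega), ih fun s hs => h s (by omega)]

theorem concat_add {α : Type*} (w : ℕ → List α) (S T : ℕ) :
    concat w (S + T) = concat (fun i => w (S + i)) T ++ concat w S := by
  induction T with
  | zero => simp
  | succ T ih => rw [← Nat.add_assoc, concat_succ, concat_succ, ih, List.append_assoc]

theorem concat_of_le {α : Type*} {w : ℕ → List α} {S T : ℕ}
    (h : ∀ s, S ≤ s → s < T → w s = []) (hST : S ≤ T) : concat w T = concat w S := by
  induction T, hST using Nat.le_induction with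
  | base => rfl
  | succ T hT ih =>
    rw [concat_succ, h T hT (Nat.lt_succ_self T), ih fun s h1 h2 => h s h1 (h2.trans (Nat.lt_succ_self T)),
      List.nil_append]

theorem concat_eq_of_eventually {α : Type*} {w : ℕ → List α} {S T : ℕ} (h : ∀ s, S ≤ s → w s = [])
    (h' : ∀ s, T ≤ s → w s = []) : concat w T = concat w S := by
  rcases le_total S T with hST | hST
  · exact concat_of_le (fun s hs _ => h s hs) hST
  · exact (concat_of_le (fun s hs _ => h' s hs) hST).symm

theorem flatten_range'_eq_concat {α : Type*} (X : ℕ → List α) (a : ℕ) :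
    ((List.range' 1 a).map X).flatten = concat (fun s => X (a - s)) a := by
  rw [concat]
  congr 1
  apply List.ext_getElem
  · simp
  · intro i h1 h2
    simp only [List.length_map, List.length_range'] at h1
    simp only [List.getElem_map, List.getElem_range', List.getElem_reverse, List.length_range,
      List.getElem_range]
    congr 1
    omega

theorem mem_concat {α : Type*} {w : ℕ → List α} {S : ℕ} {x : α} :
    x ∈ concat w S ↔ ∃ s < S, x ∈ w s := by
  simp [concat]

@[simp] theorem Word.eval_nil : Word.eval n [] = 1 := rfl

theorem Word.eval_cons (p : ℕ × ℕ) (W : Word) :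
    Word.eval n (p :: W) = band n p.1 p.2 * Word.eval n W := by
  rw [Word.eval, Word.eval, List.map_cons, List.prod_cons]

theorem Word.eval_append (W W' : Word) :
    Word.eval n (W ++ W') = Word.eval n W * Word.eval n W' := by
  rw [Word.eval, Word.eval, Word.eval, List.map_append, List.prod_append]

theorem Word.eval_concat_succ (w : ℕ → Word) (S : ℕ) :
    Word.eval n (concat w (S + 1)) = Word.eval n (w S) * Word.eval n (concat w S) := by
  rw [concat_succ, Word.eval_append]

/-- `W` is a word in the band generators `a_{i,j}` with `i < j` in `L`. -/
def IsWordOn (L : List ℕ) (W : Word) : Prop := ∀ p ∈ W, p.1 ∈ L ∧ p.2 ∈ L ∧ p.1 < p.2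

theorem IsWordOn.mono {I L : List ℕ} {W : Word} (h : IsWordOn I W) (hI : I ⊆ L) : IsWordOn L W :=
  fun p hp => ⟨hI (h p hp).1, hI (h p hp).2.1, (h p hp).2.2⟩

theorem IsWordOn.append {L : List ℕ} {W W' : Word} (h : IsWordOn L W) (h' : IsWordOn L W') :
    IsWordOn L (W ++ W') := fun p hp => (List.mem_append.1 hp).elim (h p) (h' p)

theorem isWordOn_concat {L : List ℕ} {w : ℕ → Word} {S : ℕ} (h : ∀ s < S, IsWordOn L (w s)) :
    IsWordOn L (concat w S) := fun p hp =>
  let ⟨s, hs, hps⟩ := mem_concat.1 hp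
  h s hs p hps

theorem isWordOn_powWord {p q : ℕ} (hpq : p ≠ q) (e : ℕ) : IsWordOn [p, q] (powWord p q e) := by
  intro x hx
  obtain rfl := List.eq_of_mem_replicate hx
  simp only [List.mem_cons, List.not_mem_nil, or_false]
  omega

theorem IsWordOn.eval_mem {L : List ℕ} {W : Word} (h : IsWordOn L W) :
    Word.eval n W ∈ parabolic n L := by
  apply Submonoid.list_prod_mem
  intro x hx
  obtain ⟨p, hp, rfl⟩ := List.mem_map.1 hx
  exact band_mem (h p hp).1 (h p hp).2.1 (h p hp).2.2

theorem IsWordOn.braidLength_eval {L : List ℕ} (hL : InRange n L) {W : Word} (h : IsWordOn L W) :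
    braidLength n (Word.eval n W) = W.length := by
  induction W with
  | nil => rw [Word.eval_nil, braidLength_one, List.length_nil, Nat.cast_zero]
  | cons p W ih =>
    obtain ⟨⟨h1, h2, h3⟩, h4⟩ := List.forall_mem_cons.1 h
    rw [Word.eval_cons, braidLength_mul, ih h4,
      braidLength_band (hL _ h1).1 h3 (hL _ h2).2, List.length_cons]
    push_cast
    ring

theorem IsWordOn.eq_nil {L : List ℕ} (hL : InRange n L) {W : Word} (h : IsWordOn L W)
    (h1 : Word.eval n W = 1) : W = [] := by
  have := h.braidLength_eval hL
  rw [h1, braidLength_one] at this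
  exact List.eq_nil_of_length_eq_zero (by omega)

theorem exists_isWordOn {L : List ℕ} {x : BraidGroup n} (hx : x ∈ parabolic n L) :
    ∃ W, IsWordOn L W ∧ Word.eval n W = x := by
  refine Submonoid.closure_induction ?_ ⟨[], fun p hp => absurd hp List.not_mem_nil, rfl⟩ ?_ hx
  · rintro _ ⟨i, j, hi, hj, hij, rfl⟩
    refine ⟨[(i, j)], ?_, by simp [Word.eval]⟩
    intro p hp
    obtain rfl := List.mem_singleton.1 hp
    exact ⟨hi, hj, hij⟩
  · rintro _ _ _ _ ⟨W, hW, rfl⟩ ⟨W', hW', rfl⟩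
    exact ⟨W ++ W', hW.append hW', Word.eval_append _ _⟩

/-! ### Codes -/

theorem Code.LtRight.ne {C C' : Code} (h : Code.LtRight C C') : C ≠ C' := by
  induction h with
  | int h => exact fun he => h.ne (Code.int.inj he)
  | tail l _ _ ih => exact fun he => ih (congrFun (Code.node.inj he).2 l)
  | main l _ _ ih => exact fun he => ih (congrFun (Code.node.inj he).1 l)

theorem Code.LtRight.trans {C C' C'' : Code} (h : Code.LtRight C C') (h' : Code.LtRight C' C'') :
    Code.LtRight C C'' := by
  induction h generalizing C'' with
  | int h =>
    cases h' with
    | int h' => exact .int (h.trans h')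
  | tail l heq hlt ih =>
    cases h' with
    | tail l' heq' hlt' =>
      rcases lt_trichotomy l l' with hl | rfl | hl
      · exact .tail l' (fun j hj => (heq j (hl.trans hj)).trans (heq' j hj)) (heq l' hl ▸ hlt')
      · exact .tail l (fun j hj => (heq j hj).trans (heq' j hj)) (ih hlt')
      · exact .tail l (fun j hj => (heq j hj).trans (heq' j (hl.trans hj))) (heq' l hl ▸ hlt)
    | main l' heq' hlt' => exact .tail l heq hlt
  | main l heq hlt ih =>
    cases h' with
    | tail l' heq' hlt' => exact .tail l' heq' hlt'
    | main l' heq' hlt' =>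
      rcases lt_trichotomy l l' with hl | rfl | hl
      · exact .main l (fun j hj => (heq j hj).trans (heq' j (hj.trans hl))) (heq' l hl ▸ hlt)
      · exact .main l (fun j hj => (heq j hj).trans (heq' j hj)) (ih hlt')
      · exact .main l' (fun j hj => (heq j (hj.trans hl)).trans (heq' j hj)) (heq l' hl ▸ hlt')

/-- The code with entries `c_0, c_1, …` from the right, the first `a` of which belong to the
tail. -/
def Code.ofSeq (a : ℕ) (c : ℕ → Code) : Code :=
  .node (fun i => c (a + i)) fun j => if 1 ≤ j ∧ j ≤ a then c (a - j) else .int 0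

theorem Code.ofSeq_injective (a : ℕ) : Function.Injective (Code.ofSeq a) := by
  intro c c' h
  obtain ⟨h1, h2⟩ := Code.node.inj h
  funext s
  rcases lt_or_ge s a with hs | hs
  · have := congrFun h2 (a - s)
    rwa [if_pos (by omega), if_pos (by omega), Nat.sub_sub_self hs.le] at this
  · have := congrFun h1 (s - a)
    rwa [Nat.add_sub_cancel' hs] at this

/-- Numbering the entries from the right merges the two lexicographic constructors into one rule;
which of them applies depends on whether the first difference lies in the tail. -/
theorem Code.ltRight_ofSeq {a s : ℕ} {c c' : ℕ → Code} (heq : ∀ u < s, c u = c' u)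
    (hlt : Code.LtRight (c s) (c' s)) : Code.LtRight (.ofSeq a c) (.ofSeq a c') := by
  rcases lt_or_ge s a with hs | hs
  · refine .tail (a - s) (fun j hj => ?_) ?_
    · split_ifs
      · exact heq _ (by omega)
      · rfl
    · rwa [if_pos (by omega), if_pos (by omega), Nat.sub_sub_self hs.le]
  · have hX : (fun j => if 1 ≤ j ∧ j ≤ a then c (a - j) else Code.int 0) =
        fun j => if 1 ≤ j ∧ j ≤ a then c' (a - j) else .int 0 := by
      funext j
      split_ifs
      · exact heq _ (by omega)
      · rfl
    rw [Code.ofSeq, Code.ofSeq, hX]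
    refine .main (s - a) (fun i hi => heq _ (by omega)) ?_
    rwa [Nat.add_sub_cancel' hs]

theorem hasCode_pair {p q : ℕ} {W : Word} {C : Code} :
    HasCode [p, q] [1] W C ↔ ∃ e, W = powWord p q e ∧ C = .int e := by
  constructor
  · intro h
    cases h with
    | two _ _ e => exact ⟨e, rfl, rfl⟩
    | step _ _ _ _ _ _ _ _ hL => simp at hL
  · rintro ⟨e, rfl, rfl⟩
    exact .two p q e

/-- The subwords of the tail and of the main part become one sequence indexed from the right, so the
later arguments treat them alike. `S` is any bound beyond which the subwords are empty, and it may
even fall inside the tail. -/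
theorem hasCode_iff {L k : List ℕ} (h3 : 3 ≤ L.length) {W : Word} {C : Code} :
    HasCode L k W C ↔ ∃ (S : ℕ) (w : ℕ → Word) (c : ℕ → Code), C = .ofSeq (L.length - 2) c ∧
      W = concat w S ∧ (∀ s, S ≤ s → w s = []) ∧
      ∀ s, HasCode (stage L k s) (stagePerm L k s) (w s) (c s) := by
  constructor
  · intro h
    cases h with
    | two => simp at h3
    | step _ _ _ m A X cA cX hL hW hm hA0 hA hX hX' =>
      refine ⟨L.length - 2 + (m + 1),
        fun s => if s < L.length - 2 then X (L.length - 2 - s) else A (s - (L.length - 2)),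
        fun s => if s < L.length - 2 then cX (L.length - 2 - s) else cA (s - (L.length - 2)),
        ?_, ?_, ?_, ?_⟩
      · rw [Code.ofSeq]
        congr 1
        · funext i
          rw [if_neg (by omega), Nat.add_sub_cancel_left]
        · funext j
          split_ifs with h1 h2
          · rw [Nat.sub_sub_self h1.2]
          · omega
          · exact hX' j h1
      · rw [hW, concat_add, flatten_range'_eq_concat]
        congr 1
        · refine concat_congr fun i _ => ?_
          rw [if_neg (by omega), Nat.add_sub_cancel_left]
        · refine concat_congr fun s hs => ?_
          rw [if_pos hs]
      · intro s hs
        dsimp only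
        rw [if_neg (by omega)]
        exact hm _ (by omega)
      · intro s
        dsimp only
        rw [stage, stagePerm]
        split_ifs with h
        · exact hX _ (by omega) (by omega)
        · rw [mainPerm]
          split_ifs with h0
          · rw [h0, omitStar_zero]
            exact hA0
          · exact hA _ (by omega)
  · rintro ⟨S, w, c, rfl, rfl, hS, hc⟩
    refine .step L k _ S (fun i => w (L.length - 2 + i)) (fun j => w (L.length - 2 - j)) _ _ h3
      ?_ ?_ ?_ ?_ ?_ ?_
    · rw [flatten_range'_eq_concat, concat_eq_of_eventually (T := S)
        (S := L.length - 2 + (S + 1)) (fun s hs => hS s (by omega)) hS, concat_add]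
      congr 1
      refine concat_congr fun s hs => ?_
      rw [Nat.sub_sub_self hs.le]
    · exact fun i hi => hS _ (by omega)
    · have := hc (L.length - 2 + 0)
      rwa [stage_add, stagePerm_add, mainPerm, if_pos rfl, omitStar_zero] at this
    · intro i hi
      have := hc (L.length - 2 + i)
      rwa [stage_add, stagePerm_add, mainPerm, if_neg (by omega)] at this
    · intro j h1 hj
      have := hc (L.length - 2 - j)
      rw [stage_sub k h1 hj, stagePerm_sub k h1 hj] at this
      rwa [if_pos ⟨h1, hj⟩]
    · exact fun j hj => if_neg hj

theorem IsConfiguration.hasCode_isWordOn {L k : List ℕ} (h : IsConfiguration n L k) :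
    ∀ ⦃W C⦄, HasCode L k W C → IsWordOn L W := by
  refine IsConfiguration.induction ?_ ?_ h
  · intro p q hpq _ W C hW
    obtain ⟨e, rfl, -⟩ := hasCode_pair.1 hW
    exact isWordOn_powWord hpq e
  · intro L k _ h3 ih W C hW
    obtain ⟨S, w, c, -, rfl, -, hc⟩ := (hasCode_iff h3).1 hW
    exact isWordOn_concat fun s _ => (ih s (hc s)).mono (stage_subset _ _ _)

/-- A word is determined by any of its codes. -/
theorem IsConfiguration.hasCode_unique {L k : List ℕ} (h : IsConfiguration n L k) :
    ∀ ⦃W W' C⦄, HasCode L k W C → HasCode L k W' C → W = W' := by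
  refine IsConfiguration.induction ?_ ?_ h
  · intro p q _ _ W W' C hW hW'
    obtain ⟨e, rfl, rfl⟩ := hasCode_pair.1 hW
    obtain ⟨e', rfl, he⟩ := hasCode_pair.1 hW'
    rw [Code.int.inj he]
  · intro L k _ h3 ih W W' C hW hW'
    obtain ⟨S, w, c, rfl, rfl, hS, hc⟩ := (hasCode_iff h3).1 hW
    obtain ⟨S', w', c', he, rfl, hS', hc'⟩ := (hasCode_iff h3).1 hW'
    obtain rfl := Code.ofSeq_injective _ he
    obtain rfl : w = w' := funext fun s => ih s (hc s) (hc' s)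
    exact concat_eq_of_eventually hS' hS

/-- Adding a letter on the left of a word increases its codes. -/
theorem IsConfiguration.exists_hasCode_cons {L k : List ℕ} (h : IsConfiguration n L k) :
    ∀ ⦃W C p q⦄, HasCode L k W C → p ∈ L → q ∈ L → p < q →
      ∃ C', HasCode L k ((p, q) :: W) C' ∧ Code.LtRight C C' := by
  refine IsConfiguration.induction ?_ ?_ h
  · intro a b hab _ W C p q hW hp hq hpq
    obtain ⟨e, rfl, rfl⟩ := hasCode_pair.1 hW
    refine ⟨.int (e + 1), hasCode_pair.2 ⟨e + 1, ?_, rfl⟩, .int (Nat.lt_succ_self e)⟩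
    simp only [List.mem_cons, List.not_mem_nil, or_false] at hp hq
    rw [powWord, powWord, List.replicate_succ]
    congr 2 <;> omega
  · intro L k hLk h3 ih W C p q hW hp hq hpq
    obtain ⟨S, w, c, rfl, rfl, hS, hc⟩ := (hasCode_iff h3).1 hW
    -- Some stage beyond all nonempty subwords contains both end points. Its subword is empty, so
    -- the letter can be placed there, leaving every entry to its right unchanged.
    obtain ⟨s, hs, hps, hqs⟩ := hLk.exists_mem_stage h3 hp hq S
    have hws := hc s
    rw [hS s hs.le] at hws
    obtain ⟨C', hC', hlt⟩ := ih s hws hps hqs hpq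
    refine ⟨_, (hasCode_iff h3).2 ⟨s + 1, Function.update w s [(p, q)], Function.update c s C',
      rfl, ?_, ?_, ?_⟩, Code.ltRight_ofSeq (s := s) ?_ ?_⟩
    · rw [concat_succ, Function.update_self, List.singleton_append]
      congr 1
      rw [← concat_of_le (fun u hu _ => hS u hu) hs.le]
      exact concat_congr fun u hu => (Function.update_of_ne hu.ne _ _).symm
    · intro u hu
      rw [Function.update_of_ne (by omega)]
      exact hS u (by omega)
    · intro u
      rcases eq_or_ne u s with rfl | hu
      · rw [Function.update_self, Function.update_self]
        exact hC'
      · rw [Function.update_of_ne hu, Function.update_of_ne hu]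
        exact hc u
    · exact fun u hu => (Function.update_of_ne hu.ne _ _).symm
    · rwa [Function.update_self]

/-- `C` is a code of the word `W` of `β`, and it is maximal among the codes of the words that
represent `β`. -/
def IsMaximalCode (n : ℕ) (L k : List ℕ) (β : BraidGroup n) (W : Word) (C : Code) : Prop :=
  Word.eval n W = β ∧ HasCode L k W C ∧
    ∀ W' C', Word.eval n W' = β → HasCode L k W' C' → C' = C ∨ Code.LtRight C' C

theorem IsConfiguration.exists_hasCode_append {L k : List ℕ} (h : IsConfiguration n L k)
    {W V : Word} {C : Code} (hW : HasCode L k W C) (hV : IsWordOn L V) :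
    ∃ C', HasCode L k (V ++ W) C' ∧ (C = C' ∨ Code.LtRight C C') := by
  induction V with
  | nil => exact ⟨C, hW, .inl rfl⟩
  | cons p V ih =>
    obtain ⟨⟨h1, h2, h3⟩, h4⟩ := List.forall_mem_cons.1 hV
    obtain ⟨C', hC', hle⟩ := ih h4
    obtain ⟨C'', hC'', hlt⟩ := h.exists_hasCode_cons hC' h1 h2 h3
    refine ⟨C'', hC'', .inr ?_⟩
    rcases hle with rfl | hle
    · exact hlt
    · exact hle.trans hlt

/-- The codes of a right divisor of `β` are at most the maximal code of `β`. -/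
theorem IsMaximalCode.le_of_mul_inv_mem {L k : List ℕ} (h : IsConfiguration n L k)
    {β : BraidGroup n} {W W' : Word} {C C' : Code} (hC : IsMaximalCode n L k β W C)
    (hW' : HasCode L k W' C') (hβ : β * (Word.eval n W')⁻¹ ∈ parabolic n L) :
    C' = C ∨ Code.LtRight C' C := by
  obtain ⟨V, hV, hVβ⟩ := exists_isWordOn hβ
  obtain ⟨C'', hC'', hle⟩ := h.exists_hasCode_append hW' hV
  have hmax := hC.2.2 _ _ (by rw [Word.eval_append, hVβ, inv_mul_cancel_right]) hC''
  rcases hle with rfl | hle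
  · exact hmax
  · rcases hmax with rfl | hmax
    · exact .inr hle
    · exact .inr (hle.trans hmax)

theorem IsMaximalCode.unique {L k : List ℕ} (h : IsConfiguration n L k) {β : BraidGroup n}
    {W W' : Word} {C C' : Code} (hC : IsMaximalCode n L k β W C)
    (hC' : IsMaximalCode n L k β W' C') : W = W' := by
  have key : C = C' := by
    rcases hC.2.2 _ _ hC'.1 hC'.2.1 with he | hlt
    · exact he.symm
    · rcases hC'.2.2 _ _ hC.1 hC.2.1 with he | hlt'
      · exact he
      · exact absurd rfl (hlt.trans hlt').ne
  subst key
  exact h.hasCode_unique hC.2.1 hC'.2.1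

end

/-! ### Maximal right divisors -/

section

variable {n : ℕ}

theorem IsCircular.parabolic_le {L : List ℕ} (h : IsCircular n L) :
    parabolic n L ≤ dualMonoid n := parabolic_le_dualMonoid h.1

/-- Having 1 as maximal right divisor is the form in which "no nontrivial right divisor in `N`" is
carried through the rest of the proof. -/
theorem IsMaxRightDivisor.mul_inv {G : Type*} [Group G] {M N : Submonoid G} {x y : G}
    (h : IsMaxRightDivisor M N x y) : IsMaxRightDivisor M N (x * y⁻¹) 1 := by
  refine ⟨N.one_mem, by simpa using h.2.1, fun γ hγ hM => ?_⟩
  have := h.2.2 (γ * y) (N.mul_mem hγ h.1) (by rwa [mul_inv_rev, ← mul_assoc])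
  simpa [mul_assoc] using this

theorem IsMaxRightDivisor.eq_one {M N : Submonoid (BraidGroup n)} (hN : N ≤ dualMonoid n)
    {x γ : BraidGroup n} (h : IsMaxRightDivisor M N x 1) (hγ : γ ∈ N) (hM : x * γ⁻¹ ∈ M) :
    γ = 1 :=
  eq_one_of_inv_mem (hN hγ) (hN (by simpa using h.2.2 γ hγ hM))

theorem isMaxRightDivisor_one {M N : Submonoid (BraidGroup n)} {x : BraidGroup n} (hx : x ∈ M)
    (h : ∀ γ ∈ N, x * γ⁻¹ ∈ M → γ = 1) : IsMaxRightDivisor M N x 1 := by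
  refine ⟨N.one_mem, by simpa using hx, fun γ hγ hM => ?_⟩
  rw [h γ hγ hM]
  simp [N.one_mem]

/-- If `x` has no nontrivial right divisor in `N`, then `y` is the maximal right divisor of `x y`
in `N`. -/
theorem IsMaxRightDivisor.mul {M N : Submonoid (BraidGroup n)} (hN : N ≤ dualMonoid n)
    {x y y' : BraidGroup n} (h : IsMaxRightDivisor M N x 1) (hy : y ∈ N)
    (h' : IsMaxRightDivisor M N (x * y) y') : IsMaxRightDivisor M N (x * y) y := by
  have hx : x ∈ M := by simpa using h.2.1
  have h1 : y' * y⁻¹ = 1 := by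
    refine h.eq_one hN (h'.2.2 y hy (by simpa using hx)) ?_
    rw [mul_inv_rev, inv_inv, ← mul_assoc]
    exact h'.2.1
  rwa [mul_inv_eq_one.1 h1] at h'

/-- If `y` is the maximal right divisor of `x σ` in `N` and divides `σ`, then it is the maximal
right divisor of `σ` in `N`. -/
theorem IsMaxRightDivisor.of_mul {G : Type*} [Group G] {M N : Submonoid G} {x σ y : G}
    (h : IsMaxRightDivisor M N (x * σ) y) (hx : x ∈ M) (hσ : σ * y⁻¹ ∈ M) :
    IsMaxRightDivisor M N σ y :=
  ⟨h.1, hσ, fun γ hγ hM => h.2.2 γ hγ (by rw [mul_assoc]; exact M.mul_mem hx hM)⟩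

theorem IsMaxRightDivisor.eq_self {M N : Submonoid (BraidGroup n)} (hM : M ≤ dualMonoid n)
    (hN : N ≤ dualMonoid n) {x y : BraidGroup n} (h : IsMaxRightDivisor M N x y) (hx : x ∈ N) :
    y = x := by
  refine mul_inv_eq_one.1 (eq_one_of_inv_mem (hN (h.2.2 x hx ?_)) ?_)
  · rw [mul_inv_cancel]
    exact M.one_mem
  · rw [mul_inv_rev, inv_inv]
    exact hM h.2.1

theorem parabolic_eq_bot {I : List ℕ} (h : I.length ≤ 1) : parabolic n I = ⊥ := by
  rw [parabolic, eq_bot_iff, Submonoid.closure_le]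
  rintro _ ⟨i, j, hi, hj, hij, rfl⟩
  rcases I with _ | ⟨a, _ | ⟨b, I⟩⟩
  · exact absurd hi List.not_mem_nil
  · rw [List.mem_singleton] at hi hj
    omega
  · simp at h

theorem exists_mul_of_mem_sup {G : Type*} [Group G] {N N' : Submonoid G}
    (hc : ∀ x ∈ N, ∀ y ∈ N', x * y = y * x) {z : G} (hz : z ∈ N ⊔ N') :
    ∃ x ∈ N, ∃ y ∈ N', z = x * y := by
  rw [Submonoid.sup_eq_closure] at hz
  induction hz using Submonoid.closure_induction with
  | mem z hz =>
    rcases hz with hz | hz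
    · exact ⟨z, hz, 1, N'.one_mem, (mul_one z).symm⟩
    · exact ⟨1, N.one_mem, z, hz, (one_mul z).symm⟩
  | one => exact ⟨1, N.one_mem, 1, N'.one_mem, (mul_one 1).symm⟩
  | mul _ _ _ _ h h' =>
    obtain ⟨x, hx, y, hy, rfl⟩ := h
    obtain ⟨x', hx', y', hy', rfl⟩ := h'
    refine ⟨x * x', N.mul_mem hx hx', y * y', N'.mul_mem hy hy', ?_⟩
    rw [mul_assoc, ← mul_assoc y, ← hc x' hx' y hy, mul_assoc, mul_assoc]

/-- If `x τ` has no nontrivial right divisor in `N`, where `τ ∈ N ⊔ N'` and `N`, `N'` commute, then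
neither has `x`. -/
theorem IsMaxRightDivisor.of_mul_sup {M N N' : Submonoid (BraidGroup n)} (hN : N ≤ dualMonoid n)
    (hN' : N' ≤ M) (hc : ∀ x ∈ N, ∀ y ∈ N', x * y = y * x) {x τ : BraidGroup n}
    (h : IsMaxRightDivisor M N (x * τ) 1) (hτ : τ ∈ N ⊔ N') (hx : x ∈ M) :
    IsMaxRightDivisor M N x 1 := by
  refine isMaxRightDivisor_one hx fun γ hγ hM => ?_
  obtain ⟨u, hu, v, hv, rfl⟩ := exists_mul_of_mem_sup hc hτ
  -- Since v commutes with γ u, the quotient of x u v by γ u is x γ⁻¹ v, which lies in `M`.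
  have key : γ * u = 1 := by
    refine h.eq_one hN (N.mul_mem hγ hu) ?_
    have : x * (u * v) * (γ * u)⁻¹ = x * γ⁻¹ * v := by
      rw [mul_inv_eq_iff_eq_mul, mul_assoc _ v, ← hc _ (N.mul_mem hγ hu) v hv]
      group
    rw [this]
    exact M.mul_mem hM (hN' hv)
  refine eq_one_of_inv_mem (hN hγ) ?_
  rw [inv_eq_of_mul_eq_one_right key]
  exact hN hu

/-- A right divisor splits as u v with u in `N` and v in `N'`. Then v alone is a right divisor, so
it is 1, and u is next. -/
theorem IsMaxRightDivisor.sup {M N N' : Submonoid (BraidGroup n)} (hN : N ≤ dualMonoid n)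
    (hN' : N' ≤ dualMonoid n) (hNM : N ≤ M) (hc : ∀ x ∈ N, ∀ y ∈ N', x * y = y * x)
    {x : BraidGroup n} (h : IsMaxRightDivisor M N x 1) (h' : IsMaxRightDivisor M N' x 1) :
    IsMaxRightDivisor M (N ⊔ N') x 1 := by
  refine isMaxRightDivisor_one (by simpa using h.2.1) fun γ hγ hM => ?_
  obtain ⟨u, hu, v, hv, rfl⟩ := exists_mul_of_mem_sup hc hγ
  obtain rfl : v = 1 := by
    refine h'.eq_one hN' hv ?_
    have : x * v⁻¹ = x * (u * v)⁻¹ * u := by group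
    rw [this]
    exact M.mul_mem hM (hNM hu)
  rw [mul_one] at hM ⊢
  exact h.eq_one hN hu hM

/-! ### Greedy decompositions -/

/-- `g 0` is the maximal right divisor of `β = rest 0` in `B_{J_0}^{+*}`, and so on with the
quotients `rest 1`, `rest 2`, … -/
structure IsGreedy (n : ℕ) (L : List ℕ) (J : ℕ → List ℕ) (β : BraidGroup n)
    (g rest : ℕ → BraidGroup n) : Prop where
  zero : rest 0 = β
  succ : ∀ s, rest (s + 1) = rest s * (g s)⁻¹
  max : ∀ s, IsMaxRightDivisor (parabolic n L) (parabolic n (J s)) (rest s) (g s)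

theorem exists_isGreedy {L : List ℕ} (hL : InRange n L) {J : ℕ → List ℕ} (hJ : ∀ s, J s ⊆ L)
    {β : BraidGroup n} (hβ : β ∈ parabolic n L) : ∃ g rest, IsGreedy n L J β g rest := by
  have H : ∀ s (x : parabolic n L), ∃ y : BraidGroup n,
      IsMaxRightDivisor (parabolic n L) (parabolic n (J s)) x y :=
    fun s x => exists_isMaxRightDivisor_parabolic hL (hJ s) x.2
  choose f hf using H
  obtain ⟨rest, h0, h1⟩ : ∃ rest : ℕ → parabolic n L, rest 0 = ⟨β, hβ⟩ ∧
      ∀ s, rest (s + 1) = ⟨rest s * (f s (rest s))⁻¹, (hf s (rest s)).2.1⟩ :=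
    ⟨Nat.rec ⟨β, hβ⟩ fun s x => ⟨x * (f s x)⁻¹, (hf s x).2.1⟩, rfl, fun _ => rfl⟩
  exact ⟨fun s => f s (rest s), fun s => (rest s).1, congrArg Subtype.val h0,
    fun s => congrArg Subtype.val (h1 s), fun s => hf s (rest s)⟩

theorem IsGreedy.rest_mem {L : List ℕ} {J : ℕ → List ℕ} {β : BraidGroup n}
    {g rest : ℕ → BraidGroup n} (h : IsGreedy n L J β g rest) (hβ : β ∈ parabolic n L) (s : ℕ) :
    rest s ∈ parabolic n L := by
  cases s with
  | zero => rwa [h.zero]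
  | succ s =>
    rw [h.succ]
    exact (h.max s).2.1

theorem IsGreedy.rest_eq {L : List ℕ} {J : ℕ → List ℕ} {β : BraidGroup n}
    {g rest : ℕ → BraidGroup n} (h : IsGreedy n L J β g rest) (s : ℕ) :
    rest s = rest (s + 1) * g s := by
  rw [h.succ, inv_mul_cancel_right]

theorem IsGreedy.rest_mul_eval {L : List ℕ} {J : ℕ → List ℕ} {β : BraidGroup n}
    {g rest : ℕ → BraidGroup n} (h : IsGreedy n L J β g rest) {w : ℕ → Word}
    (hw : ∀ s, Word.eval n (w s) = g s) (s : ℕ) : rest s * Word.eval n (concat w s) = β := by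
  induction s with
  | zero => rw [concat_zero, Word.eval_nil, mul_one, h.zero]
  | succ s ih => rw [Word.eval_concat_succ, hw, ← mul_assoc, ← h.rest_eq, ih]

/-- The lengths of the quotients are nonnegative and never increase, so from a minimum on all
factors are trivial. A nontrivial quotient would still end in a chord, and some later stage contains
that chord. -/
theorem IsGreedy.eventually_one {L : List ℕ} (hL : InRange n L) {J : ℕ → List ℕ}
    (hJ : ∀ p ∈ L, ∀ q ∈ L, ∀ m, ∃ s, m < s ∧ p ∈ J s ∧ q ∈ J s) (hJL : ∀ s, J s ⊆ L)
    {β : BraidGroup n} {g rest : ℕ → BraidGroup n} (h : IsGreedy n L J β g rest)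
    (hβ : β ∈ parabolic n L) : ∃ S, ∀ s, S ≤ s → rest s = 1 ∧ g s = 1 := by
  have hle := parabolic_le_dualMonoid hL
  have hg : ∀ s, g s ∈ dualMonoid n := fun s => hle (parabolic_mono (hJL s) (h.max s).1)
  have hr : ∀ s, rest s ∈ dualMonoid n := fun s => hle (h.rest_mem hβ s)
  have hlen : ∀ s, braidLength n (rest s) = braidLength n (rest (s + 1)) + braidLength n (g s) :=
    fun s => by rw [← braidLength_mul, ← h.rest_eq]
  obtain ⟨S, hS⟩ : ∃ S, ∀ s, braidLength n (rest S) ≤ braidLength n (rest s) := by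
    refine ⟨Function.argmin fun s => (braidLength n (rest s)).toNat, fun s => ?_⟩
    have := Function.argmin_le (fun s => (braidLength n (rest s)).toNat) s
    have h1 := braidLength_nonneg (hr s)
    have h2 := braidLength_nonneg (hr (Function.argmin fun s => (braidLength n (rest s)).toNat))
    omega
  have key : ∀ s, S ≤ s → rest s = rest S := by
    intro s hs
    induction s, hs using Nat.le_induction with
    | base => rfl
    | succ s _ ih =>
      have h1 := hlen s
      have h2 := hS (s + 1)
      rw [ih] at h1
      rw [h.succ, eq_one_of_braidLength (hg s) (by omega), inv_one, mul_one, ih]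
  have hg1 : ∀ s, S ≤ s → g s = 1 := by
    intro s hs
    have := h.rest_eq s
    rwa [key s hs, key (s + 1) (by omega), left_eq_mul] at this
  refine ⟨S, fun s hs => ⟨?_, hg1 s hs⟩⟩
  rw [key s hs]
  rcases eq_one_or_exists_of_mem_parabolic (h.rest_mem hβ S) with h1 | ⟨y, hy, i, hi, j, hj, hij, he⟩
  · exact h1
  · obtain ⟨u, hu, hiu, hju⟩ := hJ i hi j hj S
    have hmax := h.max u
    rw [hg1 u hu.le, key u hu.le] at hmax
    have h1 := hmax.eq_one (parabolic_le_dualMonoid (hL.subset (hJL u))) (band_mem hiu hju hij)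
      (by rwa [he, mul_inv_cancel_right])
    have h2 := braidLength_band (hL i hi).1 hij (hL j hj).2
    rw [h1, braidLength_one] at h2
    exact absurd h2 (by norm_num)

/-- The greedy decomposition along the stages gives the maximal code. -/
theorem IsGreedy.isMaximalCode {L k : List ℕ} (hLk : IsConfiguration n L k) (h3 : 3 ≤ L.length)
    {β : BraidGroup n} {g rest : ℕ → BraidGroup n} (h : IsGreedy n L (stage L k) β g rest)
    {w : ℕ → Word} {c : ℕ → Code}
    (hw : ∀ s, IsMaximalCode n (stage L k s) (stagePerm L k s) (g s) (w s) (c s)) {S : ℕ}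
    (hS : ∀ s, S ≤ s → w s = []) (hrest : rest S = 1) :
    IsMaximalCode n L k β (concat w S) (.ofSeq (L.length - 2) c) := by
  have hstage := fun s => (hLk.stage h3 s).1
  have heval := h.rest_mul_eval fun s => (hw s).1
  refine ⟨?_, (hasCode_iff h3).2 ⟨S, w, c, rfl, rfl, hS, fun s => (hw s).2.1⟩, ?_⟩
  · have := heval S
    rwa [hrest, one_mul] at this
  · intro W' C' hW' hC'
    obtain ⟨S', w', c', rfl, rfl, hS', hc'⟩ := (hasCode_iff h3).1 hC'
    by_cases hall : ∀ s, c' s = c s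
    · exact .inl (congrArg _ (funext hall))
    · push Not at hall
      classical
      -- At the first difference from the right, the subwords further right coincide because codes
      -- determine words. Hence `w' s` right divides `rest s`, so it divides `g s`, and its code is
      -- at most `c s`.
      obtain ⟨s, hs, hmin⟩ : ∃ s, c' s ≠ c s ∧ ∀ u < s, c' u = c u :=
        ⟨Nat.find hall, Nat.find_spec hall, fun u hu => not_not.1 (Nat.find_min hall hu)⟩
      have hww : concat w' s = concat w s := concat_congr fun u hu =>
        (hstage u).hasCode_unique (hc' u) (hmin u hu ▸ (hw u).2.1)
      have hdiv : rest s * (Word.eval n (w' s))⁻¹ ∈ parabolic n L := by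
        have h1 : concat w' S' = concat (fun i => w' (s + 1 + i)) S' ++ (w' s ++ concat w' s) := by
          rw [← concat_succ, ← concat_add]
          exact concat_eq_of_eventually (fun u hu => hS' u (by omega)) hS'
        rw [h1, Word.eval_append, Word.eval_append, hww, ← heval s, ← mul_assoc,
          mul_left_inj] at hW'
        rw [← hW', mul_inv_cancel_right]
        exact (isWordOn_concat fun i _ =>
          ((hstage _).hasCode_isWordOn (hc' _)).mono (stage_subset _ _ _)).eval_mem
      have hle := (hw s).le_of_mul_inv_mem (hstage s) (hc' s)
        ((h.max s).2.2 _ ((hstage s).hasCode_isWordOn (hc' s)).eval_mem hdiv)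
      exact .inr (Code.ltRight_ofSeq hmin (hle.resolve_left hs))

end

/-! ### Rotating normal forms -/

section

variable {n : ℕ}

/-- `β b_s⁻¹ b_{s+1}⁻¹ ⋯ b_{i-1}⁻¹`. -/
def residual (β : BraidGroup n) (b : ℕ → BraidGroup n) (s i : ℕ) : BraidGroup n :=
  β * ((List.range' s (i - s)).map fun l => (b l)⁻¹).prod

theorem residual_self (β : BraidGroup n) (b : ℕ → BraidGroup n) (s : ℕ) : residual β b s s = β := by
  simp [residual]

theorem residual_succ (β : BraidGroup n) (b : ℕ → BraidGroup n) {s i : ℕ} (h : s ≤ i) :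
    residual β b s (i + 1) = residual β b s i * (b i)⁻¹ := by
  rw [residual, residual, Nat.succ_sub h, List.range'_concat, List.map_append, List.prod_append,
    ← mul_assoc, one_mul, Nat.add_sub_cancel' h]
  simp

theorem residual_eq_one_iff {β : BraidGroup n} {b : ℕ → BraidGroup n} {s i : ℕ} :
    residual β b s i = 1 ↔ β = ((List.range' s (i - s)).reverse.map b).prod := by
  rw [residual, mul_eq_one_iff_eq_inv, List.prod_inv_reverse, List.map_map, List.map_reverse]
  simp [Function.comp_def]

theorem isRotatingDecomposition_iff {L : List ℕ} {s m : ℕ} {β : BraidGroup n}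
    {b : ℕ → BraidGroup n} : IsRotatingDecomposition n L s m β b ↔
      (∀ i, s ≤ i → i ≤ m → IsMaxRightDivisor (parabolic n L) (parabolic n (omitStar L i))
        (residual β b s i) (b i)) ∧ residual β b s (m + 1) = 1 := by
  rw [residual_eq_one_iff]
  exact Iff.rfl

theorem flatten_range'_reverse {α : Type*} (V : ℕ → List α) (s m : ℕ) :
    ((List.range' s m).reverse.map V).flatten = concat (fun i => V (s + i)) m := by
  rw [concat, List.range'_eq_map_range, ← List.map_reverse, List.map_map]
  rfl

theorem isRotatingNF_pair {p q : ℕ} {β : BraidGroup n} {W : Word} :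
    IsRotatingNF n [p, q] β W ↔ ∃ e, β = Word.eval n (powWord p q e) ∧ W = powWord p q e := by
  constructor
  · intro h
    cases h with
    | two _ _ e => exact ⟨e, rfl, rfl⟩
    | step _ _ _ _ _ _ _ _ hL => simp at hL
  · rintro ⟨e, rfl, rfl⟩
    exact .two p q e

theorem isRotatingNF_iff {L : List ℕ} (h3 : 3 ≤ L.length) {β : BraidGroup n} {W : Word} :
    IsRotatingNF n L β W ↔ ∃ (t : BraidGroup n) (m : ℕ) (b : ℕ → BraidGroup n) (U : Word)
      (V : ℕ → Word), IsMaxRightDivisor (parabolic n L) (parabolic n L.tail) β t ∧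
        IsRotatingDecomposition n L 0 m (β * t⁻¹) b ∧ IsRotatingNF n L.tail t U ∧
        (∀ i, i ≤ m → IsRotatingNF n (omitStar L i) (b i) (V i)) ∧ W = concat V (m + 1) ++ U := by
  constructor
  · intro h
    cases h with
    | two => simp at h3
    | step _ _ t m b _ U V hL ht hb hU hV hW => exact ⟨t, m, b, U, V, ht, hb, hU, hV, hW⟩
  · rintro ⟨t, m, b, U, V, ht, hb, hU, hV, hW⟩
    exact .step L β t m b W U V h3 ht hb hU hV hW

theorem powWord_inj_of_eval {p q e e' : ℕ} (hL : InRange n [p, q]) (hpq : p ≠ q)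
    (h : Word.eval n (powWord p q e) = Word.eval n (powWord p q e')) : e = e' := by
  have h1 := (isWordOn_powWord hpq e).braidLength_eval hL
  have h2 := (isWordOn_powWord hpq e').braidLength_eval hL
  rw [h, h2, powWord, powWord, List.length_replicate, List.length_replicate] at h1
  omega

theorem IsCircular.tail {L : List ℕ} (h : IsCircular n L) : IsCircular n L.tail :=
  h.sublist (List.tail_sublist L)

theorem IsRotatingNF.isWordOn {L : List ℕ} (hL : IsCircular n L) {β : BraidGroup n} {W : Word}
    (h : IsRotatingNF n L β W) : IsWordOn L W := by
  induction h with
  | two p q e => exact isWordOn_powWord (by simpa using hL.nodup) e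
  | step L β t m b W U V h3 ht hb hU hV hW ihU ihV =>
    subst hW
    exact (isWordOn_concat fun i hi => (ihV i (by omega) (hL.omitStar i)).mono
      (omitStar_subset _ _)).append ((ihU hL.tail).mono (List.tail_sublist L).subset)

theorem IsRotatingNF.eval_eq {L : List ℕ} {β : BraidGroup n} {W : Word}
    (h : IsRotatingNF n L β W) : Word.eval n W = β := by
  induction h with
  | two p q e => rfl
  | step L β t m b W U V h3 ht hb hU hV hW ihU ihV =>
    subst hW
    have key : ∀ i, i ≤ m + 1 → residual (β * t⁻¹) b 0 i * Word.eval n (concat V i) = β * t⁻¹ := by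
      intro i hi
      induction i with
      | zero => rw [concat_zero, Word.eval_nil, mul_one, residual_self]
      | succ i ih =>
        rw [Word.eval_concat_succ, ihV i (by omega), residual_succ _ _ (Nat.zero_le i), ← mul_assoc,
          inv_mul_cancel_right, ih (by omega)]
    have := key (m + 1) le_rfl
    rw [(isRotatingDecomposition_iff.1 hb).2, one_mul] at this
    change Word.eval n (concat V (m + 1) ++ U) = β
    rw [Word.eval_append, this, ihU, inv_mul_cancel_right]

theorem IsRotatingNF.eq_nil {L : List ℕ} (hL : IsCircular n L) {W : Word}
    (h : IsRotatingNF n L 1 W) : W = [] :=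
  (h.isWordOn hL).eq_nil hL.1 h.eval_eq

theorem IsMaxRightDivisor.eq_one_of_one {M N : Submonoid (BraidGroup n)} (hM : M ≤ dualMonoid n)
    (hN : N ≤ dualMonoid n) {y : BraidGroup n} (h : IsMaxRightDivisor M N 1 y) : y = 1 :=
  h.eq_self hM hN N.one_mem

/-- The number of factors is not prescribed, but the quotients of two decompositions agree, so the
longer one only adds trivial factors, whose words are empty. Uniqueness of the shorter normal forms
is a hypothesis so that the lemma can be used within the induction for rotating normal forms as well
as after it. -/
theorem IsRotatingDecomposition.concat_eq {L : List ℕ} (hL : IsCircular n L) {s m m' : ℕ}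
    {β : BraidGroup n} {b b' : ℕ → BraidGroup n} {V V' : ℕ → Word} (hs : s ≤ m + 1)
    (hs' : s ≤ m' + 1)
    (hb : IsRotatingDecomposition n L s m β b) (hb' : IsRotatingDecomposition n L s m' β b')
    (hV : ∀ i, s ≤ i → i ≤ m → IsRotatingNF n (omitStar L i) (b i) (V i))
    (hV' : ∀ i, s ≤ i → i ≤ m' → IsRotatingNF n (omitStar L i) (b' i) (V' i))
    (huniq : ∀ i, s ≤ i → i ≤ m → i ≤ m' → ∀ x W W', IsRotatingNF n (omitStar L i) x W →
      IsRotatingNF n (omitStar L i) x W' → W = W') :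
    concat (fun i => V (s + i)) (m + 1 - s) = concat (fun i => V' (s + i)) (m' + 1 - s) := by
  wlog hmm : m ≤ m' generalizing m m' b b' V V'
  · exact (this hs' hs hb' hb hV' hV (fun i h1 h2 h3 => huniq i h1 h3 h2)
      (le_of_not_ge hmm)).symm
  rw [isRotatingDecomposition_iff] at hb hb'
  have hN : ∀ i, parabolic n (omitStar L i) ≤ dualMonoid n := fun i => (hL.omitStar i).parabolic_le
  have hres : ∀ i, s ≤ i → i ≤ m + 1 → residual β b s i = residual β b' s i := by
    intro i hi
    induction i, hi using Nat.le_induction with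
    | base => intro; rw [residual_self, residual_self]
    | succ i hi ih =>
      intro him
      have h1 := hb.1 i hi (by omega)
      rw [ih (by omega)] at h1
      rw [residual_succ _ _ hi, residual_succ _ _ hi, ih (by omega),
        h1.unique (hN i) (hb'.1 i hi (by omega))]
  have hres' : ∀ i, m + 1 ≤ i → i ≤ m' + 1 → residual β b' s i = 1 := by
    intro i hi
    induction i, hi using Nat.le_induction with
    | base => intro; rw [← hres _ hs le_rfl, hb.2]
    | succ i hi ih =>
      intro him
      have h1 := hb'.1 i (by omega) (by omega)
      rw [ih (by omega)] at h1
      rw [residual_succ _ _ (by omega), ih (by omega),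
        h1.eq_one_of_one hL.parabolic_le (hN i), inv_one, mul_one]
  rw [concat_of_le (S := m + 1 - s) (T := m' + 1 - s) ?_ (by omega)]
  · refine concat_congr fun i hi => ?_
    have h1 := hb.1 (s + i) (by omega) (by omega)
    rw [hres _ (by omega) (by omega)] at h1
    have h2 := hV' (s + i) (by omega) (by omega)
    rw [← h1.unique (hN _) (hb'.1 (s + i) (by omega) (by omega))] at h2
    exact huniq _ (by omega) (by omega) (by omega) _ _ _ (hV (s + i) (by omega) (by omega)) h2
  · intro i hi hi'
    have h1 := hb'.1 (s + i) (by omega) (by omega)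
    rw [hres' _ (by omega) (by omega)] at h1
    have h2 := hV' (s + i) (by omega) (by omega)
    rw [h1.eq_one_of_one hL.parabolic_le (hN _)] at h2
    exact h2.eq_nil (hL.omitStar _)

theorem IsRotatingNF.unique {L : List ℕ} (hL : IsCircular n L) {β : BraidGroup n} {W W' : Word}
    (h : IsRotatingNF n L β W) (h' : IsRotatingNF n L β W') : W = W' := by
  induction hN : L.length using Nat.strong_induction_on generalizing L β W W' with
  | _ N ih =>
    subst hN
    cases h with
    | two p q e =>
      obtain ⟨e', he, rfl⟩ := isRotatingNF_pair.1 h'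
      rw [powWord_inj_of_eval hL.1 (by simpa using hL.nodup) he]
    | step _ _ t m b _ U V h3 ht hb hU hV hW =>
      obtain ⟨t', m', b', U', V', ht', hb', hU', hV', rfl⟩ := (isRotatingNF_iff h3).1 h'
      obtain rfl := ht.unique hL.tail.parabolic_le ht'
      rw [hW, ih _ (by rw [List.length_tail]; omega) hL.tail hU hU' rfl]
      congr 1
      have key := hb.concat_eq hL (V := V) (V' := V') (Nat.zero_le _) (Nat.zero_le _) hb'
        (fun i _ => hV i) (fun i _ => hV' i) fun i _ _ _ x W₁ W₂ h1 h2 =>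
          ih _ (by rw [length_omitStar]; omega) (hL.omitStar i) h1 h2 rfl
      simp only [zero_add] at key
      exact key

end

/-! ### Tail twisted rotating normal forms -/

section

variable {n : ℕ}

theorem isTailTwistedNF_pair {p q : ℕ} {β : BraidGroup n} {W : Word} :
    IsTailTwistedNF n [p, q] [1] β W ↔ ∃ e, β = Word.eval n (powWord p q e) ∧ W = powWord p q e := by
  constructor
  · intro h
    cases h with
    | two _ _ e => exact ⟨e, rfl, rfl⟩
    | step _ _ _ _ _ _ _ _ _ _ hL => simp at hL
  · rintro ⟨e, rfl, rfl⟩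
    exact .two p q e

/-- The quotient of the tail from which `t j` is split off. -/
def tailResidual (a : ℕ) (tail : BraidGroup n) (t : ℕ → BraidGroup n) (j : ℕ) : BraidGroup n :=
  tail * ((List.range' (j + 1) (a - j)).reverse.map fun l => (t l)⁻¹).prod

theorem tailResidual_self (a : ℕ) (tail : BraidGroup n) (t : ℕ → BraidGroup n) :
    tailResidual a tail t a = tail := by
  simp [tailResidual]

theorem tailResidual_pred {a j : ℕ} (tail : BraidGroup n) (t : ℕ → BraidGroup n) (hj : j < a) :
    tailResidual a tail t j = tailResidual a tail t (j + 1) * (t (j + 1))⁻¹ := by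
  have h : a - j = a - (j + 1) + 1 := by omega
  rw [tailResidual, tailResidual, h, List.range'_succ, List.reverse_cons, List.map_append,
    List.prod_append, ← mul_assoc]
  simp

theorem tailResidual_congr {a j : ℕ} {tail : BraidGroup n} {t t' : ℕ → BraidGroup n}
    (h : ∀ l, j < l → l ≤ a → t l = t' l) : tailResidual a tail t j = tailResidual a tail t' j := by
  rw [tailResidual, tailResidual]
  congr 2
  refine List.map_congr_left fun l hl => ?_
  rw [List.mem_reverse, List.mem_range'_1] at hl
  rw [h l (by omega) (by omega)]

theorem isTailTwistedNF_iff {L k : List ℕ} (h3 : 3 ≤ L.length) {β : BraidGroup n} {W : Word} :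
    IsTailTwistedNF n L k β W ↔ ∃ (tail : BraidGroup n) (t : ℕ → BraidGroup n) (m : ℕ)
      (b : ℕ → BraidGroup n) (V U : ℕ → Word),
      IsMaxRightDivisor (parabolic n L)
        (parabolic n (L.take (entry k 1)) ⊔ parabolic n (L.drop (entry k 1))) β tail ∧
      IsMaxRightDivisor (parabolic n L) (parabolic n L.dropLast) (β * tail⁻¹) (t 0) ∧
      (∀ j, 1 ≤ j → j ≤ L.length - 2 →
        IsMaxRightDivisor (parabolic n L) (parabolic n (tailPunctures L k j))
          (tailResidual (L.length - 2) tail t j) (t j)) ∧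
      IsRotatingDecomposition n L 1 m (β * tail⁻¹ * (t 0)⁻¹) b ∧
      (∀ i, 1 ≤ i → i ≤ m → IsRotatingNF n (omitStar L i) (b i) (V i)) ∧
      IsTailTwistedNF n L.dropLast (restrict k 1 (L.length - 1)) (t 0) (U 0) ∧
      (∀ j, 1 ≤ j → j ≤ L.length - 2 →
        IsTailTwistedNF n (tailPunctures L k j) (tailPerm L k j) (t j) (U j)) ∧
      W = ((List.range' 1 m).reverse.map V).flatten ++
        ((List.range (L.length - 1)).map U).flatten := by
  constructor
  · intro h
    cases h with
    | two => simp at h3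
    | step _ _ _ tail t m b _ V U hL htail ht0 ht hb hV hU0 hU hW =>
      exact ⟨tail, t, m, b, V, U, htail, ht0, ht, hb, hV, hU0, hU, hW⟩
  · rintro ⟨tail, t, m, b, V, U, htail, ht0, ht, hb, hV, hU0, hU, hW⟩
    exact .step L k β tail t m b W V U h3 htail ht0 ht hb hV hU0 hU hW

theorem IsTailTwistedNF.unique {L k : List ℕ} (hL : IsCircular n L) {β : BraidGroup n}
    {W W' : Word} (h : IsTailTwistedNF n L k β W) (h' : IsTailTwistedNF n L k β W') : W = W' := by
  induction h generalizing W' with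
  | two p q e =>
    obtain ⟨e', he, rfl⟩ := isTailTwistedNF_pair.1 h'
    rw [powWord_inj_of_eval hL.1 (by simpa using hL.nodup) he]
  | step L k β tail t m b W V U h3 htail ht0 ht hb hV hU0 hU hW ihU0 ihU =>
    obtain ⟨tail', t', m', b', V', U', htail', ht0', ht', hb', hV', hU0', hU', rfl⟩ :=
      (isTailTwistedNF_iff h3).1 h'
    have hdl : IsCircular n L.dropLast := hL.sublist (List.dropLast_sublist L)
    have htl : ∀ j, IsCircular n (tailPunctures L k j) := fun j =>
      hL.sublist (tailPunctures_sublist L k j)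
    obtain rfl := htail.unique (sup_le (hL.sublist (List.take_sublist _ _)).parabolic_le
      (hL.sublist (List.drop_sublist _ _)).parabolic_le) htail'
    have e0 := ht0.unique hdl.parabolic_le ht0'
    rw [← e0] at hb' hU0'
    -- Each t_j is defined from the t_l with l > j, so the induction runs downwards from r - 2.
    have et : ∀ d j, 1 ≤ j → j ≤ L.length - 2 → L.length - 2 - j = d → t j = t' j := by
      intro d
      induction d using Nat.strong_induction_on with
      | _ d ih =>
        intro j h1 hj hd
        refine (ht j h1 hj).unique (htl j).parabolic_le ?_
        have := ht' j h1 hj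
        rwa [← tailResidual_congr (t := t) fun l hl hla =>
          ih (L.length - 2 - l) (by omega) l (by omega) hla rfl] at this
    have eU : ∀ j, j < L.length - 1 → U j = U' j := by
      intro j hj
      rcases Nat.eq_zero_or_pos j with rfl | hj0
      · exact ihU0 hdl hU0'
      · refine ihU j hj0 (by omega) (htl j) ?_
        rw [et _ j hj0 (by omega) rfl]
        exact hU' j hj0 (by omega)
    rw [hW]
    congr 1
    · have key := hb.concat_eq hL (V := V) (V' := V') (by omega) (by omega) hb' hV hV'
        fun i _ _ _ x W₁ W₂ h1 h2 => h1.unique (hL.omitStar i) h2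
      rw [flatten_range'_reverse, flatten_range'_reverse]
      exact key
    · congr 1
      exact List.map_congr_left fun j hj => eU j (List.mem_range.1 hj)

/-! ### The Dehornoy ordering -/

/-- Multiplying by the part `β_{-1}` of a rotating normal form. -/
theorem IsRotatingNF.mul {L : List ℕ} (hL : IsCircular n L) (h3 : 3 ≤ L.length)
    {x y : BraidGroup n} {U V : Word} (hx : IsRotatingNF n L x U)
    (hx1 : IsMaxRightDivisor (parabolic n L) (parabolic n L.tail) x 1)
    (hy : y ∈ parabolic n L.tail) (hV : IsRotatingNF n L.tail y V) :
    IsRotatingNF n L (x * y) (U ++ V) := by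
  obtain ⟨t, m, b, U', V', ht, hb, hU', hV', rfl⟩ := (isRotatingNF_iff h3).1 hx
  obtain rfl := ht.unique hL.tail.parabolic_le hx1
  obtain rfl := hU'.eq_nil hL.tail
  have hxL : x ∈ parabolic n L := by simpa using hx1.2.1
  obtain ⟨y', hy'⟩ := exists_isMaxRightDivisor_parabolic hL.1 (List.tail_sublist L).subset
    (Submonoid.mul_mem _ hxL (parabolic_mono (List.tail_sublist L).subset hy))
  refine (isRotatingNF_iff h3).2 ⟨y, m, b, V, V', hx1.mul hL.tail.parabolic_le hy hy', ?_, hV,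
    hV', by rw [List.append_nil]⟩
  rwa [mul_inv_cancel_right, ← mul_one x, ← inv_one]

theorem restrict_dehornoy (r : ℕ) (h3 : 3 ≤ r) :
    restrict (dehornoy r) 1 (r - 1) = dehornoy (r - 1) := by
  rw [dehornoy, restrict_range' le_rfl (by omega) (by omega), dehornoy]

/-- With respect to the Dehornoy ordering, the tail twisted rotating normal form is the rotating
normal form. -/
theorem IsTailTwistedNF.isRotatingNF {L k : List ℕ} (hL : IsCircular n L)
    (hk : k = dehornoy L.length) {β : BraidGroup n} {W : Word} (h : IsTailTwistedNF n L k β W) :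
    IsRotatingNF n L β W := by
  induction h with
  | two p q e => exact .two p q e
  | step L k β tail t m b W V U h3 htail ht0 ht hb hV hU0 hU hW ihU0 ihU =>
    subst hk
    have hdl : IsCircular n L.dropLast := hL.sublist (List.dropLast_sublist L)
    have hdrop : ∀ j, IsCircular n (L.drop j) := fun j => hL.sublist (List.drop_sublist _ _)
    change ∀ j, 1 ≤ j → j ≤ L.length - 2 → IsMaxRightDivisor (parabolic n L) _
      (tailResidual (L.length - 2) tail t j) (t j) at ht
    -- As k(1) = 1, the left part of the tail sits on a single puncture and is trivial; β_Tail is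
    -- then β_{-1}.
    have he : entry (dehornoy L.length) 1 = 1 := entry_dehornoy le_rfl (by omega)
    rw [he, parabolic_eq_bot (I := L.take 1) (by rw [List.length_take]; omega), bot_sup_eq, List.drop_one] at htail
    replace ht : ∀ j, 1 ≤ j → j ≤ L.length - 2 →
        IsMaxRightDivisor (parabolic n L) (parabolic n (L.drop j))
          (tailResidual (L.length - 2) tail t j) (t j) := by
      intro j h1 hj
      rw [← (tailPunctures_dehornoy h1 hj).1]
      exact ht j h1 hj
    replace ihU : ∀ j, 1 ≤ j → j ≤ L.length - 2 → IsRotatingNF n (L.drop j) (t j) (U j) := by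
      intro j h1 hj
      have := ihU j h1 hj
      rw [(tailPunctures_dehornoy h1 hj).1, (tailPunctures_dehornoy h1 hj).2,
        List.length_drop] at this
      exact this (hdrop j) rfl
    replace ihU0 := ihU0 hdl (by
      rw [restrict_dehornoy _ h3, List.length_dropLast])
    obtain ⟨a, ha⟩ : ∃ a, L.length - 2 = a + 1 := ⟨L.length - 3, by omega⟩
    rw [ha] at ht ihU
    -- the last quotient is trivial
    have hres : ∀ d j, 1 ≤ j → j ≤ a + 1 → a + 1 - j = d →
        tailResidual (a + 1) tail t j ∈ parabolic n L.tail := by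
      intro d
      induction d with
      | zero =>
        intro j h1 hj hd
        obtain rfl : j = a + 1 := by omega
        rw [tailResidual_self]
        exact htail.1
      | succ d ih =>
        intro j h1 hj hd
        have h2 := ih (j + 1) (by omega) (by omega) (by omega)
        have h4 := ht (j + 1) (by omega) (by omega)
        have h5 := h4.2.1
        rw [← tailResidual_pred tail t (by omega)] at h5
        have h6 := tailResidual_pred tail t (show j < a + 1 by omega)
        rw [eq_mul_inv_iff_mul_eq] at h6
        rw [← h6] at h2
        exact (mem_parabolic_of_mul_mem hL.tail.1 (hL.parabolic_le h5)
          ((hdrop _).parabolic_le h4.1) h2).1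
    have h0 : tailResidual (a + 1) tail t 0 = 1 := by
      have h1 := ht 1 le_rfl (by omega)
      have h2 := hres a 1 le_rfl (by omega) (by omega)
      rw [List.drop_one] at h1
      rw [tailResidual_pred tail t (Nat.succ_pos a), zero_add,
        h1.eq_self hL.parabolic_le hL.tail.parabolic_le h2, mul_inv_cancel]
    -- the rotating normal form of the tail
    have hT : ∀ d j, 1 ≤ j → j ≤ a + 1 → a + 1 - j = d →
        (tailResidual (a + 1) tail t (j - 1))⁻¹ * tail ∈ parabolic n (L.drop j) ∧
        IsRotatingNF n (L.drop j) ((tailResidual (a + 1) tail t (j - 1))⁻¹ * tail)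
          ((List.range' j (d + 1)).map U).flatten := by
      intro d
      induction d with
      | zero =>
        intro j h1 hj hd
        obtain rfl : j = a + 1 := by omega
        have h4 := ht (a + 1) (by omega) le_rfl
        rw [Nat.add_sub_cancel, tailResidual_pred tail t (Nat.lt_succ_self a), tailResidual_self,
          mul_inv_rev, inv_inv, inv_mul_cancel_right]
        refine ⟨h4.1, ?_⟩
        simpa using ihU (a + 1) (by omega) le_rfl
      | succ d ih =>
        intro j h1 hj hd
        obtain ⟨h5, h6⟩ := ih (j + 1) (by omega) (by omega) (by omega)
        rw [Nat.add_sub_cancel] at h5 h6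
        have h7 : (tailResidual (a + 1) tail t (j - 1))⁻¹ * tail =
            t j * ((tailResidual (a + 1) tail t j)⁻¹ * tail) := by
          rw [tailResidual_pred tail t (show j - 1 < a + 1 by omega), Nat.sub_add_cancel h1,
            mul_inv_rev, inv_inv, mul_assoc]
        have hdd : L.drop (j + 1) = (L.drop j).tail := List.tail_drop.symm
        rw [hdd] at h5 h6
        -- A right divisor of t_j on the punctures of the next, smaller stage would also divide the
        -- quotient from which t_{j+1} has just been split off. So t_j has trivial β_{-1}, and the
        -- normal form of what follows it can simply be appended.
        have h8 : IsMaxRightDivisor (parabolic n (L.drop j)) (parabolic n (L.drop j).tail)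
            (t j) 1 := by
          refine isMaxRightDivisor_one (ht j h1 hj).1 fun γ hγ hM => ?_
          have h9 := (ht (j + 1) (by omega) (by omega)).mul_inv
          rw [← tailResidual_pred tail t (by omega), hdd] at h9
          refine h9.eq_one (hdrop j).tail.parabolic_le hγ ?_
          have h10 : tailResidual (a + 1) tail t j * γ⁻¹ =
              tailResidual (a + 1) tail t j * (t j)⁻¹ * (t j * γ⁻¹) := by group
          rw [h10]
          exact Submonoid.mul_mem _ (ht j h1 hj).2.1
            (parabolic_mono (List.drop_sublist _ _).subset hM)
        rw [h7, List.range'_succ, List.map_cons, List.flatten_cons]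
        refine ⟨Submonoid.mul_mem _ (ht j h1 hj).1
          (parabolic_mono (List.tail_sublist _).subset h5), ?_⟩
        exact (ihU j h1 hj).mul (hdrop j) (by rw [List.length_drop]; omega) h8 h5 h6
    have hT1 := (hT a 1 le_rfl (by omega) (by omega)).2
    rw [Nat.sub_self, h0, inv_one, one_mul, List.drop_one] at hT1
    rw [isRotatingDecomposition_iff] at hb
    -- Putting β_{T_0} in front as the term of index 0 makes the decomposition of β_Main the
    -- decomposition required of a rotating normal form.
    have hshift : ∀ i, residual (β * tail⁻¹) (fun i => if i = 0 then t 0 else b i) 0 (i + 1) =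
        residual (β * tail⁻¹ * (t 0)⁻¹) b 1 (i + 1) := by
      intro i
      induction i with
      | zero => rw [residual_succ _ _ le_rfl, residual_self, residual_self, if_pos rfl]
      | succ i ih =>
        rw [residual_succ _ _ (Nat.zero_le _), ih, residual_succ _ _ (Nat.le_add_left 1 i),
          if_neg (Nat.succ_ne_zero i)]
    refine (isRotatingNF_iff h3).2 ⟨tail, m, fun i => if i = 0 then t 0 else b i, _,
      fun i => if i = 0 then U 0 else V i, htail, isRotatingDecomposition_iff.2 ⟨?_, ?_⟩, hT1, ?_, ?_⟩
    · intro i _ hi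
      rcases i with _ | i
      · rw [omitStar_zero, residual_self, if_pos rfl]
        exact ht0
      · rw [hshift, if_neg (by omega)]
        exact hb.1 _ (by omega) hi
    · rw [hshift, hb.2]
    · intro i hi
      rcases i with _ | i
      · rw [omitStar_zero]
        exact ihU0
      · exact hV _ (by omega) hi
    · have hm : m + 1 = 1 + m := Nat.add_comm _ _
      have hr : L.length - 1 = a + 1 + 1 := by omega
      rw [hW, hm, concat_add, flatten_range'_reverse, hr, List.range_eq_range', List.range'_succ,
        List.map_cons, List.flatten_cons, ← List.append_assoc]
      congr 2
      · refine concat_congr fun i _ => ?_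
        rw [if_neg (by omega)]
      · simp [concat]

/-! ### Existence -/

/-- Right after the stage of `J`, the quotient has no right divisor on `J`. It exceeds `rest a` by a
factor in the two commuting monoids of `J` and `J'`, and such a factor cannot hide a divisor on `J`.
-/
theorem isMaxRightDivisor_one_of_stage {L k J J' : List ℕ} {a s : ℕ} {β : BraidGroup n}
    {g rest : ℕ → BraidGroup n} (hL : IsCircular n L) (hβ : β ∈ parabolic n L)
    (hg : IsGreedy n L (stage L k) β g rest) (hJ : J ⊆ L) (hJ' : J' ⊆ L) (hsep : Separated J J')
    (hs : stage L k s = J)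
    (hτ : (rest a)⁻¹ * rest (s + 1) ∈ parabolic n J ⊔ parabolic n J') :
    IsMaxRightDivisor (parabolic n L) (parabolic n J) (rest a) 1 := by
  have h1 := (hg.max s).mul_inv
  rw [← hg.succ, hs, ← mul_inv_cancel_left (rest a) (rest (s + 1))] at h1
  exact h1.of_mul_sup (parabolic_le_dualMonoid (hL.1.subset hJ)) (parabolic_mono hJ')
    (fun x hx y hy => hsep.commute (hL.1.subset hJ) (hL.1.subset hJ') hx hy) hτ
    (hg.rest_mem hβ a)

/-- With a = r - 2, the first a greedy factors are those of the tail. The point is that their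
product (rest a)⁻¹ β is the maximal right divisor β_Tail; stage a then gives β_{T_0}, and the stages
after it give β_Main. -/
theorem IsGreedy.isTailTwistedNF {L k : List ℕ} (hLk : IsConfiguration n L k) (h3 : 3 ≤ L.length)
    {β : BraidGroup n} (hβ : β ∈ parabolic n L) {g rest : ℕ → BraidGroup n}
    (h : IsGreedy n L (stage L k) β g rest) {w : ℕ → Word}
    (hw : ∀ s, IsTailTwistedNF n (stage L k s) (stagePerm L k s) (g s) (w s)) {S : ℕ}
    (hS : ∀ s, S ≤ s → w s = []) (hrest : ∀ s, S ≤ s → rest s = 1) :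
    IsTailTwistedNF n L k β (concat w S) := by
  have hL := hLk.circular
  have hk := hLk.perm
  obtain ⟨a, ha⟩ : ∃ a, L.length - 2 = a := ⟨_, rfl⟩
  have hsA : ∀ i, stage L k (a + i) = omitStar L i := fun i => by rw [← ha, stage_add]
  have hpA : ∀ i, stagePerm L k (a + i) = mainPerm L k i := fun i => by rw [← ha, stagePerm_add]
  have hsX : ∀ j, 1 ≤ j → j ≤ a → stage L k (a - j) = tailPunctures L k j := fun j h1 hj => by
    rw [← ha, stage_sub k h1 (by omega)]
  have hpX : ∀ j, 1 ≤ j → j ≤ a → stagePerm L k (a - j) = tailPerm L k j := fun j h1 hj => by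
    rw [← ha, stagePerm_sub k h1 (by omega)]
  set J := L.take (entry k 1) with hJ
  set J' := L.drop (entry k 1) with hJ'
  have hJL : J ⊆ L := (List.take_sublist _ _).subset
  have hJL' : J' ⊆ L := (List.drop_sublist _ _).subset
  have hsep : Separated J J' := IsCircular.separated (by rwa [hJ, hJ', List.take_append_drop])
  have hJd := parabolic_le_dualMonoid (hL.1.subset hJL)
  have hJd' := parabolic_le_dualMonoid (hL.1.subset hJL')
  have hcomm : ∀ x ∈ parabolic n J, ∀ y ∈ parabolic n J', x * y = y * x := fun x hx y hy =>
    hsep.commute (hL.1.subset hJL) (hL.1.subset hJL') hx hy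
  have hsupL : parabolic n J ⊔ parabolic n J' ≤ parabolic n L :=
    sup_le (parabolic_mono hJL) (parabolic_mono hJL')
  -- the quotients of the tail
  have hτ : ∀ d s, s ≤ a → a - s = d →
      (rest a)⁻¹ * rest s ∈ parabolic n J ⊔ parabolic n J' := by
    intro d
    induction d with
    | zero =>
      intro s hs hd
      obtain rfl : s = a := by omega
      rw [inv_mul_cancel]
      exact Submonoid.one_mem _
    | succ d ih =>
      intro s hs hd
      rw [h.rest_eq s, ← mul_assoc]
      refine Submonoid.mul_mem _ (ih (s + 1) (by omega) (by omega)) ?_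
      have h1 := (h.max s).1
      have h2 := hsX (a - s) (by omega) (by omega)
      rw [Nat.sub_sub_self hs] at h2
      rw [h2] at h1
      rcases tailPunctures_subset hk (j := a - s) (by omega) (by omega) with h4 | h4
      · exact Submonoid.mem_sup_left (parabolic_mono h4 h1)
      · exact Submonoid.mem_sup_right (parabolic_mono h4 h1)
  have hrestL := h.rest_mem hβ
  have hone : ∀ K : List ℕ, K.length ≤ 1 →
      IsMaxRightDivisor (parabolic n L) (parabolic n K) (rest a) 1 := fun K hK =>
    isMaxRightDivisor_one (hrestL a) fun γ hγ _ => by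
      rw [parabolic_eq_bot hK] at hγ
      exact Submonoid.mem_bot.1 hγ
  have he := hk.entry (i := 1) le_rfl (by omega)
  -- A one-puncture `J` carries no braids; otherwise `J` is some I_j and was exhausted at that
  -- stage. The same holds for `J'`.
  have hJ1 : IsMaxRightDivisor (parabolic n L) (parabolic n J) (rest a) 1 := by
    rcases Nat.lt_or_ge (entry k 1) 2 with h2 | h2
    · exact hone J (by rw [hJ, List.length_take]; omega)
    · obtain ⟨j, h1, hj, hjJ⟩ := exists_tailPunctures_eq_take hk h2 h3
      exact isMaxRightDivisor_one_of_stage hL hβ h hJL hJL' hsep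
        ((hsX j h1 (by omega)).trans hjJ) (hτ _ (a - j + 1) (by omega) rfl)
  have hJ1' : IsMaxRightDivisor (parabolic n L) (parabolic n J') (rest a) 1 := by
    rcases Nat.lt_or_ge L.length (entry k 1 + 2) with h2 | h2
    · exact hone J' (by rw [hJ', List.length_drop]; omega)
    · obtain ⟨j, h1, hj, hjJ⟩ := exists_tailPunctures_eq_drop hk h2 h3
      refine isMaxRightDivisor_one_of_stage hL hβ h hJL' hJL hsep.symm
        ((hsX j h1 (by omega)).trans hjJ) ?_
      rw [sup_comm]
      exact hτ _ (a - j + 1) (by omega) rfl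
  have hsup := hJ1.sup hJd hJd' (parabolic_mono hJL) hcomm hJ1'
  have hβeq : rest a * ((rest a)⁻¹ * β) = β := mul_inv_cancel_left _ _
  have htailmem : (rest a)⁻¹ * β ∈ parabolic n J ⊔ parabolic n J' := by
    have := hτ a 0 (Nat.zero_le _) rfl
    rwa [h.zero] at this
  have hβtail : β * ((rest a)⁻¹ * β)⁻¹ = rest a := by group
  have hT : ∀ j, j ≤ a → tailResidual a ((rest a)⁻¹ * β) (fun j => g (a - j)) j =
      (rest a)⁻¹ * rest (a - j) := by
    intro j hj
    induction hd : a - j generalizing j with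
    | zero =>
      obtain rfl : j = a := by omega
      rw [tailResidual_self, h.zero]
    | succ d ih =>
      rw [tailResidual_pred _ _ (by omega), ih (j + 1) (by omega) (by omega), h.succ,
        show a - (j + 1) = d by omega, mul_assoc]
  have hres : ∀ i, residual (rest (a + 1)) (fun i => g (a + i)) 1 (i + 1) = rest (a + (i + 1)) := by
    intro i
    induction i with
    | zero => rw [residual_self]
    | succ i ih => rw [residual_succ _ _ (by omega), ih, ← Nat.add_assoc a (i + 1) 1, h.succ]
  refine (isTailTwistedNF_iff h3).2 ⟨(rest a)⁻¹ * β, fun j => g (a - j), S, fun i => g (a + i),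
    fun i => w (a + i), fun j => w (a - j), ?_, ?_, ?_, ?_, ?_, ?_, ?_, ?_⟩
  · obtain ⟨τ, hτ'⟩ := exists_isMaxRightDivisor_sup hL.1 hJL hJL' hsep hβ
    rw [← hβeq] at hτ'
    have := hsup.mul (sup_le hJd hJd') htailmem hτ'
    rwa [hβeq] at this
  · have := h.max (a + 0)
    rw [hsA, omitStar_zero] at this
    rw [hβtail]
    exact this
  · intro j h1 hj
    rw [ha] at hj ⊢
    rw [hT j hj, ← hsX j h1 hj]
    -- The greedy factor is maximal in `rest (a - j)`, which is `rest a` times the current quotient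
    -- of the tail. As it divides that quotient, it is maximal there too.
    have h5 := h.max (a - j)
    rw [← mul_inv_cancel_left (rest a) (rest (a - j))] at h5
    refine h5.of_mul (hrestL a) (hsupL ?_)
    rw [mul_assoc, ← h.succ]
    exact hτ _ (a - j + 1) (by omega) rfl
  · rw [hβtail, isRotatingDecomposition_iff]
    have h5 : rest a * (g (a - 0))⁻¹ = rest (a + 1) := (h.succ a).symm
    rw [h5]
    refine ⟨fun i h1 hi => ?_, ?_⟩
    · obtain ⟨i, rfl⟩ : ∃ i', i = i' + 1 := ⟨i - 1, by omega⟩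
      rw [hres, ← hsA]
      exact h.max _
    · rw [hres]
      exact hrest _ (by omega)
  · intro i h1 hi
    have h5 := hw (a + i)
    rw [hsA, hpA, mainPerm, if_neg (by omega)] at h5
    exact h5.isRotatingNF (hL.omitStar i) (by rw [length_omitStar])
  · have h5 := hw (a + 0)
    rw [hsA, hpA, mainPerm, if_pos rfl, omitStar_zero] at h5
    exact h5
  · intro j h1 hj
    rw [ha] at hj
    have h5 := hw (a - j)
    rwa [hsX j h1 hj, hpX j h1 hj] at h5
  · have h5 : L.length - 1 = a + 1 := by omega
    rw [concat_eq_of_eventually (w := w) (T := S) (S := a + (1 + S)) (fun s hs => hS s (by omega)) hS,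
      ← Nat.add_assoc, concat_add, flatten_range'_reverse, h5, concat_succ, List.range_succ_eq_map,
      List.map_cons, List.flatten_cons, List.map_map]
    congr 1
    · refine concat_congr fun i _ => ?_
      rw [Nat.add_assoc]
    · congr 1
      have h6 : (fun j => w (a - j)) ∘ Nat.succ = fun j => w (a - (j + 1)) := rfl
      rw [h6]
      have h7 := flatten_range'_eq_concat (fun j => w (a - j)) a
      rw [List.range'_eq_map_range, List.map_map] at h7
      have h8 : (fun j => w (a - j)) ∘ (fun x => 1 + x) = fun j => w (a - (j + 1)) := by
        funext j
        rw [Function.comp_apply, Nat.add_comm 1 j]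
      rw [← h8]
      refine Eq.trans ?_ h7.symm
      refine concat_congr fun s hs => ?_
      rw [Nat.sub_sub_self hs.le]

theorem exists_eq_powWord {p q : ℕ} {W : Word} (hW : IsWordOn [p, q] W) :
    W = powWord p q W.length := by
  refine List.eq_replicate_of_mem fun x hx => ?_
  obtain ⟨h1, h2, h3⟩ := hW x hx
  simp only [List.mem_cons, List.not_mem_nil, or_false] at h1 h2
  ext <;> simp only <;> omega

/-- Every braid of `B_L^{+*}` has a tail twisted rotating normal form, and this word has the
maximal code. -/
theorem IsConfiguration.exists_normalForm {L k : List ℕ} (h : IsConfiguration n L k) :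
    ∀ β ∈ parabolic n L, ∃ W C, IsTailTwistedNF n L k β W ∧ IsMaximalCode n L k β W C := by
  refine IsConfiguration.induction ?_ ?_ h
  · intro p q hpq hLk β hβ
    obtain ⟨W, hW, rfl⟩ := exists_isWordOn hβ
    obtain ⟨e, rfl⟩ : ∃ e, W = powWord p q e := ⟨_, exists_eq_powWord hW⟩
    refine ⟨_, .int e, .two p q e, rfl, .two p q e, fun W' C' hW' hC' => ?_⟩
    obtain ⟨e', rfl, rfl⟩ := hasCode_pair.1 hC'
    rw [powWord_inj_of_eval hLk.circular.1 hpq hW']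
    exact .inl rfl
  · intro L k hLk h3 ih β hβ
    have hL := hLk.circular
    obtain ⟨g, rest, hg⟩ := exists_isGreedy hL.1 (stage_subset L k) hβ
    -- By induction each greedy factor has one word that is both its tail twisted form and the
    -- carrier of its maximal code, so a single concatenation serves both claims.
    choose w c hw hc using fun s => ih s (g s) (hg.max s).1
    obtain ⟨S, hS⟩ := hg.eventually_one hL.1
      (fun p hp q hq m => hLk.exists_mem_stage h3 hp hq m) (stage_subset L k) hβ
    have hnil : ∀ s, S ≤ s → w s = [] := fun s hs =>
      ((hLk.stage h3 s).1.hasCode_isWordOn (hc s).2.1).eq_nil (hLk.stage h3 s).1.circular.1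
        ((hc s).1.trans (hS s hs).2)
    exact ⟨concat w S, _, hg.isTailTwistedNF hLk h3 hβ hw hnil fun s hs => (hS s hs).1,
      hg.isMaximalCode hLk h3 hc hnil (hS S le_rfl).1⟩

end

end DualBraid

theorem mainTheorem4 (n : ℕ) (hn : 2 ≤ n) (k : List ℕ) (hk : k.Perm (List.range' 1 (n - 1)))
    (β : DualBraid.BraidGroup n) (hβ : β ∈ DualBraid.dualMonoid n) :
    ∃ W : DualBraid.Word,
      (∀ V : DualBraid.Word, DualBraid.IsCNormalForm n k β V ↔ V = W) ∧
      (∀ V : DualBraid.Word,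
        DualBraid.IsTailTwistedNF n (DualBraid.punctures n) k β V ↔ V = W) := by
  have hlen : (DualBraid.punctures n).length = n := List.length_range'
  have hcfg : DualBraid.IsConfiguration n (DualBraid.punctures n) k :=
    ⟨DualBraid.isCircular_punctures n, by rwa [hlen], by rwa [hlen]⟩
  obtain ⟨W, C, hW, hC⟩ := hcfg.exists_normalForm β hβ
  refine ⟨W, fun V => ⟨?_, ?_⟩, fun V => ⟨fun hV => hV.unique hcfg.circular hW, ?_⟩⟩
  · rintro ⟨hV, C', hC', hmax⟩
    exact DualBraid.IsMaximalCode.unique hcfg ⟨hV, hC', hmax⟩ hC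
  · rintro rfl
    exact ⟨hC.1, C, hC.2⟩
  · rintro rfl
    exact hW
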